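/- There is a universal constant $C>0$ such that the following holds. Let $d\ge 2$ and $n\ge 0$ be integers, let $Z_0$ be a deterministic self-adjoint $d\times d$ complex matrix, and let $Z_1,\ldots,Z_n$ be independent self-adjoint $d\times d$ complex random matrices with $\mathbf{E}[Z_i]=0$ whose entries have finite second moments. Put $X:=Z_0+\sum_{i=1}^n Z_i$. Let $G$ be the Gaussian model of $X$, that is, a self-adjoint $d\times d$ random matrix (possibly defined on another probability space) such that the real and imaginary parts of its entries are jointly Gaussian, $\mathbf{E}[G]=\mathbf{E}[X]$, and $\mathrm{Cov}(G)=\mathrm{Cov}(X)$, where $$\mathrm{Cov}(X)_{ij,kl}:=\mathbf{E}\big[(X-\mathbf{E}X)_{ij}\,\overline{(X-\mathbf{E}X)_{kl}}\big].$$ Denote by $\mathrm{tr}\,M:=\frac1d\mathrm{Tr}\,M$ the normalized trace, by $\|M\|$ the spectral norm, and by $|M|:=(M^*M)^{1/2}$ the absolute value of a matrix $M$, and define $$R_q(X):=\Big(\sum_{i=1}^n\mathbf{E}[\mathrm{tr}\,|Z_i|^q]\Big)^{1/q}\quad(q<\infty),\qquad R_\infty(X):=\Big\|\max_{1\le i\le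 n}\|Z_i\|\Big\|_\infty ,$$ with values in $[0,\infty]$ (and $R_\infty(X):=0$ if $n=0$). Then for every integer $p\ge 1$ and every $q$ with $2p\le q\le\infty$, $$\Big|\mathbf{E}[\mathrm{tr}\,X^{2p}]^{\frac1{2p}}-\mathbf{E}[\mathrm{tr}\,G^{2p}]^{\frac1{2p}}\Big|\le C\,R_q(X)\,p^2 .$$ Here $\mathbf{E}[\mathrm{tr}\,G^{2p}]<\infty$ always, and $\mathbf{E}[\mathrm{tr}\,X^{2p}]<\infty$ whenever $R_q(X)<\infty$; if $R_q(X)=\infty$ the bound is trivial. -/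

import Mathlib

open MeasureTheory ProbabilityTheory
open scoped ENNReal

noncomputable section

/-- The normalized trace `tr M = (1/d) Tr M`. -/
def ntr {d : ℕ} (M : Matrix (Fin d) (Fin d) ℂ) : ℂ :=
  (d : ℂ)⁻¹ * M.trace

/-- The absolute value `|M| = (M* M)^{1/2}` of a complex matrix. -/
def matAbs {d : ℕ} (M : Matrix (Fin d) (Fin d) ℂ) : Matrix (Fin d) (Fin d) ℂ :=
  cfc Real.sqrt (M.conjTranspose * M)

/-- The real power `|M|^q` of the absolute value, by functional calculus. -/
def matAbsPow {d : ℕ} (M : Matrix (Fin d) (Fin d) ℂ) (q : ℝ) : Matrix (Fin d) (Fin d) ℂ :=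
  cfc (fun x : ℝ => x ^ q) (matAbs M)

/-- The spectral norm (largest singular value): the operator norm on Euclidean space. -/
def specNorm {d : ℕ} (M : Matrix (Fin d) (Fin d) ℂ) : ℝ :=
  ‖Matrix.toEuclideanCLM (n := Fin d) (𝕜 := ℂ) M‖

/-- The entrywise expectation of a random matrix. -/
def matMean {d : ℕ} {Ω : Type*} [MeasurableSpace Ω] (μ : Measure Ω)
    (X : Ω → Matrix (Fin d) (Fin d) ℂ) : Matrix (Fin d) (Fin d) ℂ :=
  Matrix.of fun i j => ∫ ω, X ω i j ∂μ

/-- The `d² × d²` covariance matrix of the entries,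
`Cov(X)_{ij,kl} = E[(X - E X)_{ij} conj((X - E X)_{kl})]`. -/
def matCov {d : ℕ} {Ω : Type*} [MeasurableSpace Ω] (μ : Measure Ω)
    (X : Ω → Matrix (Fin d) (Fin d) ℂ) : Matrix (Fin d × Fin d) (Fin d × Fin d) ℂ :=
  Matrix.of fun a b =>
    ∫ ω, (X ω - matMean μ X) a.1 a.2 * (starRingEnd ℂ) ((X ω - matMean μ X) b.1 b.2) ∂μ

/-- The real vector of all real parts and imaginary parts of the entries of a matrix. -/
def reImEntries {d : ℕ} (M : Matrix (Fin d) (Fin d) ℂ) :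
    (Fin d × Fin d) ⊕ (Fin d × Fin d) → ℝ :=
  Sum.elim (fun a => (M a.1 a.2).re) (fun a => (M a.1 a.2).im)

/-- `G` (on `(Ω', ν)`) is a Gaussian model of the random matrix `X` (on `(Ω, μ)`): it is
self-adjoint, the real and imaginary parts of its entries are jointly Gaussian, and it has the
same mean and the same covariance as `X`. -/
structure IsGaussianModel {d : ℕ} {Ω Ω' : Type*} [MeasurableSpace Ω] [MeasurableSpace Ω']
    (μ : Measure Ω) (X : Ω → Matrix (Fin d) (Fin d) ℂ)
    (ν : Measure Ω') (G : Ω' → Matrix (Fin d) (Fin d) ℂ) : Prop where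
  isHermitian : ∀ ω, (G ω).IsHermitian
  gaussian : HasGaussianLaw (fun ω => reImEntries (G ω)) ν
  mean_eq : matMean ν G = matMean μ X
  cov_eq : matCov ν G = matCov μ X

/-- The parameter `R_q`, with values in `[0, ∞]`:
`(∑ i, E[tr |Z i|^q])^{1/q}` for `q < ∞`, and the essential supremum of `max_i ‖Z i‖` for
`q = ∞`. -/
def matR {d n : ℕ} {Ω : Type*} [MeasurableSpace Ω] (μ : Measure Ω)
    (Z : Fin n → Ω → Matrix (Fin d) (Fin d) ℂ) (q : ℝ≥0∞) : ℝ≥0∞ :=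
  if q = ∞ then essSup (fun ω => ⨆ i, ENNReal.ofReal (specNorm (Z i ω))) μ
  else (∑ i, ∫⁻ ω, ENNReal.ofReal (ntr (matAbsPow (Z i ω) q.toReal)).re ∂μ) ^ (1 / q.toReal)

end

/-! The engine is a rotation argument. Take independent pairs `(A i, A' i)`, centered, uncorrelated
within each pair and with equal second moments, and follow the moment of `X(θ) = Z₀ + ∑ W i`, where
`W i = cos θ A i + sin θ A' i`. Its derivative is `2p ∑ E tr W' i X^(2p-1)` with `W' i = -sin θ A i
+ cos θ A' i`. Write `X = Y i + W i`, with `Y i` independent of the `i`-th pair. Words with only the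
letter `W' i` vanish because it is centered, and words with a single further letter `W i` vanish
because `W' i` and `W i` are uncorrelated. What is left has at least three letters.

The remaining words are estimated by a reflection argument (`chessboard`) rather than by Hölder's
inequality for Schatten norms: words are controlled by the pure powers `∑ E tr W i^(2p)` and by `∑ E
tr W i Y i^(2p-2) W i`. Strong convexity of the trace of an even power (`retr_add_pow_ge`) bounds
the latter by `6 E tr X^(2p)` (`sum_integral_second_order_le`), with no loss in the number of
summands. Pure powers are small because `R_q ≤ R` implies `∑ E tr Z i^(2p) ≤ R^(2p-2) (R^2 + ∑ E tr
Z i^2)` (`sum_integral_pow_le_of_matR_le`), and the sum of second moments is itself at most the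
square of the moment norm of `X`. Hence the derivative of the moment norm, regularized at level `p
R`, is at most a multiple of `p^2 R` (`sum_drift_le`, `abs_moment_sub_le`).

The Gaussian model is reached without requiring such a bound for Gaussian copies of the individual
summands. Pairing two blocks of independent copies of the `Z i` and rotating by `π/4` passes from a
normalized sum of `N` copies of `X` to one of `2N` copies. At that stage the effective `R` is `R
N^(-1/4)`, so over repeated doublings the errors form a geometric series. For large `N` the copies
are replaced by copies of the centered Gaussian at a rotation angle `π/2`; the cost involves an
uncontrolled constant but tends to zero with `N`, and a normalized sum of Gaussian copies is
Gaussian with the same law (`abs_moment_sub_stable_le`, `map_iidCopies_gaussian_sum`). For `p = 1`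
the two moments coincide. -/

/-- The real part of the normalized trace. -/
noncomputable def retr {d : ℕ} (M : Matrix (Fin d) (Fin d) ℂ) : ℝ := (ntr M).re

/-! ### Trace identities and convexity inequalities for Hermitian matrices. -/

section Trace

variable {d : ℕ}

lemma retr_eq (M : Matrix (Fin d) (Fin d) ℂ) : retr M = (d : ℝ)⁻¹ * ∑ i, (M i i).re := by
  have : ((d : ℂ)⁻¹) = (((d : ℝ)⁻¹ : ℝ) : ℂ) := by push_cast; rfl
  rw [retr, ntr, this, Complex.re_ofReal_mul, Matrix.trace, Complex.re_sum]
  rfl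

lemma retr_add (M N : Matrix (Fin d) (Fin d) ℂ) : retr (M + N) = retr M + retr N := by
  simp [retr, ntr, mul_add]

lemma retr_zero : retr (0 : Matrix (Fin d) (Fin d) ℂ) = 0 := by simp [retr, ntr]

lemma retr_sub (M N : Matrix (Fin d) (Fin d) ℂ) : retr (M - N) = retr M - retr N := by
  simp [retr, ntr, mul_sub]

lemma retr_smul (c : ℝ) (M : Matrix (Fin d) (Fin d) ℂ) : retr (c • M) = c * retr M := by
  simp [retr_eq, Finset.mul_sum, mul_left_comm]

lemma retr_sum {ι : Type*} (s : Finset ι) (M : ι → Matrix (Fin d) (Fin d) ℂ) :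
    retr (∑ i ∈ s, M i) = ∑ i ∈ s, retr (M i) := by
  classical
  induction s using Finset.induction_on with
  | empty => simp [retr_zero]
  | insert a s ha ih => rw [Finset.sum_insert ha, Finset.sum_insert ha, retr_add, ih]

lemma retr_mul_comm (M N : Matrix (Fin d) (Fin d) ℂ) : retr (M * N) = retr (N * M) := by
  rw [retr, retr, ntr, ntr, Matrix.trace_mul_comm]

lemma retr_conjTranspose (M : Matrix (Fin d) (Fin d) ℂ) : retr M.conjTranspose = retr M := by
  simp [retr_eq]

lemma retr_conjTranspose_mul_self (M : Matrix (Fin d) (Fin d) ℂ) :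
    retr (M.conjTranspose * M) = (d : ℝ)⁻¹ * ∑ i, ∑ j, ‖M j i‖ ^ 2 := by
  rw [retr_eq]
  congr 1
  refine Finset.sum_congr rfl fun i _ => ?_
  rw [Matrix.mul_apply, Complex.re_sum]
  refine Finset.sum_congr rfl fun j _ => ?_
  rw [Matrix.conjTranspose_apply, Complex.star_def, mul_comm, Complex.mul_conj,
    Complex.normSq_eq_norm_sq, Complex.ofReal_re]

lemma retr_conjTranspose_mul_self_nonneg (M : Matrix (Fin d) (Fin d) ℂ) :
    0 ≤ retr (M.conjTranspose * M) := by
  rw [retr_conjTranspose_mul_self]; positivity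

/-- Both `U* - V` and `U* + V` have nonnegative Hilbert–Schmidt square. This is the Cauchy–Schwarz
inequality in the form that later reflects a word about its middle. -/
lemma abs_retr_mul_le (U V : Matrix (Fin d) (Fin d) ℂ) :
    |retr (U * V)| ≤ (retr (U * U.conjTranspose) + retr (V.conjTranspose * V)) / 2 := by
  have h1 := retr_conjTranspose_mul_self_nonneg (U.conjTranspose - V)
  have h2 := retr_conjTranspose_mul_self_nonneg (U.conjTranspose + V)
  have e : retr (V.conjTranspose * U.conjTranspose) = retr (U * V) := by
    rw [← Matrix.conjTranspose_mul, retr_conjTranspose]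
  simp only [Matrix.conjTranspose_sub, Matrix.conjTranspose_add, Matrix.conjTranspose_conjTranspose,
    mul_add, add_mul, mul_sub, sub_mul, retr_add, retr_sub, e] at h1 h2
  rw [abs_le]
  constructor <;> linarith

/-- A Hermitian matrix is unitarily diagonalized, together with its functional calculus. -/
lemma exists_diagonalization {A : Matrix (Fin d) (Fin d) ℂ} (hA : A.IsHermitian) :
    ∃ (U : Matrix (Fin d) (Fin d) ℂ) (l : Fin d → ℝ), U.conjTranspose * U = 1 ∧
      A = U * Matrix.diagonal (fun i => (l i : ℂ)) * U.conjTranspose ∧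
      ∀ f : ℝ → ℝ, cfc f A = U * Matrix.diagonal (fun i => (f (l i) : ℂ)) * U.conjTranspose := by
  refine ⟨hA.eigenvectorUnitary, hA.eigenvalues, ?_, ?_, fun f => ?_⟩
  · exact Unitary.coe_star_mul_self hA.eigenvectorUnitary
  · conv_lhs => rw [hA.spectral_theorem]
    rfl
  · rw [hA.cfc_eq]
    rfl

lemma diagonalization_pow {U : Matrix (Fin d) (Fin d) ℂ} (hU : U.conjTranspose * U = 1)
    (l : Fin d → ℝ) (m : ℕ) :
    (U * Matrix.diagonal (fun i => (l i : ℂ)) * U.conjTranspose) ^ m =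
      U * Matrix.diagonal (fun i => ((l i ^ m : ℝ) : ℂ)) * U.conjTranspose := by
  have hU' : U * U.conjTranspose = 1 := mul_eq_one_comm.mp hU
  induction m with
  | zero => simp [hU']
  | succ m ih =>
    rw [pow_succ, ih]
    calc _ = U * (Matrix.diagonal (fun i => ((l i ^ m : ℝ) : ℂ)) * (U.conjTranspose * U) *
          Matrix.diagonal (fun i => (l i : ℂ))) * U.conjTranspose := by
          simp only [mul_assoc]
      _ = _ := by
          rw [hU, mul_one, Matrix.diagonal_mul_diagonal]
          congr 3
          ext i
          push_cast
          ring

/-- Traces `tr A^m B^n` are integrals of `x^m y^n` against a common positive measure. -/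
lemma exists_joint_spectral {A B : Matrix (Fin d) (Fin d) ℂ} (hA : A.IsHermitian)
    (hB : B.IsHermitian) :
    ∃ (w : Fin d → Fin d → ℝ) (l m : Fin d → ℝ), (∀ j k, 0 ≤ w j k) ∧
      ∀ a b : ℕ, retr (A ^ a * B ^ b) = ∑ j, ∑ k, w j k * (l j ^ a * m k ^ b) := by
  obtain ⟨U, l, hU, hA', -⟩ := exists_diagonalization hA
  obtain ⟨V, m, hV, hB', -⟩ := exists_diagonalization hB
  -- The weights are the squared overlaps of the two eigenbases, divided by `d`.
  refine ⟨fun j k => (d : ℝ)⁻¹ * ‖(U.conjTranspose * V) j k‖ ^ 2, l, m,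
    fun j k => by positivity, fun a b => ?_⟩
  rw [hA', hB', diagonalization_pow hU, diagonalization_pow hV]
  set Q := U.conjTranspose * V with hQ
  have h1 : retr (U * Matrix.diagonal (fun i => ((l i ^ a : ℝ) : ℂ)) * U.conjTranspose *
      (V * Matrix.diagonal (fun i => ((m i ^ b : ℝ) : ℂ)) * V.conjTranspose)) =
      retr (Matrix.diagonal (fun i => ((l i ^ a : ℝ) : ℂ)) * (Q *
        Matrix.diagonal (fun i => ((m i ^ b : ℝ) : ℂ)) * Q.conjTranspose)) := by
    rw [show Q.conjTranspose = V.conjTranspose * U by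
      rw [hQ, Matrix.conjTranspose_mul, Matrix.conjTranspose_conjTranspose], hQ]
    rw [mul_assoc U, mul_assoc U, retr_mul_comm U]
    simp only [mul_assoc]
  rw [h1, retr_eq, Finset.mul_sum]
  refine Finset.sum_congr rfl fun j _ => ?_
  rw [Matrix.diagonal_mul, Complex.re_ofReal_mul, Matrix.mul_apply, Complex.re_sum, Finset.mul_sum,
    Finset.mul_sum]
  refine Finset.sum_congr rfl fun k _ => ?_
  rw [Matrix.mul_diagonal, Matrix.conjTranspose_apply, Complex.star_def, mul_right_comm,
    Complex.mul_conj, Complex.normSq_eq_norm_sq, ← Complex.ofReal_mul, Complex.ofReal_re]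
  ring

lemma retr_pow_two_mul_nonneg {A : Matrix (Fin d) (Fin d) ℂ} (hA : A.IsHermitian) (p : ℕ) :
    0 ≤ retr (A ^ (2 * p)) := by
  have := retr_conjTranspose_mul_self_nonneg (A ^ p)
  rwa [Matrix.conjTranspose_pow, hA.eq, ← pow_add, ← two_mul] at this

/-- Strong convexity of the trace of an even power. -/
lemma retr_add_pow_ge {Y W : Matrix (Fin d) (Fin d) ℂ} (hY : Y.IsHermitian)
    (hW : W.IsHermitian) {p : ℕ} (hp : 1 ≤ p) :
    retr (Y ^ (2 * p)) + 2 * p * retr (W * Y ^ (2 * p - 1)) + p * retr (W * Y ^ (2 * p - 2) * W)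
      ≤ retr ((Y + W) ^ (2 * p)) := by
  obtain ⟨r, rfl⟩ : ∃ r, p = r + 1 := ⟨p - 1, by omega⟩
  obtain ⟨w, l, m, hw, h⟩ := exists_joint_spectral (hY.add hW) hY
  set A := Y + W with hAdef
  -- After this substitution, cyclicity leaves only traces of the form `tr A^a Y^b`, so the joint
  -- spectral weights reduce the claim to a scalar inequality.
  have hWe : W = A - Y := by rw [hAdef]; abel
  have e1 : retr (W * Y ^ (2 * (r + 1) - 1)) =
      retr (A ^ 1 * Y ^ (2 * r + 1)) - retr (A ^ 0 * Y ^ (2 * r + 2)) := by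
    rw [show 2 * (r + 1) - 1 = 2 * r + 1 by omega, hWe, sub_mul, retr_sub, pow_one, pow_zero,
      one_mul, ← pow_succ']
  have e2 : retr (W * Y ^ (2 * (r + 1) - 2) * W) = retr (A ^ 2 * Y ^ (2 * r)) -
      2 * retr (A ^ 1 * Y ^ (2 * r + 1)) + retr (A ^ 0 * Y ^ (2 * r + 2)) := by
    rw [show 2 * (r + 1) - 2 = 2 * r by omega, mul_assoc, retr_mul_comm, mul_assoc, hWe]
    have : retr (Y ^ (2 * r) * ((A - Y) * (A - Y))) = retr (Y ^ (2 * r) * (A * A))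
        - retr (Y ^ (2 * r) * (A * Y)) - retr (Y ^ (2 * r) * (Y * A))
        + retr (Y ^ (2 * r) * (Y * Y)) := by
      simp only [sub_mul, mul_sub, retr_sub]; ring
    rw [this, pow_zero, one_mul, pow_one]
    have a1 : retr (Y ^ (2 * r) * (A * A)) = retr (A ^ 2 * Y ^ (2 * r)) := by
      rw [retr_mul_comm, pow_two A]
    have a2 : retr (Y ^ (2 * r) * (A * Y)) = retr (A * Y ^ (2 * r + 1)) := by
      rw [retr_mul_comm, mul_assoc, ← pow_succ']
    have a3 : retr (Y ^ (2 * r) * (Y * A)) = retr (A * Y ^ (2 * r + 1)) := by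
      rw [← mul_assoc, ← pow_succ, retr_mul_comm]
    have a4 : Y ^ (2 * r) * (Y * Y) = Y ^ (2 * r + 2) := by
      rw [pow_add, pow_two Y]
    rw [a1, a2, a3, a4]; ring
  have e3 : retr (Y ^ (2 * (r + 1))) = retr (A ^ 0 * Y ^ (2 * r + 2)) := by
    rw [pow_zero, one_mul]; congr 1
  have e4 : retr (A ^ (2 * (r + 1))) = retr (A ^ (2 * (r + 1)) * Y ^ 0) := by
    rw [pow_zero, mul_one]
  rw [e1, e2, e3, e4]
  simp only [h]
  rw [← sub_nonneg]
  -- The subtracted polynomial collapses to `y^(2p) + p y^(2p-2) (x^2 - y^2)`, so for `y ≠ 0` this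
  -- is Bernoulli's inequality for `(x/y)^2`.
  have key : ∀ x y : ℝ, 0 ≤ x ^ (2 * (r + 1)) * y ^ 0 - (x ^ 0 * y ^ (2 * r + 2)
      + 2 * ((r + 1 : ℕ) : ℝ) * (x ^ 1 * y ^ (2 * r + 1) - x ^ 0 * y ^ (2 * r + 2))
      + ((r + 1 : ℕ) : ℝ) * (x ^ 2 * y ^ (2 * r) - 2 * (x ^ 1 * y ^ (2 * r + 1))
      + x ^ 0 * y ^ (2 * r + 2))) := by
    intro x y
    rcases eq_or_ne y 0 with rfl | hy
    · rcases Nat.eq_zero_or_pos r with rfl | hr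
      · simp
      · have h0 : (2 * r) ≠ 0 := by omega
        simp only [ne_eq, h0, not_false_eq_true, zero_pow, pow_zero, Nat.add_eq_zero_iff,
          one_ne_zero, OfNat.ofNat_ne_zero, and_false, mul_zero, sub_zero, add_zero, mul_one]
        rw [pow_mul]; positivity
    · have b := one_add_mul_le_pow
        (show (-2 : ℝ) ≤ (x / y) ^ 2 - 1 by nlinarith [sq_nonneg (x / y)])
        (r + 1)
      have b' : 0 ≤ y ^ (2 * r + 2) * ((1 + ((x / y) ^ 2 - 1)) ^ (r + 1) -
          (1 + ((r + 1 : ℕ) : ℝ) * ((x / y) ^ 2 - 1))) := by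
        have hy' : 0 ≤ y ^ (2 * r + 2) := by
          rw [show 2 * r + 2 = 2 * (r + 1) by ring, pow_mul]; positivity
        exact mul_nonneg hy' (sub_nonneg.mpr b)
      have e : y ^ (2 * r + 2) * ((1 + ((x / y) ^ 2 - 1)) ^ (r + 1) -
          (1 + ((r + 1 : ℕ) : ℝ) * ((x / y) ^ 2 - 1))) = x ^ (2 * (r + 1)) - (y ^ (2 * r + 2)
          + ((r + 1 : ℕ) : ℝ) * (x ^ 2 * y ^ (2 * r) - y ^ (2 * r + 2))) := by
        rw [add_sub_cancel, ← pow_mul, div_pow]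
        field_simp
        ring
      rw [e] at b'
      refine b'.trans (le_of_eq ?_)
      ring
  simp only [Finset.mul_sum, ← Finset.sum_add_distrib, ← Finset.sum_sub_distrib]
  refine Finset.sum_nonneg fun j _ => Finset.sum_nonneg fun k _ => ?_
  refine (mul_nonneg (hw j k) (key (l j) (m k))).trans (le_of_eq ?_)
  ring

/-- Against the joint spectral weights this is `|x|^(2p-1) |y| ≤ x^(2p) + y^(2p)`, seen by comparing
`|x|` with `|y|`. It absorbs the deterministic part `Z₀` later on. -/
lemma retr_pow_le_of_convex {A B : Matrix (Fin d) (Fin d) ℂ} (hA : A.IsHermitian)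
    (hB : B.IsHermitian) {p : ℕ} (hp : 1 ≤ p) :
    -retr (A ^ (2 * p - 1) * B) ≤ retr (A ^ (2 * p)) + retr (B ^ (2 * p)) := by
  obtain ⟨r, rfl⟩ : ∃ r, p = r + 1 := ⟨p - 1, by omega⟩
  obtain ⟨w, l, m, hw, h⟩ := exists_joint_spectral hA hB
  have e1 : retr (A ^ (2 * (r + 1) - 1) * B) = retr (A ^ (2 * r + 1) * B ^ 1) := by
    rw [pow_one]; congr 2
  have e2 : retr (A ^ (2 * (r + 1))) = retr (A ^ (2 * r + 2) * B ^ 0) := by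
    rw [pow_zero, mul_one]; congr 1
  have e3 : retr (B ^ (2 * (r + 1))) = retr (A ^ 0 * B ^ (2 * r + 2)) := by
    rw [pow_zero, one_mul]; congr 1
  rw [e1, e2, e3, h, h, h, ← sub_nonneg, sub_neg_eq_add]
  simp only [← Finset.sum_add_distrib]
  refine Finset.sum_nonneg fun j _ => Finset.sum_nonneg fun k _ => ?_
  have key : ∀ x y : ℝ, 0 ≤ x ^ (2 * r + 2) * y ^ 0 + x ^ 0 * y ^ (2 * r + 2)
      + x ^ (2 * r + 1) * y ^ 1 := by
    intro x y
    have h1 : |x| ^ (2 * r + 2) = x ^ (2 * r + 2) := Even.pow_abs ⟨r + 1, by ring⟩ x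
    have h2 : |y| ^ (2 * r + 2) = y ^ (2 * r + 2) := Even.pow_abs ⟨r + 1, by ring⟩ y
    have h3 : -(|x| ^ (2 * r + 1) * |y|) ≤ x ^ (2 * r + 1) * y := by
      rw [← abs_pow, ← abs_mul]; exact neg_abs_le _
    have h4 : |x| ^ (2 * r + 1) * |y| ≤ |x| ^ (2 * r + 2) + |y| ^ (2 * r + 2) := by
      rcases le_total |x| |y| with hxy | hxy
      · calc |x| ^ (2 * r + 1) * |y| ≤ |y| ^ (2 * r + 1) * |y| := by gcongr
          _ = |y| ^ (2 * r + 2) := by rw [← pow_succ]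
          _ ≤ _ := le_add_of_nonneg_left (by positivity)
      · calc |x| ^ (2 * r + 1) * |y| ≤ |x| ^ (2 * r + 1) * |x| := by gcongr
          _ = |x| ^ (2 * r + 2) := by rw [← pow_succ]
          _ ≤ _ := le_add_of_nonneg_right (by positivity)
    rw [pow_zero, pow_zero, pow_one, ← h1, ← h2]
    linarith
  refine (mul_nonneg (hw j k) (key (l j) (m k))).trans (le_of_eq ?_)
  ring

/-- Midpoint convexity of the trace of an even power, in the form used for rotations. -/
lemma retr_rotation_pow_le {A B : Matrix (Fin d) (Fin d) ℂ} (hA : A.IsHermitian)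
    (hB : B.IsHermitian) {p : ℕ} (hp : 1 ≤ p) {a b : ℝ} (ha : |a| ≤ 1) (hb : |b| ≤ 1) :
    retr ((a • A + b • B) ^ (2 * p)) ≤
      2 ^ (2 * p) * (retr (A ^ (2 * p)) + retr (B ^ (2 * p))) := by
  set P := a • A with hP
  set Q := b • B with hQ
  have hPh : P.IsHermitian := by
    rw [Matrix.IsHermitian, hP, Matrix.conjTranspose_smul, hA.eq, star_trivial]
  have hQh : Q.IsHermitian := by
    rw [Matrix.IsHermitian, hQ, Matrix.conjTranspose_smul, hB.eq, star_trivial]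
  set S := (2 : ℝ)⁻¹ • (P + Q) with hS
  have hSh : S.IsHermitian := by
    rw [Matrix.IsHermitian, hS, Matrix.conjTranspose_smul, (hPh.add hQh).eq, star_trivial]
  set D := (2 : ℝ)⁻¹ • (P - Q) with hD
  have hDh : D.IsHermitian := by
    rw [Matrix.IsHermitian, hD, Matrix.conjTranspose_smul, (hPh.sub hQh).eq, star_trivial]
  have e1 : S + D = P := by
    rw [hS, hD, ← smul_add, add_add_sub_cancel, ← two_smul ℝ P, smul_smul]; norm_num
  have e2 : S + -D = Q := by
    rw [hS, hD, ← sub_eq_add_neg, ← smul_sub, add_sub_sub_cancel, ← two_smul ℝ Q, smul_smul]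
    norm_num
  have g : 0 ≤ retr (D * S ^ (2 * p - 2) * D) := by
    have := retr_conjTranspose_mul_self_nonneg (S ^ (p - 1) * D)
    rw [Matrix.conjTranspose_mul, Matrix.conjTranspose_pow, hSh.eq, hDh.eq, mul_assoc,
      ← mul_assoc (S ^ (p - 1)), ← pow_add, ← mul_assoc] at this
    rwa [show 2 * p - 2 = p - 1 + (p - 1) by omega]
  -- Strong convexity at the midpoint `S` in the directions `D` and `-D`: the linear terms cancel on
  -- adding, and the quadratic ones are nonnegative.
  have h1 := retr_add_pow_ge hSh hDh hp
  have h2 := retr_add_pow_ge hSh hDh.neg hp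
  rw [e1] at h1
  rw [e2] at h2
  have n1 : retr (-D * S ^ (2 * p - 1)) = -retr (D * S ^ (2 * p - 1)) := by
    rw [neg_mul, ← neg_one_smul ℝ, retr_smul]; ring
  have n2 : retr (-D * S ^ (2 * p - 2) * -D) = retr (D * S ^ (2 * p - 2) * D) := by
    simp only [neg_mul, mul_neg, neg_neg]
  rw [n1, n2] at h2
  have pS : P + Q = (2 : ℝ) • S := by rw [hS, smul_smul]; norm_num
  have hp0 : (0 : ℝ) ≤ p * retr (D * S ^ (2 * p - 2) * D) := by positivity
  have hmid : 2 * retr (S ^ (2 * p)) ≤ retr (P ^ (2 * p)) + retr (Q ^ (2 * p)) := by linarith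
  have scale : ∀ (c : ℝ) (M : Matrix (Fin d) (Fin d) ℂ), |c| ≤ 1 → M.IsHermitian →
      retr ((c • M) ^ (2 * p)) ≤ retr (M ^ (2 * p)) := by
    intro c M hc hM
    rw [smul_pow, retr_smul]
    refine mul_le_of_le_one_left (retr_pow_two_mul_nonneg hM p) ?_
    rw [pow_mul, ← sq_abs]
    exact pow_le_one₀ (by positivity) (pow_le_one₀ (abs_nonneg c) hc)
  have b1 := scale a A ha hA
  have b2 := scale b B hb hB
  rw [pS, smul_pow, retr_smul]
  have h0 := retr_pow_two_mul_nonneg hSh p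
  gcongr
  linarith

/-- The trace of `|A|^q` in terms of eigenvalues. -/
lemma exists_eigenvalues_retr {A : Matrix (Fin d) (Fin d) ℂ} (hA : A.IsHermitian) :
    ∃ l : Fin d → ℝ, (∀ q : ℝ, retr (matAbsPow A q) = (d : ℝ)⁻¹ * ∑ i, |l i| ^ q) ∧
      (∀ m : ℕ, retr (A ^ m) = (d : ℝ)⁻¹ * ∑ i, l i ^ m) ∧ ∀ i, |l i| ≤ specNorm A := by
  obtain ⟨U, l, hU, hA', hf⟩ := exists_diagonalization hA
  have tr : ∀ f : Fin d → ℝ, retr (U * Matrix.diagonal (fun i => (f i : ℂ)) * U.conjTranspose) =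
      (d : ℝ)⁻¹ * ∑ i, f i := by
    intro f
    rw [retr_mul_comm, ← mul_assoc, hU, one_mul, retr_eq]
    simp
  refine ⟨l, fun q => ?_, fun m => ?_, fun i => ?_⟩
  · have hsq : A.conjTranspose * A = cfc (fun x : ℝ => x ^ 2) A := by
      rw [hA.eq, ← pow_two, hf, ← diagonalization_pow hU, ← hA']
    have habs : matAbs A = cfc (fun x : ℝ => |x|) A := by
      rw [matAbs, hsq]
      refine (cfc_comp' Real.sqrt (fun x : ℝ => x ^ 2) A
        (Real.continuous_sqrt.continuousOn) ((continuous_pow 2).continuousOn) hA).symm.trans ?_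
      simp only [Real.sqrt_sq_eq_abs]
      rfl
    have hpow : matAbsPow A q = cfc (fun x : ℝ => |x| ^ q) A := by
      rw [matAbsPow, habs]
      refine (cfc_comp' (fun x : ℝ => x ^ q) (fun x : ℝ => |x|) A ?_
        (continuous_abs.continuousOn) hA).symm
      -- Any function is continuous on a finite spectrum, so no sign condition on `q` is needed.
      exact (Set.Finite.image _ (Matrix.finite_real_spectrum)).continuousOn _
    rw [hpow, hf, tr]
  · conv_lhs => rw [hA', diagonalization_pow hU, tr]
  · have hv : A.mulVec (fun j => U j i) = fun j => (l i : ℂ) * U j i := by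
      have : A * U = U * Matrix.diagonal (fun i => (l i : ℂ)) := by
        rw [hA', mul_assoc, hU, mul_one]
      ext j
      have := congrFun (congrFun this j) i
      rw [Matrix.mul_diagonal, Matrix.mul_apply] at this
      rw [Matrix.mulVec, dotProduct, this, mul_comm]
    set v : EuclideanSpace ℂ (Fin d) := WithLp.toLp 2 (fun j => U j i) with hvdef
    have hv1 : ‖v‖ ≠ 0 := by
      intro h0
      have h0' : v = 0 := norm_eq_zero.mp h0
      have h1 := congrFun (congrFun hU i) i
      rw [Matrix.mul_apply, Matrix.one_apply_eq] at h1
      have : ∀ j, U j i = 0 := fun j => by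
        have := congrArg (fun w : EuclideanSpace ℂ (Fin d) => w j) h0'
        simpa [hvdef] using this
      simp [this] at h1
    have happ : Matrix.toEuclideanCLM (n := Fin d) (𝕜 := ℂ) A v = (l i : ℂ) • v := by
      ext j
      have := congrFun hv j
      simpa [hvdef] using this
    have := (Matrix.toEuclideanCLM (n := Fin d) (𝕜 := ℂ) A).le_opNorm v
    rw [happ, norm_smul, Complex.norm_real, Real.norm_eq_abs] at this
    exact le_of_mul_le_mul_right this (lt_of_le_of_ne (norm_nonneg v) (Ne.symm hv1))

end Trace

/-! ### The chessboard estimate for cyclic reflection-positive functions on words. -/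

section Chessboard

variable {A : Type*}

/-- The number of non-`none` letters of a word. -/
def letterCount (w : List (Option A)) : ℕ := w.countP Option.isSome

lemma letterCount_append (u v : List (Option A)) :
    letterCount (u ++ v) = letterCount u + letterCount v := List.countP_append

lemma letterCount_reverse (u : List (Option A)) : letterCount u.reverse = letterCount u :=
  List.countP_reverse

lemma letterCount_cons_some (a : A) (u : List (Option A)) :
    letterCount (some a :: u) = letterCount u + 1 := by simp [letterCount]

lemma letterCount_cons_none (u : List (Option A)) :
    letterCount (none :: u) = letterCount u := by simp [letterCount]

lemma letterCount_nil : letterCount ([] : List (Option A)) = 0 := rfl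

lemma letterCount_replicate_none (n : ℕ) :
    letterCount (List.replicate n (none : Option A)) = 0 := by
  simp [letterCount, List.countP_replicate]

lemma letterCount_replicate_some (n : ℕ) (a : A) :
    letterCount (List.replicate n (some a)) = n := by
  simp [letterCount, List.countP_replicate]

lemma eq_replicate_of_letterCount_eq_zero {u : List (Option A)} (h : letterCount u = 0) :
    u = List.replicate u.length none := by
  rw [List.eq_replicate_iff]
  refine ⟨rfl, fun b hb => ?_⟩
  have := List.countP_eq_zero.mp h b hb
  simpa using this

lemma exists_split_last_letter {u : List (Option A)} (h : letterCount u ≠ 0) :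
    ∃ v a n, u = v ++ some a :: List.replicate n none := by
  induction u using List.reverseRecOn with
  | nil => exact absurd letterCount_nil h
  | append_singleton u x ih =>
    cases x with
    | some a => exact ⟨u, a, 0, by simp⟩
    | none =>
      rw [letterCount_append, letterCount_cons_none, letterCount_nil, add_zero] at h
      obtain ⟨v, a, n, rfl⟩ := ih h
      exact ⟨v, a, n + 1, by simp [List.replicate_succ']⟩

/-- A chessboard estimate: a reflection-positive cyclic function on words of length `2p` is
bounded on all words with at least two letters by its values on pure powers and on words with
two adjacent letters. -/
theorem chessboard [Finite A] {p : ℕ} (hp : 1 ≤ p) (t : List (Option A) → ℝ) {κ : ℝ}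
    (hrot : ∀ u v, t (u ++ v) = t (v ++ u))
    (hcs : ∀ u v, u.length = p → v.length = p →
      t (u ++ v) ≤ (t (u ++ u.reverse) + t (v.reverse ++ v)) / 2)
    (hpow : ∀ a, t (List.replicate (2 * p) (some a)) ≤ κ)
    (htwo : ∀ a, t (some a :: (List.replicate (2 * p - 2) none ++ [some a])) ≤ κ)
    {w : List (Option A)} (hw : w.length = 2 * p) (hc : 2 ≤ letterCount w) : t w ≤ κ := by
  by_contra hlt
  push Not at hlt
  set S : Set (List (Option A)) := {u | u.length = 2 * p ∧ 2 ≤ letterCount u} with hS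
  have hfin : S.Finite := (List.finite_length_eq (Option A) (2 * p)).subset fun u hu => hu.1
  -- There are finitely many words, so a maximizer exists; it is assumed to exceed `κ` and reflected
  -- until a contradiction appears.
  obtain ⟨m, hmS, hmax⟩ := hfin.exists_maximalFor t S ⟨w, hw, hc⟩
  have hmax' : ∀ u, u.length = 2 * p → 2 ≤ letterCount u → t u ≤ t m := fun u h1 h2 => by
    rcases le_total (t u) (t m) with h | h
    · exact h
    · exact hmax ⟨h1, h2⟩ h
  have hK : κ < t m := hlt.trans_le (hmax' w hw hc)
  -- A maximizer can be chosen with a run of `j` equal letters ending exactly at the middle;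
  -- reflection there doubles the run, hence `j` can be raised to `p`.
  have step : ∀ j, 1 ≤ j → j ≤ p → ∃ (a : A) (u v : List (Option A)),
      u.length = p - j ∧ v.length = p ∧ 2 ≤ letterCount (u ++ List.replicate j (some a) ++ v) ∧
      t (u ++ List.replicate j (some a) ++ v) = t m := by
    intro j hj
    induction j, hj using Nat.le_induction with
    | base =>
      intro _
      obtain ⟨v, a, n, rfl⟩ := exists_split_last_letter (u := m)
        (by have := hmS.2; omega)
      obtain ⟨l, hl⟩ := hmS
      simp only [List.length_append, List.length_cons, List.length_replicate] at l
      -- rotate so that the chosen letter sits at position `p - 1`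
      set z := List.replicate n (none : Option A) ++ v with hz
      have hzl : z.length = 2 * p - 1 := by simp [hz]; omega
      refine ⟨a, z.drop p, z.take p, by simp [hzl]; omega, by simp [hzl]; omega, ?_, ?_⟩
      · have : letterCount z = letterCount (z.take p) + letterCount (z.drop p) := by
          rw [← letterCount_append, List.take_append_drop]
        simp only [letterCount_append, letterCount_cons_some, letterCount_replicate_none,
          letterCount_replicate_some, hz] at hl this ⊢
        omega
      · rw [hrot, ← List.append_assoc, List.take_append_drop, hz, ← hrot,
          ← List.append_assoc, hrot]
        simp
    | succ j hj ih =>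
      intro hjp
      obtain ⟨a, u, v, hu, hv, hcount, ht⟩ := ih (by omega)
      have hul : (u ++ List.replicate j (some a)).length = p := by simp [hu]; omega
      by_cases hv0 : letterCount v = 0
      · -- all letters lie in one half: cut off the last one
        exfalso
        have hv' : v = List.replicate p none := by
          rw [eq_replicate_of_letterCount_eq_zero hv0, hv]
        obtain ⟨i, rfl⟩ : ∃ i, j = i + 1 := ⟨j - 1, by omega⟩
        set x := u ++ List.replicate i (some a) with hx
        have hxl : x.length = p - 1 := by simp [hx, hu]; omega
        have e : t m = t ((none :: x) ++ (some a :: List.replicate (p - 1) none)) := by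
          rw [← ht, hv', List.replicate_succ', hrot (none :: x),
            show List.replicate p (none : Option A) = List.replicate (p - 1) none ++ [none] by
              rw [← List.replicate_succ']; congr 1; omega]
          rw [show u ++ (List.replicate i (some a) ++ [some a]) ++
            (List.replicate (p - 1) none ++ [none]) =
              x ++ (some a :: List.replicate (p - 1) none ++ [none]) by simp [hx], hrot]
          simp
        have hcs' := hcs (none :: x) (some a :: List.replicate (p - 1) none)
          (by simp [hxl]; omega) (by simp; omega)
        have hcx : 1 ≤ letterCount x := by
          rw [hv', List.replicate_succ', letterCount_append, letterCount_append,
            letterCount_append, letterCount_replicate_none, letterCount_replicate_some,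
            letterCount_cons_some, letterCount_nil] at hcount
          rw [hx, letterCount_append, letterCount_replicate_some]
          omega
        have h1 := hmax' ((none :: x) ++ (none :: x).reverse)
          (by simp [hxl]; omega)
          (by rw [letterCount_append, letterCount_reverse, letterCount_cons_none]; omega)
        have h2 : t ((some a :: List.replicate (p - 1) none).reverse ++
            (some a :: List.replicate (p - 1) none)) ≤ κ := by
          rw [hrot]
          refine le_trans (le_of_eq ?_) (htwo a)
          congr 1
          simp only [List.reverse_cons, List.reverse_replicate, List.cons_append,
            ← List.append_assoc, ← List.replicate_add]
          congr 4
          omega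
        rw [e] at hK h1
        linarith
      -- Both reflected words still have at least two letters, so neither exceeds the maximum. Their
      -- average is at least the maximum, so the one containing the run is again a maximizer.
      · have hcs' := hcs _ v hul hv
        have h2 := hmax' (v.reverse ++ v) (by simp [hv]; omega)
          (by rw [letterCount_append, letterCount_reverse]; omega)
        have h1 := hmax' ((u ++ List.replicate j (some a)) ++
            (u ++ List.replicate j (some a)).reverse)
          (by rw [List.length_append, List.length_reverse, hul]; omega)
          (by rw [letterCount_append, letterCount_reverse, letterCount_append,
                letterCount_replicate_some]; omega)
        have heq : t ((u ++ List.replicate j (some a)) ++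
            (u ++ List.replicate j (some a)).reverse) = t m := by
          rw [ht] at hcs'; linarith
        obtain ⟨b, u', rfl⟩ : ∃ b u', u = b :: u' := by
          cases u with
          | nil => simp at hu; omega
          | cons b u' => exact ⟨b, u', rfl⟩
        obtain ⟨i, rfl⟩ : ∃ i, j = i + 1 := ⟨j - 1, by omega⟩
        have hu'l : u'.length = p - (i + 1 + 1) := by simp at hu; omega
        refine ⟨a, u', List.replicate i (some a) ++ (u'.reverse ++ [b, b]), hu'l, ?_, ?_, ?_⟩
        · simp [hu'l]; omega
        · simp only [letterCount_append, letterCount_replicate_some]; omega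
        · rw [← heq]
          have e1 : (b :: u' ++ List.replicate (i + 1) (some a)) ++
              (b :: u' ++ List.replicate (i + 1) (some a)).reverse = [b] ++
                (u' ++ (List.replicate (i + 1) (some a) ++ (List.replicate (i + 1) (some a) ++
                  (u'.reverse ++ [b])))) := by
            simp only [List.reverse_append, List.reverse_replicate, List.reverse_cons,
              List.cons_append, List.append_assoc, List.nil_append]
          have e2 : List.replicate (i + 1) (some a) ++ (List.replicate (i + 1) (some a) ++
              (u'.reverse ++ [b])) = List.replicate (i + 1 + 1) (some a) ++
                (List.replicate i (some a) ++ (u'.reverse ++ [b])) := by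
            simp only [← List.append_assoc, ← List.replicate_add]
            congr 3
            ring
          -- Rotating by one place shifts the doubled run so that `j + 1` of its letters end at the
          -- middle.
          rw [e1, e2, hrot [b]]
          congr 1
          simp only [List.append_assoc, List.cons_append, List.nil_append]
  obtain ⟨a, u, v, hu, hv, hcount, ht⟩ := step p hp le_rfl
  have hu0 : u = [] := by rw [← List.length_eq_zero_iff, hu]; omega
  subst hu0
  rw [List.nil_append] at ht hcount
  have hcs' := hcs (List.replicate p (some a)) v (by simp) hv
  have h1 : t (List.replicate p (some a) ++ (List.replicate p (some a)).reverse) ≤ κ := by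
    rw [List.reverse_replicate, ← List.replicate_add, ← two_mul]; exact hpow a
  -- If the right half has no letter, its reflection leaves the admissible class. Shifting by one
  -- place puts a single letter there: its reflection is a cyclic form of the two-letter word
  -- bounded by `κ`, and the other reflection is still admissible.
  by_cases hv0 : letterCount v = 0
  · obtain ⟨q, rfl⟩ : ∃ q, p = q + 1 := ⟨p - 1, by omega⟩
    have hv' : v = List.replicate (q + 1) none := by
      rw [eq_replicate_of_letterCount_eq_zero hv0, hv]
    have e : t m = t ((none :: List.replicate q (some a)) ++
        (some a :: List.replicate q none)) := by
      rw [← ht, hv', hrot (none :: _), List.replicate_succ' (n := q) (a := some a),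
        List.replicate_succ' (n := q) (a := none),
        show List.replicate q (some a) ++ [some a] ++ (List.replicate q none ++ [none]) =
          List.replicate q (some a) ++ (some a :: List.replicate q none ++ [none]) by simp, hrot]
      simp
    have hq : 1 ≤ q := by
      rw [letterCount_append, hv0, letterCount_replicate_some] at hcount; omega
    have hcs'' := hcs (none :: List.replicate q (some a)) (some a :: List.replicate q none)
      (by simp) (by simp)
    have h1 := hmax' ((none :: List.replicate q (some a)) ++
        (none :: List.replicate q (some a)).reverse) (by simp; omega)
      (by rw [letterCount_append, letterCount_reverse, letterCount_cons_none,
            letterCount_replicate_some]; omega)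
    have h2 : t ((some a :: List.replicate q none).reverse ++
        (some a :: List.replicate q none)) ≤ κ := by
      rw [hrot]
      refine le_trans (le_of_eq ?_) (htwo a)
      congr 1
      simp only [List.reverse_cons, List.reverse_replicate, List.cons_append,
        ← List.append_assoc, ← List.replicate_add]
      congr 4
      omega
    rw [e] at hK h1
    linarith
  · have h2 := hmax' (v.reverse ++ v) (by simp [hv]; omega)
      (by rw [letterCount_append, letterCount_reverse]; omega)
    rw [ht] at hcs'
    linarith

end Chessboard

/-! ### Polynomial domination and integrability of matrix products. -/

section Dominated

open scoped Matrix.Norms.Frobenius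

variable {d : ℕ} {Ω : Type*} [MeasurableSpace Ω]

lemma norm_entry_le_frobenius (M : Matrix (Fin d) (Fin d) ℂ) (a b : Fin d) : ‖M a b‖ ≤ ‖M‖ := by
  rw [Matrix.frobenius_norm_def, ← Real.sqrt_eq_rpow]
  refine Real.le_sqrt_of_sq_le ?_
  have h : ‖M a b‖ ^ 2 = ‖M a b‖ ^ (2 : ℝ) := by norm_num
  rw [h]
  refine le_trans ?_ (Finset.single_le_sum (f := fun i => ∑ j, ‖M i j‖ ^ (2 : ℝ))
    (fun i _ => by positivity) (Finset.mem_univ a))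
  exact Finset.single_le_sum (f := fun j => ‖M a j‖ ^ (2 : ℝ)) (fun i _ => by positivity)
    (Finset.mem_univ b)

lemma abs_retr_le_frobenius (M : Matrix (Fin d) (Fin d) ℂ) : |retr M| ≤ ‖M‖ := by
  rw [retr_eq, abs_mul, abs_of_nonneg (by positivity : (0 : ℝ) ≤ (d : ℝ)⁻¹)]
  have h : |∑ i, (M i i).re| ≤ d * ‖M‖ := by
    refine (Finset.abs_sum_le_sum_abs _ _).trans ?_
    refine (Finset.sum_le_sum fun i _ => (Complex.abs_re_le_norm _).trans
      (norm_entry_le_frobenius M i i)).trans ?_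
    simp
  rcases Nat.eq_zero_or_pos d with rfl | hd
  · simp
  · calc (d : ℝ)⁻¹ * |∑ i, (M i i).re| ≤ (d : ℝ)⁻¹ * (d * ‖M‖) := by gcongr
      _ = ‖M‖ := by field_simp

lemma norm_le_sum_entries (M : Matrix (Fin d) (Fin d) ℂ) : ‖M‖ ≤ ∑ a, ∑ b, ‖M a b‖ := by
  rw [Matrix.frobenius_norm_def, ← Real.sqrt_eq_rpow]
  refine Real.sqrt_le_iff.mpr ⟨by positivity, ?_⟩
  simp only [Real.rpow_two]
  calc ∑ a, ∑ b, ‖M a b‖ ^ 2 ≤ ∑ a, (∑ b, ‖M a b‖) ^ 2 :=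
        Finset.sum_le_sum fun a _ => Finset.sum_sq_le_sq_sum_of_nonneg fun b _ => norm_nonneg _
    _ ≤ _ := Finset.sum_sq_le_sq_sum_of_nonneg fun a _ => Finset.sum_nonneg fun b _ => norm_nonneg _

/-- A random matrix with measurable entries, of size at most a constant times `g ^ k`. -/
structure Dominated (g : Ω → ℝ) (k : ℕ) (M : Ω → Matrix (Fin d) (Fin d) ℂ) : Prop where
  meas : ∀ a b, Measurable fun ω => M ω a b
  bound : ∃ C, ∀ ω, ‖M ω‖ ≤ C * g ω ^ k

namespace Dominated

variable {g : Ω → ℝ} {k l : ℕ} {M N : Ω → Matrix (Fin d) (Fin d) ℂ}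

/-- The Frobenius norm is submultiplicative, so the exponents add: a word of length `2p` in letters
of exponent one is integrable as soon as `g ^ (2p)` is. -/
lemma mul (hM : Dominated g k M) (hN : Dominated g l N) :
    Dominated g (k + l) (fun ω => M ω * N ω) := by
  refine ⟨fun a b => ?_, ?_⟩
  · simp only [Matrix.mul_apply]
    exact Finset.measurable_sum _ fun j _ => (hM.meas a j).mul (hN.meas j b)
  · obtain ⟨C, hC⟩ := hM.bound
    obtain ⟨D, hD⟩ := hN.bound
    refine ⟨C * D, fun ω => (norm_mul_le _ _).trans ?_⟩
    calc ‖M ω‖ * ‖N ω‖ ≤ (C * g ω ^ k) * (D * g ω ^ l) :=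
          mul_le_mul (hC ω) (hD ω) (norm_nonneg _) ((norm_nonneg _).trans (hC ω))
      _ = _ := by ring

lemma add (hM : Dominated g k M) (hN : Dominated g k N) :
    Dominated g k (fun ω => M ω + N ω) := by
  refine ⟨fun a b => (hM.meas a b).add (hN.meas a b), ?_⟩
  obtain ⟨C, hC⟩ := hM.bound
  obtain ⟨D, hD⟩ := hN.bound
  refine ⟨C + D, fun ω => (norm_add_le _ _).trans ?_⟩
  rw [add_mul]
  exact add_le_add (hC ω) (hD ω)

lemma smul (c : ℝ) (hM : Dominated g k M) : Dominated g k (fun ω => c • M ω) := by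
  refine ⟨fun a b => ?_, ?_⟩
  · simp only [Matrix.smul_apply]
    exact (hM.meas a b).const_smul c
  · obtain ⟨C, hC⟩ := hM.bound
    refine ⟨|c| * C, fun ω => ?_⟩
    rw [norm_smul, Real.norm_eq_abs, mul_assoc]
    exact mul_le_mul_of_nonneg_left (hC ω) (abs_nonneg c)

lemma const (hg : ∀ ω, 1 ≤ g ω) (B : Matrix (Fin d) (Fin d) ℂ) (k : ℕ) :
    Dominated g k (fun _ => B) :=
  ⟨fun _ _ => measurable_const, ‖B‖, fun ω =>
    le_mul_of_one_le_right (norm_nonneg _) (one_le_pow₀ (hg ω))⟩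

lemma sum {ι : Type*} (hg : ∀ ω, 1 ≤ g ω) (s : Finset ι) {M : ι → Ω → Matrix (Fin d) (Fin d) ℂ}
    (hM : ∀ i ∈ s, Dominated g k (M i)) : Dominated g k (fun ω => ∑ i ∈ s, M i ω) := by
  classical
  induction s using Finset.induction_on with
  | empty => simpa using const hg 0 k
  | insert a s ha ih =>
    simp only [Finset.sum_insert ha]
    exact (hM a (by simp)).add (ih fun i hi => hM i (by simp [hi]))

lemma pow (hg : ∀ ω, 1 ≤ g ω) (hM : Dominated g 1 M) (n : ℕ) :
    Dominated g n (fun ω => M ω ^ n) := by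
  induction n with
  | zero => simpa using const hg 1 0
  | succ n ih => simpa only [pow_succ] using ih.mul hM

lemma list_prod {A : Type*} (hg : ∀ ω, 1 ≤ g ω) {L : A → Ω → Matrix (Fin d) (Fin d) ℂ}
    (hL : ∀ a, Dominated g 1 (L a)) (w : List A) :
    Dominated g w.length (fun ω => (w.map fun a => L a ω).prod) := by
  induction w with
  | nil => simpa using const hg 1 0
  | cons a w ih =>
    simp only [List.map_cons, List.prod_cons, List.length_cons]
    rw [add_comm]
    exact (hL a).mul ih

lemma measurable_retr (hM : Dominated g k M) : Measurable fun ω => retr (M ω) := by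
  simp only [retr_eq]
  exact (Finset.measurable_sum _ fun i _ => Complex.measurable_re.comp (hM.meas i i)).const_mul _

lemma integrable_of_norm_le {E : Type*} [NormedAddCommGroup E] {μ : Measure Ω}
    (hM : Dominated g k M) (hg : ∀ ω, 1 ≤ g ω) {r : ℕ} (hk : k ≤ r)
    (hint : Integrable (fun ω => g ω ^ r) μ) {f : Ω → E} (hf : AEStronglyMeasurable f μ)
    (hle : ∀ ω, ‖f ω‖ ≤ ‖M ω‖) : Integrable f μ := by
  obtain ⟨C, hC⟩ := hM.bound
  refine (hint.const_mul |C|).mono' hf (Filter.Eventually.of_forall fun ω => ?_)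
  have h0 : 0 ≤ g ω := zero_le_one.trans (hg ω)
  calc ‖f ω‖ ≤ C * g ω ^ k := (hle ω).trans (hC ω)
    _ ≤ |C| * g ω ^ r :=
      mul_le_mul (le_abs_self C) (pow_le_pow_right₀ (hg ω) hk) (by positivity) (abs_nonneg C)

lemma integrable_retr {μ : Measure Ω} (hM : Dominated g k M) (hg : ∀ ω, 1 ≤ g ω) {r : ℕ}
    (hk : k ≤ r) (hint : Integrable (fun ω => g ω ^ r) μ) :
    Integrable (fun ω => retr (M ω)) μ :=
  hM.integrable_of_norm_le hg hk hint hM.measurable_retr.aestronglyMeasurable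
    fun ω => abs_retr_le_frobenius (M ω)

lemma integrable_entry {μ : Measure Ω} (hM : Dominated g k M) (hg : ∀ ω, 1 ≤ g ω) {r : ℕ}
    (hk : k ≤ r) (hint : Integrable (fun ω => g ω ^ r) μ) (a b : Fin d) :
    Integrable (fun ω => M ω a b) μ :=
  hM.integrable_of_norm_le hg hk hint (hM.meas a b).aestronglyMeasurable
    fun ω => norm_entry_le_frobenius (M ω) a b

end Dominated

end Dominated

/-! ### Expected traces of words and the expansion of a perturbed power. -/

section Words

variable {d : ℕ} {Ω : Type*}

/-- The product of the random matrices spelled by a word. -/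
def wordProd {A : Type*} (L : A → Ω → Matrix (Fin d) (Fin d) ℂ) (w : List A) (ω : Ω) :
    Matrix (Fin d) (Fin d) ℂ := (w.map fun a => L a ω).prod

lemma wordProd_append {A : Type*} (L : A → Ω → Matrix (Fin d) (Fin d) ℂ) (u v : List A) (ω : Ω) :
    wordProd L (u ++ v) ω = wordProd L u ω * wordProd L v ω := by
  simp [wordProd]

lemma wordProd_replicate {A : Type*} (L : A → Ω → Matrix (Fin d) (Fin d) ℂ) (n : ℕ) (a : A)
    (ω : Ω) : wordProd L (List.replicate n a) ω = L a ω ^ n := by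
  simp [wordProd]

lemma wordProd_singleton {A : Type*} (L : A → Ω → Matrix (Fin d) (Fin d) ℂ) (a : A)
    (ω : Ω) : wordProd L [a] ω = L a ω := by
  simp [wordProd]

/-- Hermitian letters make reversal the adjoint; therefore palindromic words of even length have
nonnegative trace, which is the reflection positivity needed for `chessboard`. -/
lemma wordProd_reverse {A : Type*} (L : A → Ω → Matrix (Fin d) (Fin d) ℂ)
    (hL : ∀ a ω, (L a ω).IsHermitian) (w : List A) (ω : Ω) :
    wordProd L w.reverse ω = (wordProd L w ω).conjTranspose := by
  induction w with
  | nil => simp [wordProd]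
  | cons a w ih =>
    rw [List.reverse_cons, wordProd_append, ih, wordProd_singleton, ← List.singleton_append,
      wordProd_append, wordProd_singleton, Matrix.conjTranspose_mul, (hL a ω).eq]

variable [MeasurableSpace Ω] {ι A : Type*} [Fintype ι] {μ : Measure Ω} {g : Ω → ℝ} {p : ℕ}

/-- Hölder's inequality for words: a word with at least two letters is bounded through
pure powers and words with two adjacent letters. -/
theorem abs_sum_integral_word_le [Finite A] (hp : 1 ≤ p)
    {L : ι → Option A → Ω → Matrix (Fin d) (Fin d) ℂ}
    (hL : ∀ i a ω, (L i a ω).IsHermitian) (hg : ∀ ω, 1 ≤ g ω)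
    (hint : Integrable (fun ω => g ω ^ (2 * p)) μ) (hdom : ∀ i a, Dominated g 1 (L i a)) {κ : ℝ}
    (hpow : ∀ a, ∑ i, ∫ ω, retr (L i (some a) ω ^ (2 * p)) ∂μ ≤ κ)
    (htwo : ∀ a, ∑ i, ∫ ω, retr (L i (some a) ω * L i none ω ^ (2 * p - 2) * L i (some a) ω) ∂μ ≤ κ)
    {w : List (Option A)} (hw : w.length = 2 * p) (hc : 2 ≤ letterCount w) :
    |∑ i, ∫ ω, retr (wordProd (L i) w ω) ∂μ| ≤ κ := by
  have hI : ∀ i (u : List (Option A)), u.length = 2 * p →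
      Integrable (fun ω => retr (wordProd (L i) u ω)) μ := fun i u hu =>
    (Dominated.list_prod hg (hdom i) u).integrable_retr hg hu.le hint
  have hnn : ∀ i (u : List (Option A)) ω, 0 ≤ retr (wordProd (L i) (u ++ u.reverse) ω) := by
    intro i u ω
    rw [wordProd_append, wordProd_reverse _ (hL i), retr_mul_comm]
    exact retr_conjTranspose_mul_self_nonneg _
  have hnn' : ∀ i (u : List (Option A)) ω, 0 ≤ retr (wordProd (L i) (u.reverse ++ u) ω) := by
    intro i u ω
    rw [wordProd_append, wordProd_reverse _ (hL i)]
    exact retr_conjTranspose_mul_self_nonneg _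
  have hnn_sum : ∀ u : List (Option A),
      0 ≤ ∑ i, ∫ ω, retr (wordProd (L i) (u ++ u.reverse) ω) ∂μ :=
    fun u => Finset.sum_nonneg fun i _ => integral_nonneg fun ω => hnn i u ω
  have hnn_sum' : ∀ u : List (Option A),
      0 ≤ ∑ i, ∫ ω, retr (wordProd (L i) (u.reverse ++ u) ω) ∂μ :=
    fun u => Finset.sum_nonneg fun i _ => integral_nonneg fun ω => hnn' i u ω
  -- The estimate is run on the sum over `i` as a whole, since the hypotheses control only the
  -- summed quantities.
  refine chessboard hp (fun u => |∑ i, ∫ ω, retr (wordProd (L i) u ω) ∂μ|) ?_ ?_ ?_ ?_ hw hc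
  · intro u v
    simp only [wordProd_append]
    congr 1
    exact Finset.sum_congr rfl fun i _ => integral_congr_ae
      (Filter.Eventually.of_forall fun ω => retr_mul_comm _ _)
  · intro u v hu hv
    rw [abs_of_nonneg (hnn_sum u), abs_of_nonneg (hnn_sum' v), ← Finset.sum_add_distrib,
      Finset.sum_div]
    refine (Finset.abs_sum_le_sum_abs _ _).trans (Finset.sum_le_sum fun i _ => ?_)
    rw [← integral_add (hI i _ (by simp [hu]; omega)) (hI i _ (by simp [hv]; omega)),
      ← integral_div]
    refine (abs_integral_le_integral_abs).trans (integral_mono_of_nonneg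
      (Filter.Eventually.of_forall fun ω => abs_nonneg _)
      (((hI i _ (by simp [hu]; omega)).add (hI i _ (by simp [hv]; omega))).div_const 2)
      (Filter.Eventually.of_forall fun ω => ?_))
    simp only [wordProd_append, wordProd_reverse _ (hL i)]
    exact abs_retr_mul_le _ _
  · intro a
    simp only [wordProd_replicate]
    rw [abs_of_nonneg (Finset.sum_nonneg fun i _ => integral_nonneg fun ω =>
      retr_pow_two_mul_nonneg (hL i _ ω) p)]
    exact hpow a
  · intro a
    have e : some a :: (List.replicate (2 * p - 2) none ++ [some a]) =
        (some a :: List.replicate (p - 1) none) ++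
          (some a :: List.replicate (p - 1) none).reverse := by
      simp only [List.reverse_cons, List.reverse_replicate, List.cons_append]
      rw [← List.append_assoc, ← List.replicate_add]
      congr 3
      omega
    rw [e, abs_of_nonneg (hnn_sum _), ← e]
    refine le_trans (le_of_eq ?_) (htwo a)
    refine Finset.sum_congr rfl fun i _ => integral_congr_ae
      (Filter.Eventually.of_forall fun ω => ?_)
    simp only
    rw [← List.singleton_append, wordProd_append, wordProd_append, wordProd_singleton,
      wordProd_replicate, mul_assoc]

/-- Expansion of a power of a perturbed matrix: if the words with one or two letters vanish,
only the words with three letters contribute. -/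
theorem abs_sum_integral_mul_add_pow_le (hp : 1 ≤ p)
    {L : ι → Option Bool → Ω → Matrix (Fin d) (Fin d) ℂ}
    (hL : ∀ i a ω, (L i a ω).IsHermitian) (hg : ∀ ω, 1 ≤ g ω)
    (hint : Integrable (fun ω => g ω ^ (2 * p)) μ) (hdom : ∀ i a, Dominated g 1 (L i a)) {κ : ℝ}
    (hpow : ∀ a, ∑ i, ∫ ω, retr (L i (some a) ω ^ (2 * p)) ∂μ ≤ κ)
    (htwo : ∀ a, ∑ i, ∫ ω, retr (L i (some a) ω * L i none ω ^ (2 * p - 2) * L i (some a) ω) ∂μ ≤ κ)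
    (hone : ∀ i, ∫ ω, retr (L i (some true) ω * L i none ω ^ (2 * p - 1)) ∂μ = 0)
    (hzero : ∀ i b c, b + c + 2 = 2 * p → ∫ ω, retr (L i (some true) ω * L i none ω ^ b *
      L i (some false) ω * L i none ω ^ c) ∂μ = 0)
    {x : ℝ} (hx : 0 ≤ x) (hκ : 0 ≤ κ) :
    |∑ i, ∫ ω, retr (L i (some true) ω *
        (L i none ω + x • L i (some false) ω) ^ (2 * p - 1)) ∂μ| ≤
      (2 * p) ^ 2 * x ^ 2 * κ * (1 + x) ^ (2 * p) := by
  set P : ι → Ω → Matrix (Fin d) (Fin d) ℂ := fun i ω => L i none ω + x • L i (some false) ω with hP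
  have hPd : ∀ i, Dominated g 1 (P i) := fun i => (hdom i none).add ((hdom i _).smul x)
  set E : List (Option Bool) → ℕ → ℝ := fun w n =>
    ∑ i, ∫ ω, retr (wordProd (L i) w ω * P i ω ^ n) ∂μ with hE
  have hI : ∀ i (u : List (Option Bool)) n, u.length + n = 2 * p →
      Integrable (fun ω => retr (wordProd (L i) u ω * P i ω ^ n)) μ := fun i u n hu =>
    ((Dominated.list_prod hg (hdom i) u).mul ((hPd i).pow hg n)).integrable_retr hg hu.le hint
  -- Splitting the leftmost factor of the remaining power either appends `none` or appends `some
  -- false` at the cost of a factor `x`.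
  have hrec : ∀ (u : List (Option Bool)) n, u.length + (n + 1) = 2 * p →
      E u (n + 1) = E (u ++ [none]) n + x * E (u ++ [some false]) n := by
    intro u n hu
    simp only [hE]
    rw [Finset.mul_sum, ← Finset.sum_add_distrib]
    refine Finset.sum_congr rfl fun i _ => ?_
    rw [← integral_const_mul, ← integral_add (hI i _ n (by simp; omega))
      ((hI i _ n (by simp; omega)).const_mul x)]
    refine integral_congr_ae (Filter.Eventually.of_forall fun ω => ?_)
    simp only [wordProd_append, wordProd_singleton]
    rw [← retr_smul, ← retr_add]
    congr 1
    rw [pow_succ']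
    generalize P i ω ^ n = Q
    simp only [hP, mul_add, add_mul, mul_assoc, Matrix.mul_smul, Matrix.smul_mul]
  have h1x : 1 ≤ 1 + x := by linarith
  -- Once two letters are present, every full expansion is bounded by `κ`, and the weights of the
  -- remaining choices sum to `(1 + x) ^ n`.
  have hA : ∀ n (u : List (Option Bool)), u.length + n = 2 * p → 2 ≤ letterCount u →
      |E u n| ≤ κ * (1 + x) ^ n := by
    intro n
    induction n with
    | zero =>
      intro u hu hc
      simpa [hE] using abs_sum_integral_word_le hp hL hg hint hdom hpow htwo hu hc
    | succ n ih =>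
      intro u hu hc
      rw [hrec u n hu]
      have h1 := ih (u ++ [none]) (by simp; omega) (by rw [letterCount_append]; omega)
      have h2 := ih (u ++ [some false]) (by simp; omega) (by rw [letterCount_append]; omega)
      calc |E (u ++ [none]) n + x * E (u ++ [some false]) n|
          ≤ |E (u ++ [none]) n| + x * |E (u ++ [some false]) n| := by
            refine (abs_add_le _ _).trans ?_
            rw [abs_mul, abs_of_nonneg hx]
        _ ≤ κ * (1 + x) ^ n + x * (κ * (1 + x) ^ n) := by gcongr
        _ = κ * (1 + x) ^ (n + 1) := by ring
  -- With exactly two letters so far, the completion without a third vanishes by `hzero`; the place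
  -- of the third gives the factor `n * x`.
  have hB : ∀ n b c, b + c + 2 + n = 2 * p →
      |E ([some true] ++ List.replicate b none ++ [some false] ++ List.replicate c none) n| ≤
        n * x * κ * (1 + x) ^ n := by
    intro n
    induction n with
    | zero =>
      intro b c hbc
      have : E ([some true] ++ List.replicate b none ++ [some false] ++ List.replicate c none) 0 =
          0 := by
        simp only [hE, pow_zero, mul_one, wordProd_append, wordProd_singleton, wordProd_replicate]
        exact Finset.sum_eq_zero fun i _ => hzero i b c (by omega)
      rw [this]; simp
    | succ n ih =>
      intro b c hbc
      rw [hrec _ n (by simp; omega)]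
      have h1 := ih b (c + 1) (by omega)
      rw [List.replicate_succ', ← List.append_assoc] at h1
      have h2 := hA n ([some true] ++ List.replicate b none ++ [some false] ++
        List.replicate c none ++ [some false]) (by simp; omega)
        (by simp only [letterCount_append, letterCount_cons_some]; omega)
      refine (abs_add_le _ _).trans ?_
      rw [abs_mul, abs_of_nonneg hx]
      calc _ ≤ n * x * κ * (1 + x) ^ n + x * (κ * (1 + x) ^ n) := by gcongr
        _ = ((n + 1 : ℕ) : ℝ) * x * κ * (1 + x) ^ n := by push_cast; ring
        _ ≤ _ := by gcongr; omega
  -- With one letter so far, the completion without a second vanishes by `hone`; placing the second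
  -- and third gives `n ^ 2 * x ^ 2`.
  have hC : ∀ n b, b + 1 + n = 2 * p →
      |E ([some true] ++ List.replicate b none) n| ≤ (n : ℝ) ^ 2 * x ^ 2 * κ * (1 + x) ^ n := by
    intro n
    induction n with
    | zero =>
      intro b hb
      have : E ([some true] ++ List.replicate b none) 0 = 0 := by
        simp only [hE, pow_zero, mul_one, wordProd_append, wordProd_singleton, wordProd_replicate]
        refine Finset.sum_eq_zero fun i _ => ?_
        rw [show b = 2 * p - 1 by omega]
        exact hone i
      rw [this]; simp
    | succ n ih =>
      intro b hb
      rw [hrec _ n (by simp; omega)]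
      have h1 := ih (b + 1) (by omega)
      rw [List.replicate_succ', ← List.append_assoc] at h1
      have h2 := hB n b 0 (by omega)
      rw [List.replicate_zero, List.append_nil] at h2
      refine (abs_add_le _ _).trans ?_
      rw [abs_mul, abs_of_nonneg hx]
      calc _ ≤ (n : ℝ) ^ 2 * x ^ 2 * κ * (1 + x) ^ n + x * (n * x * κ * (1 + x) ^ n) := by gcongr
        _ = ((n : ℝ) ^ 2 + n) * x ^ 2 * κ * (1 + x) ^ n := by ring
        _ ≤ _ := by
          gcongr
          · push_cast; nlinarith [(Nat.cast_nonneg n : (0 : ℝ) ≤ n)]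
          · omega
  have h := hC (2 * p - 1) 0 (by omega)
  simp only [hE, List.replicate_zero, List.append_nil, wordProd_singleton] at h
  refine h.trans ?_
  have : ((2 * p - 1 : ℕ) : ℝ) ≤ 2 * p := by
    calc ((2 * p - 1 : ℕ) : ℝ) ≤ ((2 * p : ℕ) : ℝ) := by exact_mod_cast Nat.sub_le _ _
      _ = _ := by push_cast; ring
  gcongr
  omega

end Words

/-! ### Factorization of mixed traces under independence. -/

section Independence

variable {d : ℕ} {Ω : Type*} [MeasurableSpace Ω] {μ : Measure Ω} {g : Ω → ℝ}

open scoped Matrix.Norms.Frobenius in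
lemma Dominated.integrable_entry_mul {k l r : ℕ} {M N : Ω → Matrix (Fin d) (Fin d) ℂ}
    (hM : Dominated g k M) (hN : Dominated g l N) (hg : ∀ ω, 1 ≤ g ω) (hkl : k + l ≤ r)
    (hint : Integrable (fun ω => g ω ^ r) μ) (a b c e : Fin d) :
    Integrable (fun ω => M ω a b * N ω c e) μ := by
  obtain ⟨C, hC⟩ := hM.bound
  obtain ⟨D, hD⟩ := hN.bound
  refine (hint.const_mul |C * D|).mono' ((hM.meas a b).mul (hN.meas c e)).aestronglyMeasurable
    (Filter.Eventually.of_forall fun ω => ?_)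
  have h0 : 0 ≤ g ω := zero_le_one.trans (hg ω)
  rw [norm_mul]
  calc ‖M ω a b‖ * ‖N ω c e‖ ≤ (C * g ω ^ k) * (D * g ω ^ l) :=
        mul_le_mul ((norm_entry_le_frobenius _ a b).trans (hC ω))
          ((norm_entry_le_frobenius _ c e).trans (hD ω)) (norm_nonneg _)
          ((norm_nonneg _).trans (hC ω))
    _ = C * D * g ω ^ (k + l) := by ring
    _ ≤ |C * D| * g ω ^ r :=
      mul_le_mul (le_abs_self _) (pow_le_pow_right₀ (hg ω) hkl) (by positivity) (abs_nonneg _)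

lemma retr_mul_four (U P V Q : Matrix (Fin d) (Fin d) ℂ) :
    retr (U * P * V * Q) =
      (d : ℝ)⁻¹ * ∑ a, ∑ e, ∑ c, ∑ b, (U a b * V c e * (P b c * Q e a)).re := by
  rw [retr_eq]
  congr 1
  refine Finset.sum_congr rfl fun a _ => ?_
  rw [Matrix.mul_apply, Complex.re_sum]
  refine Finset.sum_congr rfl fun e _ => ?_
  rw [Matrix.mul_apply, Finset.sum_mul, Complex.re_sum]
  refine Finset.sum_congr rfl fun c _ => ?_
  rw [Matrix.mul_apply, Finset.sum_mul, Finset.sum_mul, Complex.re_sum]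
  refine Finset.sum_congr rfl fun b _ => ?_
  congr 1
  ring

/-- Mixed traces of two independent groups of matrices depend only on the second moments of the
first group. -/
lemma integral_retr_mul_four {k l r : ℕ} {U P V Q : Ω → Matrix (Fin d) (Fin d) ℂ}
    (hg : ∀ ω, 1 ≤ g ω) (hint : Integrable (fun ω => g ω ^ r) μ) (hr : 2 ≤ r) (hkl : k + l ≤ r)
    (hU : Dominated g 1 U) (hV : Dominated g 1 V) (hP : Dominated g k P) (hQ : Dominated g l Q)
    (hind : ∀ a b c e, IndepFun (fun ω => U ω a b * V ω c e) (fun ω => P ω b c * Q ω e a) μ) :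
    ∫ ω, retr (U ω * P ω * V ω * Q ω) ∂μ = (d : ℝ)⁻¹ * ∑ a, ∑ e, ∑ c, ∑ b,
      ((∫ ω, U ω a b * V ω c e ∂μ) * ∫ ω, P ω b c * Q ω e a ∂μ).re := by
  have hI1 : ∀ a b c e, Integrable (fun ω => U ω a b * V ω c e) μ :=
    fun a b c e => hU.integrable_entry_mul hV hg hr hint a b c e
  have hI2 : ∀ a b c e, Integrable (fun ω => P ω b c * Q ω e a) μ :=
    fun a b c e => hP.integrable_entry_mul hQ hg hkl hint b c e a
  have hI : ∀ a b c e, Integrable (fun ω => U ω a b * V ω c e * (P ω b c * Q ω e a)) μ :=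
    fun a b c e => (hind a b c e).integrable_mul (hI1 a b c e) (hI2 a b c e)
  have hre : ∀ a b c e, Integrable (fun ω => (U ω a b * V ω c e * (P ω b c * Q ω e a)).re) μ :=
    fun a b c e => (hI a b c e).re
  simp only [retr_mul_four]
  rw [integral_const_mul, integral_finsetSum _ fun a _ => integrable_finsetSum _ fun e _ =>
    integrable_finsetSum _ fun c _ => integrable_finsetSum _ fun b _ => hre a b c e]
  congr 1
  refine Finset.sum_congr rfl fun a _ => ?_
  rw [integral_finsetSum _ fun e _ =>
    integrable_finsetSum _ fun c _ => integrable_finsetSum _ fun b _ => hre a b c e]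
  refine Finset.sum_congr rfl fun e _ => ?_
  rw [integral_finsetSum _ fun c _ => integrable_finsetSum _ fun b _ => hre a b c e]
  refine Finset.sum_congr rfl fun c _ => ?_
  rw [integral_finsetSum _ fun b _ => hre a b c e]
  refine Finset.sum_congr rfl fun b _ => ?_
  rw [← (hind a b c e).integral_fun_mul_eq_mul_integral (hI1 a b c e).aestronglyMeasurable
    (hI2 a b c e).aestronglyMeasurable]
  exact integral_re (hI a b c e)

lemma measurable_pow_entry {S : Type*} [MeasurableSpace S] {M : S → Matrix (Fin d) (Fin d) ℂ}
    (hM : ∀ a b, Measurable fun y => M y a b) (n : ℕ) (a b : Fin d) :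
    Measurable fun y => (M y ^ n) a b := by
  induction n generalizing a b with
  | zero => simp
  | succ n ih =>
    simp only [pow_succ, Matrix.mul_apply]
    exact Finset.measurable_sum _ fun j _ => (ih a j).mul (hM j b)

end Independence

/-! ### Rotated sums and their second-moment structure. -/

section Rotation

variable {d : ℕ} {Ω ι : Type*}

/-- Independent pairs `(A i, A' i)` of centered self-adjoint random matrices, uncorrelated within
each pair and with equal second moments. -/
structure RotationPair [MeasurableSpace Ω] (μ : Measure Ω) (r : ℕ)
    (A A' : ι → Ω → Matrix (Fin d) (Fin d) ℂ) : Prop where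
  herm : ∀ i ω, (A i ω).IsHermitian
  herm' : ∀ i ω, (A' i ω).IsHermitian
  meas : ∀ i a b, Measurable fun ω => A i ω a b
  meas' : ∀ i a b, Measurable fun ω => A' i ω a b
  memLp : ∀ i a b, MemLp (fun ω => A i ω a b) r μ
  memLp' : ∀ i a b, MemLp (fun ω => A' i ω a b) r μ
  indep : iIndepFun (fun i ω => ((fun a b => A i ω a b : Fin d → Fin d → ℂ),
    (fun a b => A' i ω a b : Fin d → Fin d → ℂ))) μ
  mean : ∀ i a b, ∫ ω, A i ω a b ∂μ = 0
  mean' : ∀ i a b, ∫ ω, A' i ω a b ∂μ = 0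
  second : ∀ i a b c e, ∫ ω, A i ω a b * A i ω c e ∂μ = ∫ ω, A' i ω a b * A' i ω c e ∂μ
  cross : ∀ i a b c e, ∫ ω, A i ω a b * A' i ω c e ∂μ = 0

/-- The rotated summand `c A + s A'`. -/
noncomputable def rotW (A A' : ι → Ω → Matrix (Fin d) (Fin d) ℂ) (c s : ℝ) (i : ι) (ω : Ω) :
    Matrix (Fin d) (Fin d) ℂ := c • A i ω + s • A' i ω

/-- The rotated sum `Z₀ + ∑ i, (c A i + s A' i)`. -/
noncomputable def rotX [Fintype ι] (Z₀ : Matrix (Fin d) (Fin d) ℂ)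
    (A A' : ι → Ω → Matrix (Fin d) (Fin d) ℂ) (c s : ℝ) (ω : Ω) : Matrix (Fin d) (Fin d) ℂ := Z₀ + ∑ i, rotW A A' c s i ω

/-- The rotated sum without its `i`-th summand. -/
noncomputable def rotY [Fintype ι] [DecidableEq ι] (Z₀ : Matrix (Fin d) (Fin d) ℂ)
    (A A' : ι → Ω → Matrix (Fin d) (Fin d) ℂ) (c s : ℝ) (i : ι) (ω : Ω) : Matrix (Fin d) (Fin d) ℂ := Z₀ + ∑ j ∈ Finset.univ.erase i, rotW A A' c s j ω

/-- A function dominating all matrices in the rotation argument. -/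
noncomputable def rotG [Fintype ι] (A A' : ι → Ω → Matrix (Fin d) (Fin d) ℂ) (ω : Ω) : ℝ :=
  1 + ∑ i, ∑ a, ∑ b, (‖A i ω a b‖ + ‖A' i ω a b‖)

variable {Z₀ : Matrix (Fin d) (Fin d) ℂ} {A A' : ι → Ω → Matrix (Fin d) (Fin d) ℂ}

lemma rotY_add_rotW [Fintype ι] [DecidableEq ι] (Z₀ : Matrix (Fin d) (Fin d) ℂ)
    (A A' : ι → Ω → Matrix (Fin d) (Fin d) ℂ) (c s : ℝ) (i : ι) (ω : Ω) :
    rotY Z₀ A A' c s i ω + rotW A A' c s i ω = rotX Z₀ A A' c s ω := by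
  rw [rotX, rotY, add_assoc, Finset.sum_erase_add _ _ (Finset.mem_univ i)]

lemma one_le_rotG [Fintype ι] (A A' : ι → Ω → Matrix (Fin d) (Fin d) ℂ) (ω : Ω) :
    1 ≤ rotG A A' ω := by
  rw [rotG]
  exact le_add_of_nonneg_right (by positivity)

namespace RotationPair

variable [MeasurableSpace Ω] {μ : Measure Ω} {r : ℕ} (h : RotationPair μ r A A')
include h

lemma isHermitian_rotW (c s : ℝ) (i : ι) (ω : Ω) : (rotW A A' c s i ω).IsHermitian := by
  rw [Matrix.IsHermitian, rotW, Matrix.conjTranspose_add, Matrix.conjTranspose_smul,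
    Matrix.conjTranspose_smul, (h.herm i ω).eq, (h.herm' i ω).eq, star_trivial, star_trivial]

lemma isHermitian_sum_rotW (s' : Finset ι) (c s : ℝ) (ω : Ω) :
    (∑ i ∈ s', rotW A A' c s i ω).IsHermitian := by
  rw [Matrix.IsHermitian, Matrix.conjTranspose_sum]
  exact Finset.sum_congr rfl fun i _ => (h.isHermitian_rotW c s i ω).eq

variable [Fintype ι]

lemma integrable_rotG [IsProbabilityMeasure μ] :
    Integrable (fun ω => rotG A A' ω ^ r) μ := by
  have hm : MemLp (rotG A A') r μ := by
    refine (memLp_const (1 : ℝ)).add (memLp_finsetSum _ fun i _ => memLp_finsetSum _ fun a _ =>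
      memLp_finsetSum _ fun b _ => (h.memLp i a b).norm.add (h.memLp' i a b).norm)
  have := hm.integrable_norm_pow'
  refine this.congr (Filter.Eventually.of_forall fun ω => ?_)
  simp only
  rw [Real.norm_of_nonneg (zero_le_one.trans (one_le_rotG A A' ω))]

open scoped Matrix.Norms.Frobenius in
lemma dominated (i : ι) : Dominated (rotG A A') 1 (A i) := by
  refine ⟨h.meas i, 1, fun ω => ?_⟩
  refine (norm_le_sum_entries _).trans ?_
  rw [rotG, one_mul, pow_one]
  calc ∑ a, ∑ b, ‖A i ω a b‖ ≤ ∑ a, ∑ b, (‖A i ω a b‖ + ‖A' i ω a b‖) := by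
        gcongr; exact le_add_of_nonneg_right (norm_nonneg _)
    _ ≤ ∑ i, ∑ a, ∑ b, (‖A i ω a b‖ + ‖A' i ω a b‖) :=
      Finset.single_le_sum (f := fun i => ∑ a, ∑ b, (‖A i ω a b‖ + ‖A' i ω a b‖))
        (fun i _ => by positivity) (Finset.mem_univ i)
    _ ≤ _ := by linarith

open scoped Matrix.Norms.Frobenius in
lemma dominated' (i : ι) : Dominated (rotG A A') 1 (A' i) := by
  refine ⟨h.meas' i, 1, fun ω => ?_⟩
  refine (norm_le_sum_entries _).trans ?_
  rw [rotG, one_mul, pow_one]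
  calc ∑ a, ∑ b, ‖A' i ω a b‖ ≤ ∑ a, ∑ b, (‖A i ω a b‖ + ‖A' i ω a b‖) := by
        gcongr; exact le_add_of_nonneg_left (norm_nonneg _)
    _ ≤ ∑ i, ∑ a, ∑ b, (‖A i ω a b‖ + ‖A' i ω a b‖) :=
      Finset.single_le_sum (f := fun i => ∑ a, ∑ b, (‖A i ω a b‖ + ‖A' i ω a b‖))
        (fun i _ => by positivity) (Finset.mem_univ i)
    _ ≤ _ := by linarith

lemma dominated_rotW (c s : ℝ) (i : ι) : Dominated (rotG A A') 1 (rotW A A' c s i) :=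
  ((h.dominated i).smul c).add ((h.dominated' i).smul s)

lemma dominated_rotX (Z₀ : Matrix (Fin d) (Fin d) ℂ) (c s : ℝ) :
    Dominated (rotG A A') 1 (rotX Z₀ A A' c s) :=
  (Dominated.const (one_le_rotG A A') Z₀ 1).add
    (Dominated.sum (one_le_rotG A A') _ fun i _ => h.dominated_rotW c s i)

lemma isHermitian_rotX (hZ : Z₀.IsHermitian) (c s : ℝ) (ω : Ω) :
    (rotX Z₀ A A' c s ω).IsHermitian := hZ.add (h.isHermitian_sum_rotW _ c s ω)

lemma integral_rotW [IsProbabilityMeasure μ] (hr : 2 ≤ r) (c s : ℝ) (i : ι) (a b : Fin d) :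
    ∫ ω, rotW A A' c s i ω a b ∂μ = 0 := by
  have hI := (h.dominated i).integrable_entry (one_le_rotG A A') (by omega : 1 ≤ r)
    h.integrable_rotG a b
  have hI' := (h.dominated' i).integrable_entry (one_le_rotG A A') (by omega : 1 ≤ r)
    h.integrable_rotG a b
  simp only [rotW, Matrix.add_apply, Matrix.smul_apply]
  rw [integral_add (f := fun ω => c • A i ω a b) (g := fun ω => s • A' i ω a b) (hI.smul c)
    (hI'.smul s), integral_smul, integral_smul, h.mean, h.mean',
    smul_zero, smul_zero, add_zero]

/-- The cross moments vanish and the two diagonal ones agree, so only the inner product of the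
coefficient vectors remains. Orthogonality of `(-s, c)` and `(c, s)` thus makes the derivative
letter uncorrelated with the rotated letter. -/
lemma integral_rotW_mul_rotW [IsProbabilityMeasure μ] (hr : 2 ≤ r) (c s c' s' : ℝ) (i : ι)
    (a b e f : Fin d) :
    ∫ ω, rotW A A' c s i ω a b * rotW A A' c' s' i ω e f ∂μ =
      (c * c' + s * s' : ℝ) * ∫ ω, A i ω a b * A i ω e f ∂μ := by
  have hg := one_le_rotG A A'
  have hG := h.integrable_rotG
  have I1 := (h.dominated i).integrable_entry_mul (h.dominated i) hg hr hG a b e f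
  have I2 := (h.dominated i).integrable_entry_mul (h.dominated' i) hg hr hG a b e f
  have I3 := (h.dominated i).integrable_entry_mul (h.dominated' i) hg hr hG e f a b
  have I4 := (h.dominated' i).integrable_entry_mul (h.dominated' i) hg hr hG a b e f
  have e0 : ∀ ω, rotW A A' c s i ω a b * rotW A A' c' s' i ω e f =
      ((c * c' : ℝ) : ℂ) * (A i ω a b * A i ω e f) + ((c * s' : ℝ) : ℂ) * (A i ω a b * A' i ω e f)
      + (((s * c' : ℝ) : ℂ) * (A i ω e f * A' i ω a b)
        + ((s * s' : ℝ) : ℂ) * (A' i ω a b * A' i ω e f)) := by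
    intro ω
    simp only [rotW, Matrix.add_apply, Matrix.smul_apply, Complex.real_smul]
    push_cast
    ring
  simp only [e0]
  have J1 : Integrable (fun ω => ((c * c' : ℝ) : ℂ) * (A i ω a b * A i ω e f)) μ :=
    I1.const_mul _
  have J2 : Integrable (fun ω => ((c * s' : ℝ) : ℂ) * (A i ω a b * A' i ω e f)) μ :=
    I2.const_mul _
  have J3 : Integrable (fun ω => ((s * c' : ℝ) : ℂ) * (A i ω e f * A' i ω a b)) μ :=
    I3.const_mul _
  have J4 : Integrable (fun ω => ((s * s' : ℝ) : ℂ) * (A' i ω a b * A' i ω e f)) μ :=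
    I4.const_mul _
  have J12 : Integrable (fun ω => ((c * c' : ℝ) : ℂ) * (A i ω a b * A i ω e f) +
    ((c * s' : ℝ) : ℂ) * (A i ω a b * A' i ω e f)) μ := J1.add J2
  have J34 : Integrable (fun ω => ((s * c' : ℝ) : ℂ) * (A i ω e f * A' i ω a b) +
    ((s * s' : ℝ) : ℂ) * (A' i ω a b * A' i ω e f)) μ := J3.add J4
  rw [integral_add J12 J34, integral_add J1 J2, integral_add J3 J4, integral_const_mul,
    integral_const_mul, integral_const_mul, integral_const_mul, h.cross, h.cross, ← h.second]
  push_cast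
  ring

variable [DecidableEq ι]

lemma dominated_rotY (Z₀ : Matrix (Fin d) (Fin d) ℂ) (c s : ℝ) (i : ι) :
    Dominated (rotG A A') 1 (rotY Z₀ A A' c s i) :=
  (Dominated.const (one_le_rotG A A') Z₀ 1).add
    (Dominated.sum (one_le_rotG A A') _ fun i _ => h.dominated_rotW c s i)

lemma isHermitian_rotY (hZ : Z₀.IsHermitian) (c s : ℝ) (i : ι) (ω : Ω) :
    (rotY Z₀ A A' c s i ω).IsHermitian := hZ.add (h.isHermitian_sum_rotW _ c s ω)

/-- The sum without its `i`-th summand is independent of the `i`-th pair. -/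
lemma indepFun_rotY (c s : ℝ) (i : ι) :
    IndepFun (fun ω => ((fun a b => A i ω a b : Fin d → Fin d → ℂ),
      (fun a b => A' i ω a b : Fin d → Fin d → ℂ)))
      (fun ω a b => rotY Z₀ A A' c s i ω a b) μ := by
  have hm : ∀ i, Measurable fun ω => ((fun a b => A i ω a b : Fin d → Fin d → ℂ),
      (fun a b => A' i ω a b : Fin d → Fin d → ℂ)) := fun i =>
    (measurable_pi_lambda _ fun a => measurable_pi_lambda _ fun b => h.meas i a b).prodMk
      (measurable_pi_lambda _ fun a => measurable_pi_lambda _ fun b => h.meas' i a b)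
  have := h.indep.indepFun_finset {i} (Finset.univ.erase i) (by simp) hm
  have hφ : Measurable fun v : ({x // x ∈ ({i} : Finset ι)} →
      (Fin d → Fin d → ℂ) × (Fin d → Fin d → ℂ)) => v ⟨i, Finset.mem_singleton_self i⟩ :=
    measurable_pi_apply _
  have h2 := this.comp
    (φ := fun v : ({x // x ∈ ({i} : Finset ι)} → (Fin d → Fin d → ℂ) × (Fin d → Fin d → ℂ)) =>
      v ⟨i, Finset.mem_singleton_self i⟩)
    (ψ := fun (v : {x // x ∈ Finset.univ.erase i} → (Fin d → Fin d → ℂ) × (Fin d → Fin d → ℂ))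
      (a b : Fin d) => Z₀ a b + ∑ j : {x // x ∈ Finset.univ.erase i},
      (c • (v j).1 a b + s • (v j).2 a b))
    hφ
    (measurable_pi_lambda _ fun a => measurable_pi_lambda _ fun b => by fun_prop)
  refine h2.congr (Filter.Eventually.of_forall fun ω => rfl)
    (Filter.Eventually.of_forall fun ω => ?_)
  funext a b
  simp only [rotY, Matrix.add_apply, Function.comp_apply]
  congr 1
  rw [Matrix.sum_apply, ← Finset.sum_coe_sort (Finset.univ.erase i)]
  rfl

/-- Traces with at most two rotated summands, against powers of the remaining sum. -/
lemma integral_retr_rotW_rotW [IsProbabilityMeasure μ] (hr : 2 ≤ r) (c s c₁ s₁ c₂ s₂ : ℝ) (i : ι)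
    {k l : ℕ} (hkl : k + l ≤ r) :
    ∫ ω, retr (rotW A A' c₁ s₁ i ω * rotY Z₀ A A' c s i ω ^ k * rotW A A' c₂ s₂ i ω *
      rotY Z₀ A A' c s i ω ^ l) ∂μ = (c₁ * c₂ + s₁ * s₂) *
    ∫ ω, retr (A i ω * rotY Z₀ A A' c s i ω ^ k * A i ω * rotY Z₀ A A' c s i ω ^ l) ∂μ := by
  have hg := one_le_rotG A A'
  have hG := h.integrable_rotG
  have hY := h.dominated_rotY Z₀ c s i
  have hpow : ∀ b e e' a, Measurable fun y : Fin d → Fin d → ℂ =>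
      ((Matrix.of y) ^ k) b e * ((Matrix.of y) ^ l) e' a := fun b e e' a =>
    (measurable_pow_entry (fun a b => by
        simp only [Matrix.of_apply]; fun_prop) k b e).mul
      (measurable_pow_entry (fun a b => by
        simp only [Matrix.of_apply]; fun_prop) l e' a)
  have hind : ∀ (c₁ s₁ c₂ s₂ : ℝ) a b e f, IndepFun
      (fun ω => rotW A A' c₁ s₁ i ω a b * rotW A A' c₂ s₂ i ω e f)
      (fun ω => (rotY Z₀ A A' c s i ω ^ k) b e * (rotY Z₀ A A' c s i ω ^ l) f a) μ := by
    intro c₁ s₁ c₂ s₂ a b e f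
    refine (h.indepFun_rotY (Z₀ := Z₀) c s i).comp
      (φ := fun v : (Fin d → Fin d → ℂ) × (Fin d → Fin d → ℂ) =>
        (c₁ • v.1 a b + s₁ • v.2 a b) * (c₂ • v.1 e f + s₂ • v.2 e f))
      (ψ := fun y : Fin d → Fin d → ℂ => ((Matrix.of y) ^ k) b e * ((Matrix.of y) ^ l) f a) ?_
      (hpow b e f a)
    fun_prop
  -- Viewing `A i` as the rotation with coefficients `(1, 0)` makes both sides instances of the same
  -- factorization.
  have hA : ∀ ω, A i ω = rotW A A' 1 0 i ω := fun ω => by simp [rotW]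
  have h1 := integral_retr_mul_four hg hG hr hkl (h.dominated_rotW c₁ s₁ i)
    (h.dominated_rotW c₂ s₂ i) (hY.pow hg k) (hY.pow hg l) (hind c₁ s₁ c₂ s₂)
  have h2 := integral_retr_mul_four hg hG hr hkl (h.dominated_rotW 1 0 i)
    (h.dominated_rotW 1 0 i) (hY.pow hg k) (hY.pow hg l) (hind 1 0 1 0)
  rw [h1]
  simp only [hA]
  rw [h2, mul_left_comm]
  congr 1
  simp only [Finset.mul_sum]
  refine Finset.sum_congr rfl fun a _ => Finset.sum_congr rfl fun e _ =>
    Finset.sum_congr rfl fun f _ => Finset.sum_congr rfl fun b _ => ?_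
  rw [h.integral_rotW_mul_rotW hr, h.integral_rotW_mul_rotW hr, mul_assoc, Complex.re_ofReal_mul]
  norm_num

lemma integral_retr_rotW_pow [IsProbabilityMeasure μ] (hr : 2 ≤ r) (c s c₁ s₁ : ℝ) (i : ι)
    {k : ℕ} (hk : k ≤ r) :
    ∫ ω, retr (rotW A A' c₁ s₁ i ω * rotY Z₀ A A' c s i ω ^ k) ∂μ = 0 := by
  have hg := one_le_rotG A A'
  have hG := h.integrable_rotG
  have hY := h.dominated_rotY Z₀ c s i
  -- The identity matrices fill the unused slots, so that the four-factor formula also covers a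
  -- single summand.
  have hind : ∀ a b e f, IndepFun
      (fun ω => rotW A A' c₁ s₁ i ω a b * (1 : Matrix (Fin d) (Fin d) ℂ) e f)
      (fun ω => (rotY Z₀ A A' c s i ω ^ k) b e * (1 : Matrix (Fin d) (Fin d) ℂ) f a) μ := by
    intro a b e f
    have h0 : IndepFun (fun ω => rotW A A' c₁ s₁ i ω a b)
        (fun ω => (rotY Z₀ A A' c s i ω ^ k) b e) μ :=
      (h.indepFun_rotY (Z₀ := Z₀) c s i).comp
        (φ := fun v : (Fin d → Fin d → ℂ) × (Fin d → Fin d → ℂ) => c₁ • v.1 a b + s₁ • v.2 a b)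
        (ψ := fun y : Fin d → Fin d → ℂ => ((Matrix.of y) ^ k) b e) (by fun_prop)
        (measurable_pow_entry (fun a b => by simp only [Matrix.of_apply]; fun_prop) k b e)
    exact h0.comp (φ := fun z => z * (1 : Matrix (Fin d) (Fin d) ℂ) e f)
      (ψ := fun z => z * (1 : Matrix (Fin d) (Fin d) ℂ) f a)
      (measurable_id.mul_const _) (measurable_id.mul_const _)
  have h1 := integral_retr_mul_four hg hG hr (by omega : k + 0 ≤ r) (h.dominated_rotW c₁ s₁ i)
    (Dominated.const hg 1 1) (hY.pow hg k) (Dominated.const hg 1 0) hind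
  simp only [mul_one] at h1
  rw [h1]
  simp [integral_mul_const, h.integral_rotW hr]

end RotationPair

end Rotation

/-! ### Tangent-line and positivity inequalities for traces. -/

section Convexity

variable {d : ℕ}

/-- Each eigenvalue of `X ^ 2` satisfies the tangent-line inequality for `u ↦ u ^ p` at `a`, which
is Bernoulli again. In expectation, with `a` chosen later, it plays the role of Jensen's inequality.
-/
lemma retr_sq_tangent_le {X : Matrix (Fin d) (Fin d) ℂ} (hX : X.IsHermitian) (hd : d ≠ 0) {p : ℕ}
    (hp : 1 ≤ p) {a : ℝ} (ha : 0 ≤ a) :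
    p * a ^ (p - 1) * retr (X ^ 2) - (p - 1) * a ^ p ≤ retr (X ^ (2 * p)) := by
  obtain ⟨w, l, m, hw, h⟩ := exists_joint_spectral hX hX
  have e : ∀ k, retr (X ^ k) = ∑ i, ∑ j, w i j * l i ^ k := fun k => by
    simpa using h k 0
  have e1 : ∑ i, ∑ j, w i j = 1 := by
    have h0 := e 0
    simp only [pow_zero, mul_one] at h0
    rw [← h0, retr_eq]
    have : (d : ℝ) ≠ 0 := by exact_mod_cast hd
    simp [this]
  have key : ∀ x : ℝ, p * a ^ (p - 1) * x ^ 2 - (p - 1) * a ^ p ≤ x ^ (2 * p) := by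
    intro x
    obtain ⟨r, rfl⟩ : ∃ r, p = r + 1 := ⟨p - 1, by omega⟩
    rw [pow_mul]
    have hu : 0 ≤ x ^ 2 := sq_nonneg x
    generalize x ^ 2 = u at hu
    rw [Nat.add_sub_cancel]
    rcases ha.eq_or_lt with rfl | ha
    · rcases Nat.eq_zero_or_pos r with rfl | hr
      · simp
      · simp [hr.ne']; positivity
    · have b := one_add_mul_le_pow (show (-2 : ℝ) ≤ u / a - 1 by
        have := div_nonneg hu ha.le; linarith) (r + 1)
      rw [add_sub_cancel, div_pow, le_div_iff₀ (by positivity)] at b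
      refine le_trans (le_of_eq ?_) b
      have : u / a * a ^ (r + 1) = u * a ^ r := by
        rw [pow_succ]; field_simp
      push_cast
      linear_combination (-(r : ℝ) - 1) * this
  rw [e 2, e (2 * p)]
  calc p * a ^ (p - 1) * (∑ i, ∑ j, w i j * l i ^ 2) - (p - 1) * a ^ p
      = ∑ i, ∑ j, w i j * (p * a ^ (p - 1) * l i ^ 2 - (p - 1) * a ^ p) := by
        simp only [mul_sub, Finset.sum_sub_distrib, ← Finset.sum_mul, e1, one_mul]
        congr 1
        simp only [Finset.mul_sum, Finset.sum_mul]
        exact Finset.sum_congr rfl fun i _ => Finset.sum_congr rfl fun j _ => by ring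
    _ ≤ _ := Finset.sum_le_sum fun i _ => Finset.sum_le_sum fun j _ =>
        mul_le_mul_of_nonneg_left (key _) (hw i j)

lemma retr_mul_pow_mul_self_nonneg {W Y : Matrix (Fin d) (Fin d) ℂ} (hW : W.IsHermitian)
    (hY : Y.IsHermitian) (p : ℕ) : 0 ≤ retr (W * Y ^ (2 * p - 2) * W) := by
  have := retr_conjTranspose_mul_self_nonneg (Y ^ (p - 1) * W)
  rw [Matrix.conjTranspose_mul, Matrix.conjTranspose_pow, hW.eq, hY.eq, mul_assoc,
    ← mul_assoc (Y ^ (p - 1)), ← pow_add, ← mul_assoc] at this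
  rwa [show 2 * p - 2 = p - 1 + (p - 1) by omega]

end Convexity

/-! ### Lower bounds for the moments and control of second-order terms. -/

namespace RotationPair

variable {d : ℕ} {Ω ι : Type*} [MeasurableSpace Ω] [Fintype ι] {μ : Measure Ω}
  [IsProbabilityMeasure μ] {p : ℕ} {A A' : ι → Ω → Matrix (Fin d) (Fin d) ℂ}
  {Z₀ : Matrix (Fin d) (Fin d) ℂ} {c s : ℝ}

section General

variable (h : RotationPair μ (2 * p) A A')
include h

lemma integrable_retr_of_dominated {k : ℕ} {M : Ω → Matrix (Fin d) (Fin d) ℂ}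
    (hM : Dominated (rotG A A') k M) (hk : k ≤ 2 * p) : Integrable (fun ω => retr (M ω)) μ :=
  hM.integrable_retr (one_le_rotG A A') hk h.integrable_rotG

lemma integral_retr_rotW_mul_const (hp : 1 ≤ p) (c s : ℝ) (i : ι)
    (B : Matrix (Fin d) (Fin d) ℂ) : ∫ ω, retr (rotW A A' c s i ω * B) ∂μ = 0 := by
  have hg := one_le_rotG A A'
  have h1 := integral_retr_mul_four (P := fun _ => B) hg h.integrable_rotG (by omega)
    (by omega : 0 + 0 ≤ 2 * p) (h.dominated_rotW c s i) (Dominated.const hg 1 1)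
    (Dominated.const hg B 0) (Dominated.const hg 1 0)
    (fun a b e f => indepFun_const_right _ _)
  simp only [mul_one] at h1
  rw [h1]
  simp [integral_mul_const, h.integral_rotW (by omega : 2 ≤ 2 * p)]

lemma integral_retr_sum_mul_const (hp : 1 ≤ p) (c s : ℝ) (B : Matrix (Fin d) (Fin d) ℂ) :
    ∫ ω, retr ((∑ i, rotW A A' c s i ω) * B) ∂μ = 0 := by
  simp only [Finset.sum_mul, retr_sum]
  rw [integral_finsetSum _ fun i _ => h.integrable_retr_of_dominated
    ((h.dominated_rotW c s i).mul (Dominated.const (one_le_rotG A A') B 1)) (by omega)]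
  exact Finset.sum_eq_zero fun i _ => h.integral_retr_rotW_mul_const hp c s i B

lemma integrable_rotX_pow (Z₀ : Matrix (Fin d) (Fin d) ℂ) (c s : ℝ) {k : ℕ} (hk : k ≤ 2 * p) :
    Integrable (fun ω => retr (rotX Z₀ A A' c s ω ^ k)) μ :=
  h.integrable_retr_of_dominated ((h.dominated_rotX Z₀ c s).pow (one_le_rotG A A') k) hk

/-- Jensen's inequality for a convex trace function: expand at `Z₀`, drop the nonnegative quadratic
term, and use that the random part is centered. -/
lemma retr_pow_le_integral (hp : 1 ≤ p) (hZ : Z₀.IsHermitian) (c s : ℝ) :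
    retr (Z₀ ^ (2 * p)) ≤ ∫ ω, retr (rotX Z₀ A A' c s ω ^ (2 * p)) ∂μ := by
  have hW := Dominated.sum (one_le_rotG A A') Finset.univ fun i _ => h.dominated_rotW c s i
  have hI := h.integrable_retr_of_dominated
    (hW.mul (Dominated.const (one_le_rotG A A') (Z₀ ^ (2 * p - 1)) 1)) (by omega)
  have h0 : ∫ ω, (retr (Z₀ ^ (2 * p)) +
      2 * p * retr ((∑ i, rotW A A' c s i ω) * Z₀ ^ (2 * p - 1))) ∂μ = retr (Z₀ ^ (2 * p)) := by
    rw [integral_add (integrable_const _) (hI.const_mul _), integral_const_mul,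
      h.integral_retr_sum_mul_const hp]
    simp
  rw [← h0]
  refine integral_mono ((integrable_const _).add (hI.const_mul _))
    (h.integrable_rotX_pow Z₀ c s le_rfl) fun ω => ?_
  have h1 := retr_add_pow_ge hZ (h.isHermitian_sum_rotW Finset.univ c s ω) hp
  have h2 := retr_mul_pow_mul_self_nonneg (h.isHermitian_sum_rotW Finset.univ c s ω) hZ p
  have h3 : (0 : ℝ) ≤ p * retr ((∑ i, rotW A A' c s i ω) * Z₀ ^ (2 * p - 2) *
    ∑ i, rotW A A' c s i ω) := by positivity
  simp only [rotX]
  linarith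

lemma sum_integral_rotW_pow_le (hp : 1 ≤ p) (hc : |c| ≤ 1) (hs : |s| ≤ 1) :
    ∑ i, ∫ ω, retr (rotW A A' c s i ω ^ (2 * p)) ∂μ ≤
      2 ^ (2 * p) * (∑ i, ∫ ω, retr (A i ω ^ (2 * p)) ∂μ +
        ∑ i, ∫ ω, retr (A' i ω ^ (2 * p)) ∂μ) := by
  have hg := one_le_rotG A A'
  rw [← Finset.sum_add_distrib, Finset.mul_sum]
  refine Finset.sum_le_sum fun i _ => ?_
  have I1 := h.integrable_retr_of_dominated ((h.dominated i).pow hg (2 * p)) le_rfl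
  have I2 := h.integrable_retr_of_dominated ((h.dominated' i).pow hg (2 * p)) le_rfl
  rw [← integral_add I1 I2, ← integral_const_mul]
  exact integral_mono
    (h.integrable_retr_of_dominated ((h.dominated_rotW c s i).pow hg (2 * p)) le_rfl)
    ((I1.add I2).const_mul _) fun ω => retr_rotation_pow_le (h.herm i ω) (h.herm' i ω) hp hc hs

variable [DecidableEq ι]

/-- By strong convexity, the second-order terms of all summands are controlled by the moment
of the sum itself. -/
lemma sum_integral_second_order_le (hp : 1 ≤ p) (hZ : Z₀.IsHermitian) (c s : ℝ) :
    ∑ i, ∫ ω, retr (rotW A A' c s i ω * rotY Z₀ A A' c s i ω ^ (2 * p - 2) *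
      rotW A A' c s i ω) ∂μ ≤ 6 * ∫ ω, retr (rotX Z₀ A A' c s ω ^ (2 * p)) ∂μ := by
  have hg := one_le_rotG A A'
  have hp0 : (0 : ℝ) < p := by exact_mod_cast hp
  have hX := h.dominated_rotX Z₀ c s
  have IX := h.integrable_rotX_pow Z₀ c s (le_refl (2 * p))
  have IWX : ∀ i, Integrable (fun ω => retr (rotW A A' c s i ω *
      rotX Z₀ A A' c s ω ^ (2 * p - 1))) μ := fun i =>
    h.integrable_retr_of_dominated ((h.dominated_rotW c s i).mul (hX.pow hg _)) (by omega)
  -- Strong convexity is applied at `Y` in direction `W` and at `X = Y + W` in direction `-W`, the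
  -- latter without its quadratic term. Adding cancels both moments, and the linear term at `Y` has
  -- mean zero by independence.
  have each : ∀ i, ∫ ω, retr (rotW A A' c s i ω * rotY Z₀ A A' c s i ω ^ (2 * p - 2) *
      rotW A A' c s i ω) ∂μ ≤ 2 * ∫ ω, retr (rotW A A' c s i ω *
        rotX Z₀ A A' c s ω ^ (2 * p - 1)) ∂μ := by
    intro i
    have hY := h.dominated_rotY Z₀ c s i
    have I2 := h.integrable_retr_of_dominated
      (((h.dominated_rotW c s i).mul (hY.pow hg (2 * p - 2))).mul (h.dominated_rotW c s i))
      (by omega)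
    have I1 := h.integrable_retr_of_dominated
      ((h.dominated_rotW c s i).mul (hY.pow hg (2 * p - 1))) (by omega)
    have z := h.integral_retr_rotW_pow (Z₀ := Z₀) (by omega) c s c s i
      (by omega : 2 * p - 1 ≤ 2 * p)
    have hle : ∫ ω, (2 * p * retr (rotW A A' c s i ω * rotY Z₀ A A' c s i ω ^ (2 * p - 1)) +
        p * retr (rotW A A' c s i ω * rotY Z₀ A A' c s i ω ^ (2 * p - 2) *
        rotW A A' c s i ω)) ∂μ ≤ ∫ ω, 2 * p * retr (rotW A A' c s i ω *
        rotX Z₀ A A' c s ω ^ (2 * p - 1)) ∂μ := by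
      refine integral_mono ((I1.const_mul _).add (I2.const_mul _)) ((IWX i).const_mul _)
        fun ω => ?_
      have hWh := h.isHermitian_rotW c s i ω
      have hXh := h.isHermitian_rotX hZ c s ω
      have h1 := retr_add_pow_ge (h.isHermitian_rotY hZ c s i ω) hWh hp
      have h2 := retr_add_pow_ge hXh hWh.neg hp
      have h3 := retr_mul_pow_mul_self_nonneg hWh.neg hXh p
      have h4 : (0 : ℝ) ≤ p * retr (-rotW A A' c s i ω * rotX Z₀ A A' c s ω ^ (2 * p - 2) *
        -rotW A A' c s i ω) := by positivity
      have e : rotX Z₀ A A' c s ω + -rotW A A' c s i ω = rotY Z₀ A A' c s i ω := by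
        rw [← rotY_add_rotW Z₀ A A' c s i ω, add_neg_cancel_right]
      have n1 : retr (-rotW A A' c s i ω * rotX Z₀ A A' c s ω ^ (2 * p - 1)) =
          -retr (rotW A A' c s i ω * rotX Z₀ A A' c s ω ^ (2 * p - 1)) := by
        rw [neg_mul, ← neg_one_smul ℝ, retr_smul]; ring
      rw [rotY_add_rotW] at h1
      rw [e, n1] at h2
      simp only
      linarith
    rw [integral_add (I1.const_mul _) (I2.const_mul _), integral_const_mul, z, mul_zero, zero_add,
      integral_const_mul, integral_const_mul, mul_comm (2 : ℝ), mul_assoc] at hle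
    exact le_of_mul_le_mul_left hle hp0
  refine (Finset.sum_le_sum fun i _ => each i).trans ?_
  rw [← Finset.mul_sum, ← integral_finsetSum _ fun i _ => IWX i]
  have IZX : Integrable (fun ω => retr (rotX Z₀ A A' c s ω ^ (2 * p - 1) * Z₀)) μ :=
    h.integrable_retr_of_dominated ((hX.pow hg _).mul (Dominated.const hg Z₀ 1)) (by omega)
  have e1 : ∀ ω, ∑ i, retr (rotW A A' c s i ω * rotX Z₀ A A' c s ω ^ (2 * p - 1)) =
      retr (rotX Z₀ A A' c s ω ^ (2 * p)) - retr (rotX Z₀ A A' c s ω ^ (2 * p - 1) * Z₀) := by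
    intro ω
    rw [← retr_sum, ← Finset.sum_mul, show ∑ i, rotW A A' c s i ω = rotX Z₀ A A' c s ω - Z₀ by
      rw [rotX]; abel, sub_mul, retr_sub, ← pow_succ', retr_mul_comm Z₀]
    congr 3
    omega
  simp only [e1]
  rw [integral_sub IX IZX]
  -- Since `∑ W i = X - Z₀`, only this term obstructs. It costs one moment of `X` and one of `Z₀`,
  -- the latter again at most a moment of `X`; three moments in all, doubled by `each`, give the
  -- constant `6`.
  have h5 : -∫ ω, retr (rotX Z₀ A A' c s ω ^ (2 * p - 1) * Z₀) ∂μ ≤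
      ∫ ω, retr (rotX Z₀ A A' c s ω ^ (2 * p)) ∂μ + retr (Z₀ ^ (2 * p)) := by
    rw [← integral_neg]
    have : ∫ ω, (retr (rotX Z₀ A A' c s ω ^ (2 * p)) + retr (Z₀ ^ (2 * p))) ∂μ =
        ∫ ω, retr (rotX Z₀ A A' c s ω ^ (2 * p)) ∂μ + retr (Z₀ ^ (2 * p)) := by
      rw [integral_add IX (integrable_const _)]; simp
    rw [← this]
    exact integral_mono IZX.neg (IX.add (integrable_const _)) fun ω =>
      retr_pow_le_of_convex (h.isHermitian_rotX hZ c s ω) hZ hp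
  have h6 := h.retr_pow_le_integral hp hZ c s
  linarith

/-- The summands are centered and independent, so `E tr X^2` is `tr Z₀^2` plus the sum of second
moments; Jensen raises this to the power `p`. It allows the variance in the bound on pure powers to
be replaced by the moment of `X`. -/
lemma sum_integral_sq_pow_le (hp : 1 ≤ p) (hd : d ≠ 0) (hZ : Z₀.IsHermitian)
    (hcs : c ^ 2 + s ^ 2 = 1) :
    (∑ i, ∫ ω, retr (A i ω ^ 2) ∂μ) ^ p ≤ ∫ ω, retr (rotX Z₀ A A' c s ω ^ (2 * p)) ∂μ := by
  have hg := one_le_rotG A A'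
  set σ := ∑ i, ∫ ω, retr (A i ω ^ 2) ∂μ with hσ
  have hσ0 : 0 ≤ σ := Finset.sum_nonneg fun i _ => integral_nonneg fun ω =>
    retr_pow_two_mul_nonneg (h.herm i ω) 1
  have IX2 := h.integrable_rotX_pow Z₀ c s (by omega : 2 ≤ 2 * p)
  have IWY : ∀ i, Integrable (fun ω => retr (rotW A A' c s i ω * rotY Z₀ A A' c s i ω)) μ :=
    fun i => h.integrable_retr_of_dominated
      ((h.dominated_rotW c s i).mul (h.dominated_rotY Z₀ c s i)) (by omega)
  have IWW : ∀ i, Integrable (fun ω => retr (rotW A A' c s i ω * rotW A A' c s i ω)) μ :=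
    fun i => h.integrable_retr_of_dominated
      ((h.dominated_rotW c s i).mul (h.dominated_rotW c s i)) (by omega)
  have IWZ : Integrable (fun ω => retr ((∑ i, rotW A A' c s i ω) * Z₀)) μ :=
    h.integrable_retr_of_dominated ((Dominated.sum hg Finset.univ fun i _ =>
      h.dominated_rotW c s i).mul (Dominated.const hg Z₀ 1)) (by omega)
  have e : ∀ ω, retr (rotX Z₀ A A' c s ω ^ 2) =
      ∑ i, (retr (rotW A A' c s i ω * rotY Z₀ A A' c s i ω) +
        retr (rotW A A' c s i ω * rotW A A' c s i ω)) +
      (retr ((∑ i, rotW A A' c s i ω) * Z₀) + retr (Z₀ ^ 2)) := by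
    intro ω
    have h1 : ∀ i, retr (rotW A A' c s i ω * rotY Z₀ A A' c s i ω) +
        retr (rotW A A' c s i ω * rotW A A' c s i ω) =
        retr (rotW A A' c s i ω * rotX Z₀ A A' c s ω) := by
      intro i
      rw [← retr_add, ← mul_add, rotY_add_rotW]
    simp only [h1]
    rw [← retr_sum, ← Finset.sum_mul, pow_two, pow_two]
    set S := ∑ i, rotW A A' c s i ω with hS
    have : rotX Z₀ A A' c s ω = Z₀ + S := rfl
    rw [this]
    simp only [mul_add, add_mul, retr_add]
    rw [retr_mul_comm Z₀ S]
    ring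
  have hmean : σ ≤ ∫ ω, retr (rotX Z₀ A A' c s ω ^ 2) ∂μ := by
    simp only [e]
    have J1 : ∀ i, Integrable (fun ω => retr (rotW A A' c s i ω * rotY Z₀ A A' c s i ω) +
        retr (rotW A A' c s i ω * rotW A A' c s i ω)) μ := fun i => (IWY i).add (IWW i)
    have J2 : Integrable (fun ω => retr ((∑ i, rotW A A' c s i ω) * Z₀) + retr (Z₀ ^ 2)) μ :=
      IWZ.add (integrable_const _)
    rw [integral_add (integrable_finsetSum _ fun i _ => J1 i) J2,
      integral_add IWZ (integrable_const _), h.integral_retr_sum_mul_const hp,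
      integral_finsetSum _ fun i _ => J1 i]
    have e2 : ∀ i, ∫ ω, (retr (rotW A A' c s i ω * rotY Z₀ A A' c s i ω) +
        retr (rotW A A' c s i ω * rotW A A' c s i ω)) ∂μ = ∫ ω, retr (A i ω ^ 2) ∂μ := by
      intro i
      rw [integral_add (IWY i) (IWW i)]
      have z1 := h.integral_retr_rotW_pow (Z₀ := Z₀) (by omega) c s c s i
        (by omega : 1 ≤ 2 * p)
      have z2 := h.integral_retr_rotW_rotW (Z₀ := Z₀) (by omega) c s c s c s i
        (by omega : 0 + 0 ≤ 2 * p)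
      simp only [pow_one, pow_zero, mul_one] at z1 z2
      rw [z1, z2, ← pow_two, ← pow_two, hcs, one_mul, zero_add]
      simp only [pow_two]
    simp only [e2]
    have : 0 ≤ retr (Z₀ ^ 2) := retr_pow_two_mul_nonneg hZ 1
    simp only [integral_const, probReal_univ, smul_eq_mul, one_mul, zero_add]
    linarith
  clear_value σ
  -- The tangent is taken at `σ`, where replacing `E tr X^2` by its lower bound `σ` leaves exactly
  -- `σ ^ p`.
  have hle : ∫ ω, (p * σ ^ (p - 1) * retr (rotX Z₀ A A' c s ω ^ 2) - (p - 1) * σ ^ p) ∂μ ≤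
      ∫ ω, retr (rotX Z₀ A A' c s ω ^ (2 * p)) ∂μ :=
    integral_mono ((IX2.const_mul _).sub (integrable_const _))
      (h.integrable_rotX_pow Z₀ c s le_rfl) fun ω =>
        retr_sq_tangent_le (h.isHermitian_rotX hZ c s ω) hd hp hσ0
  rw [integral_sub (IX2.const_mul _) (integrable_const _), integral_const_mul] at hle
  simp only [integral_const, probReal_univ, smul_eq_mul, one_mul] at hle
  refine le_trans ?_ hle
  have h3 : p * σ ^ (p - 1) * σ ≤ p * σ ^ (p - 1) * ∫ ω, retr (rotX Z₀ A A' c s ω ^ 2) ∂μ :=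
    mul_le_mul_of_nonneg_left hmean (by positivity)
  have h4 : p * σ ^ (p - 1) * σ = p * σ ^ p := by
    rw [mul_assoc, ← pow_succ, Nat.sub_add_cancel hp]
  linarith

end General

end RotationPair

/-! ### The drift bound. -/

namespace RotationPair

section Drift

variable {d : ℕ} {Ω ι : Type*} [MeasurableSpace Ω] [Fintype ι] [DecidableEq ι] {μ : Measure Ω}
  [IsProbabilityMeasure μ] {p : ℕ} {A A' : ι → Ω → Matrix (Fin d) (Fin d) ℂ}
  {Z₀ : Matrix (Fin d) (Fin d) ℂ} {c s : ℝ}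

/-- The letters of the expansion of the drift, normalized by `x`. -/
noncomputable def driftLetter (Z₀ : Matrix (Fin d) (Fin d) ℂ)
    (A A' : ι → Ω → Matrix (Fin d) (Fin d) ℂ) (c s x : ℝ) (i : ι) :
    Option Bool → Ω → Matrix (Fin d) (Fin d) ℂ
  | none => rotY Z₀ A A' c s i
  | some false => fun ω => x⁻¹ • rotW A A' c s i ω
  | some true => fun ω => x⁻¹ • rotW A A' (-s) c i ω

lemma sum_drift_le (h : RotationPair μ (2 * p) A A') (hp : 2 ≤ p) (hd : d ≠ 0)
    (hZ : Z₀.IsHermitian) (hcs : c ^ 2 + s ^ 2 = 1) {R N : ℝ} (hR : 0 < R)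
    (hτ : ∑ i, ∫ ω, retr (A i ω ^ (2 * p)) ∂μ ≤
      R ^ (2 * p - 2) * (R ^ 2 + ∑ i, ∫ ω, retr (A i ω ^ 2) ∂μ))
    (hτ' : ∑ i, ∫ ω, retr (A' i ω ^ (2 * p)) ∂μ ≤
      R ^ (2 * p - 2) * (R ^ 2 + ∑ i, ∫ ω, retr (A i ω ^ 2) ∂μ))
    (hN : ∫ ω, retr (rotX Z₀ A A' c s ω ^ (2 * p)) ∂μ ≤ N ^ (2 * p)) (hRN : 16 * p * R ≤ N) :
    |∑ i, ∫ ω, retr (rotW A A' (-s) c i ω * rotX Z₀ A A' c s ω ^ (2 * p - 1)) ∂μ| ≤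
      576 * p ^ 2 * R * N ^ (2 * p - 1) := by
  have hg := one_le_rotG A A'
  have hp1 : 1 ≤ p := by omega
  have hpR : (2 : ℝ) ≤ p := by exact_mod_cast hp
  have hRN' : 32 * R ≤ N := le_trans (by nlinarith) hRN
  have hN0 : 0 < N := by linarith
  set σ := ∑ i, ∫ ω, retr (A i ω ^ 2) ∂μ with hσ
  have hσN : σ ≤ N ^ 2 := by
    have h1 := (h.sum_integral_sq_pow_le hp1 hd hZ hcs).trans hN
    rw [pow_mul] at h1
    exact le_of_pow_le_pow_left₀ (by omega) (by positivity) h1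
  have hcs' : (-s) ^ 2 + c ^ 2 = 1 := by linarith
  have ha : |c| ≤ 1 := by
    rw [← sq_le_one_iff_abs_le_one]; nlinarith [sq_nonneg s]
  have hb : |s| ≤ 1 := by
    rw [← sq_le_one_iff_abs_le_one]; nlinarith [sq_nonneg c]
  -- `κ` is exactly what the second-order terms need. The `8` makes `κ x^(2p) = 6 N^2 (8R)^(2p-2)`
  -- dominate the pure powers, which lose `2^(2p)` from the rotation and a further factor `4`.
  set x := 8 * R / N with hx
  have hx0 : 0 < x := by positivity
  have hxN : x * N = 8 * R := by rw [hx]; field_simp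
  set κ := 6 * N ^ (2 * p) / x ^ 2 with hκ
  have hκ0 : 0 ≤ κ := by positivity
  have hpowN : N ^ (2 * p) = N ^ (2 * p - 1) * N := by
    rw [← pow_succ]; congr 1; omega
  -- the normalized pure powers
  have hτW : ∀ c' s' : ℝ, |c'| ≤ 1 → |s'| ≤ 1 →
      (x⁻¹) ^ (2 * p) * ∑ i, ∫ ω, retr (rotW A A' c' s' i ω ^ (2 * p)) ∂μ ≤ κ := by
    intro c' s' hc' hs'
    have h1 := h.sum_integral_rotW_pow_le hp1 hc' hs'
    have h2 : ∑ i, ∫ ω, retr (rotW A A' c' s' i ω ^ (2 * p)) ∂μ ≤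
        2 ^ (2 * p) * (4 * (R ^ (2 * p - 2) * N ^ 2)) := by
      refine h1.trans (mul_le_mul_of_nonneg_left ?_ (by positivity))
      have : R ^ (2 * p - 2) * (R ^ 2 + σ) ≤ R ^ (2 * p - 2) * (2 * N ^ 2) := by
        have : R ^ 2 ≤ N ^ 2 := by gcongr; linarith
        gcongr
        linarith
      linarith
    have h3 : 2 ^ (2 * p) * (4 * (R ^ (2 * p - 2) * N ^ 2)) ≤ κ * x ^ (2 * p) := by
      obtain ⟨q, rfl⟩ : ∃ q, p = q + 2 := ⟨p - 2, by omega⟩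
      have e1 : κ * x ^ (2 * (q + 2)) = 6 * N ^ (2 * q + 4) * x ^ (2 * q + 2) := by
        rw [hκ, show 2 * (q + 2) = 2 * q + 2 + 2 by ring, pow_add x, show 2 * q + 2 + 2 =
          2 * q + 4 by ring]
        field_simp
      have e2 : 6 * N ^ (2 * q + 4) * x ^ (2 * q + 2) = 6 * N ^ 2 * (x * N) ^ (2 * q + 2) := by
        rw [mul_pow]; ring
      rw [e1, e2, hxN, mul_pow, show 2 * (q + 2) - 2 = 2 * q + 2 by omega]
      have e3 : (2 : ℝ) ^ (2 * (q + 2)) * 4 ≤ 6 * 8 ^ (2 * q + 2) := by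
        have : (2 : ℝ) ^ (2 * q) ≤ 8 ^ (2 * q) := by gcongr; norm_num
        have h0 : (0 : ℝ) ≤ 8 ^ (2 * q) := by positivity
        rw [show 2 * (q + 2) = 2 * q + 4 by ring, pow_add, pow_add]
        norm_num
        linarith
      calc (2 : ℝ) ^ (2 * (q + 2)) * (4 * (R ^ (2 * q + 2) * N ^ 2))
          = (2 ^ (2 * (q + 2)) * 4) * (R ^ (2 * q + 2) * N ^ 2) := by ring
        _ ≤ (6 * 8 ^ (2 * q + 2)) * (R ^ (2 * q + 2) * N ^ 2) := by gcongr
        _ = _ := by ring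
    rw [inv_pow, inv_mul_le_iff₀ (by positivity), mul_comm _ κ]
    exact h2.trans h3
  -- the normalized second-order terms
  have hsec : ∀ c' s' : ℝ, c' ^ 2 + s' ^ 2 = 1 →
      x⁻¹ * x⁻¹ * ∑ i, ∫ ω, retr (rotW A A' c' s' i ω * rotY Z₀ A A' c s i ω ^ (2 * p - 2) *
        rotW A A' c' s' i ω) ∂μ ≤ κ := by
    intro c' s' hcs''
    have e : ∀ (c' s' : ℝ), c' ^ 2 + s' ^ 2 = 1 → ∀ i,
        ∫ ω, retr (rotW A A' c' s' i ω * rotY Z₀ A A' c s i ω ^ (2 * p - 2) *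
        rotW A A' c' s' i ω) ∂μ = ∫ ω, retr (A i ω * rotY Z₀ A A' c s i ω ^ (2 * p - 2) *
        A i ω) ∂μ := by
      intro c' s' hcs'' i
      have := h.integral_retr_rotW_rotW (Z₀ := Z₀) (by omega) c s c' s' c' s' i
        (by omega : (2 * p - 2) + 0 ≤ 2 * p)
      simp only [pow_zero, mul_one] at this
      rw [this, ← pow_two, ← pow_two, hcs'', one_mul]
    have h1 := (h.sum_integral_second_order_le hp1 hZ c s).trans
      (mul_le_mul_of_nonneg_left hN (by norm_num : (0 : ℝ) ≤ 6))
    simp only [e c s hcs] at h1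
    simp only [e c' s' hcs'']
    rw [hκ, ← mul_inv, ← pow_two, inv_mul_eq_div]
    gcongr
  have hLherm : ∀ i a ω, (driftLetter Z₀ A A' c s x i a ω).IsHermitian := by
    intro i a ω
    have sm : ∀ M : Matrix (Fin d) (Fin d) ℂ, M.IsHermitian → (x⁻¹ • M).IsHermitian :=
        fun M hM => by
      rw [Matrix.IsHermitian, Matrix.conjTranspose_smul, hM.eq, star_trivial]
    match a with
    | none => exact h.isHermitian_rotY hZ c s i ω
    | some false => exact sm _ (h.isHermitian_rotW c s i ω)
    | some true => exact sm _ (h.isHermitian_rotW (-s) c i ω)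
  have hLdom : ∀ i a, Dominated (rotG A A') 1 (driftLetter Z₀ A A' c s x i a) := by
    intro i a
    match a with
    | none => exact h.dominated_rotY Z₀ c s i
    | some false => exact (h.dominated_rotW c s i).smul _
    | some true => exact (h.dominated_rotW (-s) c i).smul _
  have hb' : |(-s)| ≤ 1 := by rwa [abs_neg]
  have main := abs_sum_integral_mul_add_pow_le (L := driftLetter Z₀ A A' c s x) hp1 hLherm hg
    h.integrable_rotG hLdom (κ := κ) (x := x) ?_ ?_ ?_ ?_ hx0.le hκ0
  · have e1 : ∀ i ω, retr (driftLetter Z₀ A A' c s x i (some true) ω *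
        (driftLetter Z₀ A A' c s x i none ω + x • driftLetter Z₀ A A' c s x i (some false) ω) ^
          (2 * p - 1)) =
        x⁻¹ * retr (rotW A A' (-s) c i ω * rotX Z₀ A A' c s ω ^ (2 * p - 1)) := by
      intro i ω
      simp only [driftLetter]
      rw [smul_inv_smul₀ hx0.ne', rotY_add_rotW, smul_mul_assoc, retr_smul]
    simp only [e1, integral_const_mul] at main
    rw [← Finset.mul_sum, abs_mul, abs_of_pos (inv_pos.mpr hx0), inv_mul_le_iff₀ hx0] at main
    refine main.trans ?_
    -- The condition `16 p R ≤ N` says precisely `2 p x ≤ 1`, so the sum over further letters costs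
    -- only a constant.
    have hexp : (1 + x) ^ (2 * p) ≤ 3 := by
      have h2p : x * (2 * p) ≤ 1 := by
        rw [hx, div_mul_eq_mul_div, div_le_one hN0]; linarith
      calc (1 + x) ^ (2 * p) ≤ (Real.exp x) ^ (2 * p) := by
            gcongr; rw [add_comm]; exact Real.add_one_le_exp x
        _ = Real.exp (x * (2 * p)) := by
            rw [← Real.exp_nat_mul]; congr 1; push_cast; ring
        _ ≤ Real.exp 1 := Real.exp_le_exp.mpr h2p
        _ ≤ 3 := by linarith [Real.exp_one_lt_d9]
    calc x * ((2 * p) ^ 2 * x ^ 2 * κ * (1 + x) ^ (2 * p))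
        ≤ x * ((2 * p) ^ 2 * x ^ 2 * κ * 3) := by gcongr
      _ = 12 * p ^ 2 * x * (κ * x ^ 2) := by ring
      _ = 12 * p ^ 2 * x * (6 * N ^ (2 * p)) := by
          rw [hκ, div_mul_cancel₀ _ (by positivity)]
      _ = 72 * p ^ 2 * (x * N) * N ^ (2 * p - 1) := by rw [hpowN]; ring
      _ = _ := by rw [hxN]; ring
  · intro a
    match a with
    | false =>
      refine le_trans (le_of_eq ?_) (hτW c s ha hb)
      rw [Finset.mul_sum]
      simp only [driftLetter, smul_pow, retr_smul, integral_const_mul]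
    | true =>
      refine le_trans (le_of_eq ?_) (hτW (-s) c hb' ha)
      rw [Finset.mul_sum]
      simp only [driftLetter, smul_pow, retr_smul, integral_const_mul]
  · intro a
    match a with
    | false =>
      refine le_trans (le_of_eq ?_) (hsec c s hcs)
      rw [Finset.mul_sum]
      simp only [driftLetter, smul_mul_assoc, mul_smul_comm, retr_smul, integral_const_mul,
        mul_assoc]
    | true =>
      refine le_trans (le_of_eq ?_) (hsec (-s) c hcs')
      rw [Finset.mul_sum]
      simp only [driftLetter, smul_mul_assoc, mul_smul_comm, retr_smul, integral_const_mul,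
        mul_assoc]
  · intro i
    simp only [driftLetter, smul_mul_assoc, retr_smul, integral_const_mul]
    rw [h.integral_retr_rotW_pow (by omega) c s (-s) c i (by omega), mul_zero]
  -- Two-letter words vanish because the coefficient vectors `(-s, c)` and `(c, s)` are orthogonal.
  · intro i b e hbe
    simp only [driftLetter, smul_mul_assoc, mul_smul_comm, retr_smul, integral_const_mul]
    rw [h.integral_retr_rotW_rotW (by omega) c s (-s) c c s i (by omega),
      show -s * c + c * s = 0 by ring, zero_mul, mul_zero, mul_zero]

end Drift

/-! ### Differentiation of moments along the rotation. -/

section Derivative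

open scoped Matrix.Norms.Frobenius

variable {d : ℕ} {Ω ι : Type*} [MeasurableSpace Ω] [Fintype ι] {μ : Measure Ω}
  [IsProbabilityMeasure μ] {p : ℕ} {A A' : ι → Ω → Matrix (Fin d) (Fin d) ℂ}
  {Z₀ : Matrix (Fin d) (Fin d) ℂ}

/-- The normalized trace as a continuous real-linear map. -/
noncomputable def retrCLM (d : ℕ) : Matrix (Fin d) (Fin d) ℂ →L[ℝ] ℝ :=
  LinearMap.mkContinuous
    { toFun := retr
      map_add' := retr_add
      map_smul' := fun c M => retr_smul c M } 1 fun M => by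
        rw [one_mul]; exact abs_retr_le_frobenius M

/-- The Leibniz rule gives `n` terms with the derivative in different positions; cyclicity of the
trace makes them equal. -/
lemma hasDerivAt_retr_pow {X : ℝ → Matrix (Fin d) (Fin d) ℂ} {X' : Matrix (Fin d) (Fin d) ℂ}
    {θ : ℝ} (hX : HasDerivAt X X' θ) (n : ℕ) :
    HasDerivAt (fun t => retr (X t ^ n)) (n * retr (X' * X θ ^ (n - 1))) θ := by
  have h1 := hX.fun_pow' n
  have h2 := (retrCLM d).hasFDerivAt.comp_hasDerivAt θ h1
  refine h2.congr_deriv ?_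
  change retr _ = _
  rw [retr_sum, Finset.sum_congr rfl (g := fun _ => retr (X' * X θ ^ (n - 1))), Finset.sum_const,
    Finset.card_range, nsmul_eq_mul]
  intro i hi
  rw [Finset.mem_range] at hi
  rw [mul_assoc, retr_mul_comm, mul_assoc, ← pow_add]
  congr 3
  simp only [Nat.pred_eq_sub_one]
  omega

omit [MeasurableSpace Ω] in
lemma hasDerivAt_rotX (Z₀ : Matrix (Fin d) (Fin d) ℂ) (A A' : ι → Ω → Matrix (Fin d) (Fin d) ℂ)
    (ω : Ω) (θ : ℝ) :
    HasDerivAt (fun t => rotX Z₀ A A' (Real.cos t) (Real.sin t) ω)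
      (∑ i, rotW A A' (-Real.sin θ) (Real.cos θ) i ω) θ := by
  unfold rotX rotW
  refine (HasDerivAt.fun_sum fun i _ => ?_).const_add _
  exact ((Real.hasDerivAt_cos θ).smul_const _).add ((Real.hasDerivAt_sin θ).smul_const _)

/-- Differentiation of the moments along the rotation. -/
lemma hasDerivAt_integral_rotX (h : RotationPair μ (2 * p) A A') (hp : 1 ≤ p) (θ : ℝ) :
    HasDerivAt (fun t => ∫ ω, retr (rotX Z₀ A A' (Real.cos t) (Real.sin t) ω ^ (2 * p)) ∂μ)
      (2 * p * ∑ i, ∫ ω, retr (rotW A A' (-Real.sin θ) (Real.cos θ) i ω *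
        rotX Z₀ A A' (Real.cos θ) (Real.sin θ) ω ^ (2 * p - 1)) ∂μ) θ := by
  have hg := one_le_rotG A A'
  have hX := fun t : ℝ => h.dominated_rotX Z₀ (Real.cos t) (Real.sin t)
  have hW := fun t : ℝ => Dominated.sum hg Finset.univ fun i _ =>
    h.dominated_rotW (-Real.sin t) (Real.cos t) i
  -- The constant does not depend on the angle, since sine and cosine are at most one in absolute
  -- value; it gives an integrable envelope for the derivative.
  obtain ⟨C, hC0, hCA⟩ : ∃ C : ℝ, 0 ≤ C ∧ ∀ ω,
      ‖Z₀‖ + ∑ i, (‖A i ω‖ + ‖A' i ω‖) ≤ C * rotG A A' ω := by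
    choose C hC using fun i => (h.dominated i).bound
    choose D hD using fun i => (h.dominated' i).bound
    refine ⟨‖Z₀‖ + ∑ i, (|C i| + |D i|), by positivity, fun ω => ?_⟩
    rw [add_mul, Finset.sum_mul]
    have h0 : 0 ≤ rotG A A' ω := zero_le_one.trans (hg ω)
    refine add_le_add (le_mul_of_one_le_right (norm_nonneg _) (hg ω))
      (Finset.sum_le_sum fun i _ => ?_)
    rw [add_mul]
    have h1 := hC i ω
    have h2 := hD i ω
    rw [pow_one] at h1 h2
    exact add_le_add (h1.trans (mul_le_mul_of_nonneg_right (le_abs_self _) h0))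
      (h2.trans (mul_le_mul_of_nonneg_right (le_abs_self _) h0))
  have nW : ∀ c s : ℝ, |c| ≤ 1 → |s| ≤ 1 → ∀ ω, ‖∑ i, rotW A A' c s i ω‖ ≤
      ∑ i, (‖A i ω‖ + ‖A' i ω‖) := by
    intro c s hc hs ω
    refine (norm_sum_le _ _).trans (Finset.sum_le_sum fun i _ => (norm_add_le _ _).trans ?_)
    rw [norm_smul, norm_smul]
    exact add_le_add (mul_le_of_le_one_left (norm_nonneg _) hc)
      (mul_le_of_le_one_left (norm_nonneg _) hs)
  have key := hasDerivAt_integral_of_dominated_loc_of_deriv_le (μ := μ)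
    (F := fun t ω => retr (rotX Z₀ A A' (Real.cos t) (Real.sin t) ω ^ (2 * p)))
    (F' := fun t ω => ((2 * p : ℕ) : ℝ) * retr ((∑ i, rotW A A' (-Real.sin t) (Real.cos t) i ω) *
      rotX Z₀ A A' (Real.cos t) (Real.sin t) ω ^ (2 * p - 1)))
    (bound := fun ω => ((2 * p : ℕ) : ℝ) * (C ^ (2 * p) * rotG A A' ω ^ (2 * p)))
    (x₀ := θ) (s := Set.univ) Filter.univ_mem
    (Filter.Eventually.of_forall fun t =>
      ((hX t).pow hg _).measurable_retr.aestronglyMeasurable)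
    (h.integrable_rotX_pow Z₀ _ _ le_rfl)
    (((hW θ).mul ((hX θ).pow hg _)).measurable_retr.const_mul _).aestronglyMeasurable
    (Filter.Eventually.of_forall fun ω t _ => ?_)
    ((h.integrable_rotG.const_mul _).const_mul _)
    (Filter.Eventually.of_forall fun ω t _ => hasDerivAt_retr_pow (hasDerivAt_rotX Z₀ A A' ω t) _)
  · refine key.2.congr_deriv ?_
    rw [integral_const_mul, ← integral_finsetSum _ fun i _ => h.integrable_retr_of_dominated
      ((h.dominated_rotW _ _ i).mul ((hX θ).pow hg _)) (by omega)]
    simp only [Finset.sum_mul, retr_sum]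
    push_cast
    rfl
  · rw [norm_mul, Real.norm_natCast]
    refine mul_le_mul_of_nonneg_left ?_ (Nat.cast_nonneg _)
    rw [Real.norm_eq_abs]
    refine (abs_retr_le_frobenius _).trans ((norm_mul_le _ _).trans ?_)
    have hsum0 : 0 ≤ ∑ i, (‖A i ω‖ + ‖A' i ω‖) := by positivity
    have h1 : ‖∑ i, rotW A A' (-Real.sin t) (Real.cos t) i ω‖ ≤ C * rotG A A' ω :=
      (nW _ _ (by rw [abs_neg]; exact Real.abs_sin_le_one t) (Real.abs_cos_le_one t) ω).trans
        (le_trans (le_add_of_nonneg_left (norm_nonneg _)) (hCA ω))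
    have h2 : ‖rotX Z₀ A A' (Real.cos t) (Real.sin t) ω‖ ≤ C * rotG A A' ω :=
      (norm_add_le _ _).trans ((add_le_add le_rfl
        (nW _ _ (Real.abs_cos_le_one t) (Real.abs_sin_le_one t) ω)).trans (hCA ω))
    have h3 : ‖rotX Z₀ A A' (Real.cos t) (Real.sin t) ω ^ (2 * p - 1)‖ ≤
        (C * rotG A A' ω) ^ (2 * p - 1) :=
      (norm_pow_le' _ (by omega)).trans (pow_le_pow_left₀ (norm_nonneg _) h2 _)
    have h0 : 0 ≤ C * rotG A A' ω := (norm_nonneg _).trans h1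
    calc _ ≤ (C * rotG A A' ω) * (C * rotG A A' ω) ^ (2 * p - 1) := by gcongr
      _ = (C * rotG A A' ω) ^ (2 * p) := by rw [← pow_succ']; congr 1; omega
      _ = _ := mul_pow _ _ _

end Derivative

/-! ### Integration of the drift bound along the rotation. -/

section Comparison

variable {d : ℕ} {Ω ι : Type*} [MeasurableSpace Ω] [Fintype ι] {μ : Measure Ω}
  [IsProbabilityMeasure μ] {p : ℕ} {A A' : ι → Ω → Matrix (Fin d) (Fin d) ℂ}
  {Z₀ : Matrix (Fin d) (Fin d) ℂ}

/-- Moments along a rotation change by at most a multiple of `p² R`. -/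
theorem abs_moment_sub_le (h : RotationPair μ (2 * p) A A') (hp : 2 ≤ p) (hd : d ≠ 0)
    (hZ : Z₀.IsHermitian) {R : ℝ} (hR : 0 < R)
    (hτ : ∑ i, ∫ ω, retr (A i ω ^ (2 * p)) ∂μ ≤
      R ^ (2 * p - 2) * (R ^ 2 + ∑ i, ∫ ω, retr (A i ω ^ 2) ∂μ))
    (hτ' : ∑ i, ∫ ω, retr (A' i ω ^ (2 * p)) ∂μ ≤
      R ^ (2 * p - 2) * (R ^ 2 + ∑ i, ∫ ω, retr (A i ω ^ 2) ∂μ))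
    {θ : ℝ} (hθ0 : 0 ≤ θ) (hθ : θ ≤ 2) :
    |(∫ ω, retr (rotX Z₀ A A' (Real.cos θ) (Real.sin θ) ω ^ (2 * p)) ∂μ) ^ (1 / (2 * (p : ℝ))) -
      (∫ ω, retr (rotX Z₀ A A' 1 0 ω ^ (2 * p)) ∂μ) ^ (1 / (2 * (p : ℝ)))| ≤
      1168 * p ^ 2 * R := by
  classical
  set F : ℝ → ℝ := fun t =>
    ∫ ω, retr (rotX Z₀ A A' (Real.cos t) (Real.sin t) ω ^ (2 * p)) ∂μ with hF
  have hp0 : (0 : ℝ) < p := by exact_mod_cast (by omega : 0 < p)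
  have hF0 : ∀ t, 0 ≤ F t := fun t => integral_nonneg fun ω =>
    retr_pow_two_mul_nonneg (h.isHermitian_rotX hZ _ _ ω) p
  set K : ℝ := 16 * p * R with hK
  have hK0 : 0 < K := by positivity
  set e : ℝ := 1 / (2 * (p : ℝ)) with he
  have he0 : 0 < e := by positivity
  have he1 : e ≤ 1 := by
    rw [he, div_le_one (by positivity)]
    have : (2 : ℝ) ≤ p := by exact_mod_cast hp
    linarith
  have hcast : ((2 * p : ℕ) : ℝ) * e = 1 := by rw [he]; push_cast; field_simp
  -- Adding `K ^ (2 * p)` keeps the root differentiable and enforces `16 p R ≤ N t`, as the drift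
  -- bound requires.
  set N : ℝ → ℝ := fun t => (F t + K ^ (2 * p)) ^ e with hNdef
  have hpos : ∀ t, 0 < F t + K ^ (2 * p) := fun t => by
    have := hF0 t; positivity
  have hN0 : ∀ t, 0 < N t := fun t => Real.rpow_pos_of_pos (hpos t) e
  have hNpow : ∀ t, N t ^ (2 * p) = F t + K ^ (2 * p) := fun t => by
    rw [hNdef, ← Real.rpow_natCast, ← Real.rpow_mul (hpos t).le, mul_comm e, hcast, Real.rpow_one]
  have hKe : (K ^ (2 * p)) ^ e = K := by
    rw [← Real.rpow_natCast, ← Real.rpow_mul hK0.le, hcast, Real.rpow_one]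
  have hKN : ∀ t, K ≤ N t := fun t => by
    conv_lhs => rw [← hKe]
    exact Real.rpow_le_rpow (by positivity) (le_add_of_nonneg_left (hF0 t)) he0.le
  have hder : ∀ t, ∃ N', HasDerivAt N N' t ∧ ‖N'‖ ≤ 576 * p ^ 2 * R := by
    intro t
    have h1 := h.hasDerivAt_integral_rotX (Z₀ := Z₀) (by omega) t
    set D := ∑ i, ∫ ω, retr (rotW A A' (-Real.sin t) (Real.cos t) i ω *
        rotX Z₀ A A' (Real.cos t) (Real.sin t) ω ^ (2 * p - 1)) ∂μ with hD
    have h2 : |D| ≤ 576 * p ^ 2 * R * N t ^ (2 * p - 1) :=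
      h.sum_drift_le hp hd hZ (Real.cos_sq_add_sin_sq t) hR hτ hτ'
        (by rw [hNpow]; exact le_add_of_nonneg_right (by positivity)) (hKN t)
    refine ⟨_, (h1.add_const (K ^ (2 * p))).rpow_const (Or.inl (hpos t).ne'), ?_⟩
    have h3 : (F t + K ^ (2 * p)) ^ (e - 1) = (N t ^ (2 * p - 1))⁻¹ := by
      rw [Real.rpow_sub (hpos t), Real.rpow_one, ← hNpow t]
      have : (N t ^ (2 * p)) ^ e = N t := by
        rw [← Real.rpow_natCast, ← Real.rpow_mul (hN0 t).le, hcast, Real.rpow_one]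
      rw [this, show N t ^ (2 * p) = N t * N t ^ (2 * p - 1) by
        rw [← pow_succ']; congr 1; omega]
      have := (hN0 t).ne'
      field_simp
    change ‖2 * p * D * e * (F t + K ^ (2 * p)) ^ (e - 1)‖ ≤ _
    have h4 : 2 * p * D * e = D := by
      rw [he]; field_simp
    rw [h3, h4, norm_mul, norm_inv, Real.norm_eq_abs,
      Real.norm_of_nonneg (by have := hN0 t; positivity),
      ← div_eq_mul_inv, div_le_iff₀ (by have := hN0 t; positivity)]
    exact h2
  choose N' hN'1 hN'2 using hder
  have hmv : ‖N θ - N 0‖ ≤ 576 * p ^ 2 * R * ‖θ - 0‖ :=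
    convex_univ.norm_image_sub_le_of_norm_hasDerivWithin_le
      (fun t _ => (hN'1 t).hasDerivWithinAt) (fun t _ => hN'2 t) (Set.mem_univ _) (Set.mem_univ _)
  have hlow : ∀ t, F t ^ e ≤ N t := fun t =>
    Real.rpow_le_rpow (hF0 t) (le_add_of_nonneg_right (by positivity)) he0.le
  -- Subadditivity of `u ↦ u ^ e` for `e ≤ 1` removes the regularization at cost `K ≤ 16 p^2 R`.
  -- With `2 * 576` from an angle at most `2`, this yields `1168`.
  have hup : ∀ t, N t ≤ F t ^ e + K := fun t => by
    conv_rhs => rw [← hKe]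
    exact Real.rpow_add_le_add_rpow (hF0 t) (by positivity) he0.le he1
  have e0 : F 0 = ∫ ω, retr (rotX Z₀ A A' 1 0 ω ^ (2 * p)) ∂μ := by
    simp only [hF, Real.cos_zero, Real.sin_zero]
  rw [← e0]
  change |F θ ^ e - F 0 ^ e| ≤ _
  rw [sub_zero, Real.norm_eq_abs, Real.norm_of_nonneg hθ0] at hmv
  have hmv' : |N θ - N 0| ≤ 1152 * p ^ 2 * R := by
    refine hmv.trans ?_
    calc 576 * p ^ 2 * R * θ ≤ 576 * p ^ 2 * R * 2 := by gcongr
      _ = _ := by ring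
  have hK' : K ≤ 16 * p ^ 2 * R := by
    rw [hK]
    have : (p : ℝ) ≤ p ^ 2 := by
      have : (1 : ℝ) ≤ p := by exact_mod_cast (by omega : 1 ≤ p)
      nlinarith
    gcongr
  have a1 := abs_le.mp hmv'
  have b1 := hlow θ
  have b2 := hlow 0
  have b3 := hup θ
  have b4 := hup 0
  rw [abs_le]
  constructor <;> linarith [a1.1, a1.2]

end Comparison

end RotationPair

/-! ### Independent copies and regrouping of independent families. -/

section IndependentCopies

/-- Independence says that the joint law is a product measure, and currying identifies a product
over pairs with an iterated product. -/
lemma iIndepFun_curry {ι κ Ω β : Type*} [MeasurableSpace Ω] [MeasurableSpace β] {μ : Measure Ω}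
    [IsProbabilityMeasure μ] {f : ι × κ → Ω → β} (hf : ∀ x, Measurable (f x))
    (h : iIndepFun f μ) : iIndepFun (fun i ω j => f (i, j) ω) μ := by
  have : ∀ i j, IsProbabilityMeasure (μ.map (f (i, j))) :=
    fun i j => Measure.isProbabilityMeasure_map (hf (i, j)).aemeasurable
  have hs : iIndepFun (fun (x : (_ : ι) × κ) ω => f (x.1, x.2) ω) μ :=
    h.precomp (Equiv.sigmaEquivProd ι κ).injective
  have hin : ∀ i, μ.map (fun ω j => f (i, j) ω) =
      Measure.infinitePi fun j => μ.map (f (i, j)) := fun i =>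
    (iIndepFun_iff_map_fun_eq_infinitePi_map fun j => hf (i, j)).1
      (h.precomp (Prod.mk_right_injective i))
  rw [iIndepFun_iff_map_fun_eq_infinitePi_map fun i => measurable_pi_lambda _ fun j => hf (i, j)]
  simp_rw [hin]
  have hall := hs.map_fun_eq_infinitePi_map fun x : (_ : ι) × κ => hf (x.1, x.2)
  rw [← Measure.infinitePi_map_piCurry (fun (i : ι) (j : κ) => μ.map (f (i, j))), ← hall]
  have hm : Measurable fun ω (x : (_ : ι) × κ) => f (x.1, x.2) ω :=
    measurable_pi_lambda _ fun x => hf (x.1, x.2)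
  exact (Measure.map_map (MeasurableEquiv.piCurry fun (_ : ι) (_ : κ) => β).measurable hm).symm

lemma iIndepFun_comp_measurePreserving {ι Ω S β : Type*} [MeasurableSpace Ω] [MeasurableSpace S]
    [MeasurableSpace β] {μ : Measure Ω} {P : Measure S} {φ : Ω → S} (hφ : MeasurePreserving φ μ P)
    {f : ι → S → β} (hf : ∀ i, Measurable (f i)) (h : iIndepFun f P) :
    iIndepFun (fun i ω => f i (φ ω)) μ := by
  rw [iIndepFun_iff_measure_inter_preimage_eq_mul] at h ⊢
  intro s sets hsets
  have h1 : ∀ i ∈ s, MeasurableSet (f i ⁻¹' sets i) := fun i hi => hf i (hsets i hi)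
  have := h s hsets
  rw [← hφ.measure_preimage (s.measurableSet_biInter h1).nullMeasurableSet] at this
  rw [Set.preimage_iInter₂] at this
  refine this.trans (Finset.prod_congr rfl fun i hi => ?_)
  exact (hφ.measure_preimage (h1 i hi).nullMeasurableSet).symm

lemma iIndepFun_pairs {ι K Ω β : Type*} [MeasurableSpace Ω] [MeasurableSpace β] {μ : Measure Ω}
    [IsProbabilityMeasure μ] {f : K → Ω → β} (hf : ∀ k, Measurable (f k)) (h : iIndepFun f μ)
    {u v : ι → K} (hu : Function.Injective u) (hv : Function.Injective v)
    (huv : ∀ i j, u i ≠ v j) : iIndepFun (fun i ω => (f (u i) ω, f (v i) ω)) μ := by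
  have hinj : Function.Injective fun x : ι × Bool => if x.2 then u x.1 else v x.1 := by
    rintro ⟨i, a⟩ ⟨j, b⟩ hij
    cases a <;> cases b <;> simp only [Prod.mk.injEq] <;> simp at hij
    · exact ⟨hv hij, trivial⟩
    · exact absurd hij.symm (huv _ _)
    · exact absurd hij (huv _ _)
    · exact ⟨hu hij, trivial⟩
  have h1 := iIndepFun_curry (fun x => hf _) (h.precomp hinj)
  exact h1.comp (fun _ (w : Bool → β) => (w true, w false)) fun _ => by fun_prop

variable {S : Type*} [MeasurableSpace S] (P : Measure S) [IsProbabilityMeasure P]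

/-- The law of a sequence of independent copies. -/
noncomputable abbrev iidCopies : Measure (ℕ → S) := Measure.infinitePi fun _ => P

lemma integral_iidCopies_eval {E : Type*} [NormedAddCommGroup E] [NormedSpace ℝ E] {f : S → E}
    (hf : AEStronglyMeasurable f P) (j : ℕ) : ∫ ω, f (ω j) ∂(iidCopies P) = ∫ s, f s ∂P := by
  have h := measurePreserving_eval_infinitePi (fun _ : ℕ => P) j
  conv_rhs => rw [← h.map_eq]
  rw [integral_map h.measurable.aemeasurable (by rw [h.map_eq]; exact hf)]

lemma iIndepFun_iidCopies {β : Type*} [MeasurableSpace β] {f : S → β} (hf : Measurable f) :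
    iIndepFun (fun (j : ℕ) (ω : ℕ → S) => f (ω j)) (iidCopies P) :=
  iIndepFun_infinitePi fun _ => hf

lemma iIndepFun_iidCopies_prod {κ β : Type*} [MeasurableSpace β] {f : κ → S → β}
    (hf : ∀ i, Measurable (f i)) (h : iIndepFun f P) [Countable κ] :
    iIndepFun (fun (x : ℕ × κ) (ω : ℕ → S) => f x.2 (ω x.1)) (iidCopies P) := by
  refine iIndepFun_uncurry' (X := fun (j : ℕ) (i : κ) (ω : ℕ → S) => f i (ω j))
    (fun j i => (hf i).comp (measurable_pi_apply j)) ?_ fun j => ?_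
  · exact iIndepFun_infinitePi (X := fun _ s i => f i s) fun _ => measurable_pi_lambda _ hf
  · exact iIndepFun_comp_measurePreserving (measurePreserving_eval_infinitePi (fun _ : ℕ => P) j)
      hf h

end IndependentCopies

/-! ### Rotation pairs built from independent copies. -/

section Blocks

variable {d : ℕ} {κ S : Type*} [MeasurableSpace S] {P : Measure S} [IsProbabilityMeasure P]
  {Z : κ → S → Matrix (Fin d) (Fin d) ℂ}

/-- The normalized sum of `N` independent copies of a random matrix. -/
noncomputable def iidSum (Z₀ : Matrix (Fin d) (Fin d) ℂ) (c : ℝ) (N : ℕ)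
    (X : S → Matrix (Fin d) (Fin d) ℂ) (ω : ℕ → S) : Matrix (Fin d) (Fin d) ℂ :=
  Z₀ + c • ∑ j ∈ Finset.range N, X (ω j)

lemma measurable_smul_entry {T : Type*} [MeasurableSpace T] {M : T → Matrix (Fin d) (Fin d) ℂ}
    (hM : ∀ a b, Measurable fun s => M s a b) (c : ℝ) (a b : Fin d) :
    Measurable fun s => (c • M s) a b := by
  simp only [Matrix.smul_apply]
  exact (hM a b).const_smul c

/-- The two families read disjoint blocks of coordinates, so rotation by `π/4` merges them into one
normalized sum of `2N` copies. -/
lemma rotationPair_blocks [Countable κ] {p : ℕ}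
    (hherm : ∀ i s, (Z i s).IsHermitian)
    (hmeas : ∀ i a b, Measurable fun s => Z i s a b)
    (hmem : ∀ i a b, MemLp (fun s => Z i s a b) (2 * p : ℕ) P)
    (hind : iIndepFun (fun i s => (fun a b => Z i s a b : Fin d → Fin d → ℂ)) P)
    (hmean : ∀ i a b, ∫ s, Z i s a b ∂P = 0) (c : ℝ) (N : ℕ) :
    RotationPair (iidCopies P) (2 * p) (fun (x : κ × Fin N) ω => c • Z x.1 (ω x.2))
      (fun x ω => c • Z x.1 (ω (N + x.2))) := by
  have hev : ∀ j, MeasurePreserving (Function.eval j) (iidCopies P) P :=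
    fun j => measurePreserving_eval_infinitePi (fun _ : ℕ => P) j
  have hm : ∀ i a b (j : ℕ), Measurable fun ω : ℕ → S => Z i (ω j) a b :=
    fun i a b j => (hmeas i a b).comp (measurable_pi_apply j)
  have hme : ∀ i, Measurable fun s => (fun a b => Z i s a b : Fin d → Fin d → ℂ) := fun i =>
    measurable_pi_lambda _ fun a => measurable_pi_lambda _ fun b => hmeas i a b
  have hbig := iIndepFun_iidCopies_prod P hme hind
  have hbm : ∀ x : ℕ × κ, Measurable fun ω : ℕ → S =>
      (fun a b => Z x.2 (ω x.1) a b : Fin d → Fin d → ℂ) :=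
    fun x => (hme x.2).comp (measurable_pi_apply x.1)
  have hml : ∀ i a b (j : ℕ), MemLp (fun ω : ℕ → S => Z i (ω j) a b) (2 * p : ℕ) (iidCopies P) :=
    fun i a b j => (hmem i a b).comp_measurePreserving (hev j)
  have hint : ∀ i a b (j : ℕ), ∫ ω, Z i (ω j) a b ∂(iidCopies P) = 0 := fun i a b j => by
    rw [integral_iidCopies_eval P (f := fun s => Z i s a b) (hmeas i a b).aestronglyMeasurable,
      hmean]
  have hherm' : ∀ i s, (c • Z i s).IsHermitian := fun i s => by
    have := hherm i s
    simp only [Matrix.IsHermitian, Matrix.conjTranspose_smul, star_trivial] at this ⊢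
    rw [this]
  constructor
  · exact fun x ω => hherm' _ _
  · exact fun x ω => hherm' _ _
  · exact fun x a b => measurable_smul_entry (fun a b => hm _ a b _) c a b
  · exact fun x a b => measurable_smul_entry (fun a b => hm _ a b _) c a b
  · exact fun x a b => (hml x.1 a b x.2).const_smul c
  · exact fun x a b => (hml x.1 a b (N + x.2)).const_smul c
  · have h1 := iIndepFun_pairs hbm hbig (ι := κ × Fin N) (u := fun x => ((x.2 : ℕ), x.1))
      (v := fun x => (N + (x.2 : ℕ), x.1)) ?_ ?_ ?_
    · refine h1.comp (fun _ w => ((fun a b => c • w.1 a b), (fun a b => c • w.2 a b)))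
        fun _ => ?_
      fun_prop
    · rintro ⟨i, j⟩ ⟨i', j'⟩ h
      simp only [Prod.mk.injEq] at h ⊢
      exact ⟨h.2, Fin.ext h.1⟩
    · rintro ⟨i, j⟩ ⟨i', j'⟩ h
      simp only [Prod.mk.injEq] at h ⊢
      exact ⟨h.2, Fin.ext (by omega)⟩
    · rintro ⟨i, j⟩ ⟨i', j'⟩ h
      simp only [Prod.mk.injEq] at h
      have := j.2
      omega
  · intro x a b
    simp only [Matrix.smul_apply]
    rw [integral_smul, hint, smul_zero]
  · intro x a b
    simp only [Matrix.smul_apply]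
    rw [integral_smul, hint, smul_zero]
  · intro x a b e f
    have := fun j => integral_iidCopies_eval P
      (f := fun s => (c • Z x.1 s) a b * (c • Z x.1 s) e f)
      ((measurable_smul_entry (hmeas x.1) c a b).mul
        (measurable_smul_entry (hmeas x.1) c e f)).aestronglyMeasurable j
    rw [this, this]
  · intro x a b e f
    have hne : ((x.2 : ℕ), x.1) ≠ (N + (x.2 : ℕ), x.1) := by
      intro h
      have := x.2.2
      simp only [Prod.mk.injEq] at h
      omega
    have h2 : IndepFun (fun ω : ℕ → S => Z x.1 (ω x.2) a b)
        (fun ω => Z x.1 (ω (N + x.2)) e f) (iidCopies P) :=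
      (hbig.indepFun hne).comp (φ := fun w : Fin d → Fin d → ℂ => w a b)
        (ψ := fun w : Fin d → Fin d → ℂ => w e f) (by fun_prop) (by fun_prop)
    have h3 := h2.integral_fun_mul_eq_mul_integral (hm _ a b _).aestronglyMeasurable
      (hm _ e f _).aestronglyMeasurable
    rw [hint, zero_mul] at h3
    simp only [Matrix.smul_apply, smul_mul_smul_comm]
    rw [integral_smul, h3, smul_zero]

/-- A normalized sum of copies of `X` paired with a normalized sum of copies of a random matrix
with the same second moments. -/
lemma rotationPair_replace {p : ℕ} {X V : S → Matrix (Fin d) (Fin d) ℂ}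
    (hX : ∀ s, (X s).IsHermitian) (hV : ∀ s, (V s).IsHermitian)
    (hXm : ∀ a b, Measurable fun s => X s a b) (hVm : ∀ a b, Measurable fun s => V s a b)
    (hXp : ∀ a b, MemLp (fun s => X s a b) (2 * p : ℕ) P)
    (hVp : ∀ a b, MemLp (fun s => V s a b) (2 * p : ℕ) P)
    (hX0 : ∀ a b, ∫ s, X s a b ∂P = 0) (hV0 : ∀ a b, ∫ s, V s a b ∂P = 0)
    (hXV : ∀ a b e f, ∫ s, X s a b * X s e f ∂P = ∫ s, V s a b * V s e f ∂P)
    (hcr : ∀ a b e f, ∫ s, X s a b * V s e f ∂P = 0) (c : ℝ) (N : ℕ) :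
    RotationPair (iidCopies P) (2 * p) (fun (j : Fin N) ω => c • X (ω j))
      (fun j ω => c • V (ω j)) := by
  have hev : ∀ j, MeasurePreserving (Function.eval j) (iidCopies P) P :=
    fun j => measurePreserving_eval_infinitePi (fun _ : ℕ => P) j
  have hsm : ∀ M : Matrix (Fin d) (Fin d) ℂ, M.IsHermitian → (c • M).IsHermitian := fun M h => by
    simp only [Matrix.IsHermitian, Matrix.conjTranspose_smul, star_trivial] at h ⊢
    rw [h]
  have hprod : ∀ (A B : S → Matrix (Fin d) (Fin d) ℂ), (∀ a b, Measurable fun s => A s a b) →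
      (∀ a b, Measurable fun s => B s a b) → ∀ (j : ℕ) a b e f,
      ∫ ω, (c • A (ω j)) a b * (c • B (ω j)) e f ∂(iidCopies P) =
        (c * c) • ∫ s, A s a b * B s e f ∂P := by
    intro A B hA hB j a b e f
    rw [← integral_iidCopies_eval P (f := fun s => A s a b * B s e f)
      ((hA a b).mul (hB e f)).aestronglyMeasurable j, ← integral_smul]
    simp only [Matrix.smul_apply, smul_mul_smul_comm]
  have hone : ∀ A : S → Matrix (Fin d) (Fin d) ℂ, (∀ a b, Measurable fun s => A s a b) →
      (∀ a b, ∫ s, A s a b ∂P = 0) → ∀ (j : ℕ) a b,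
      ∫ ω, (c • A (ω j)) a b ∂(iidCopies P) = 0 := by
    intro A hA h0 j a b
    simp only [Matrix.smul_apply]
    rw [integral_smul, integral_iidCopies_eval P (f := fun s => A s a b)
      (hA a b).aestronglyMeasurable, h0, smul_zero]
  constructor
  · exact fun j ω => hsm _ (hX _)
  · exact fun j ω => hsm _ (hV _)
  · exact fun j a b => measurable_smul_entry
      (fun a b => (hXm a b).comp (measurable_pi_apply _)) c a b
  · exact fun j a b => measurable_smul_entry
      (fun a b => (hVm a b).comp (measurable_pi_apply _)) c a b
  · exact fun j a b => ((hXp a b).comp_measurePreserving (hev j)).const_smul c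
  · exact fun j a b => ((hVp a b).comp_measurePreserving (hev j)).const_smul c
  -- Both members of a pair read the same coordinate: independence is needed only between pairs,
  -- while within a pair vanishing correlation suffices.
  · have hf : Measurable fun s => ((fun a b => (c • X s) a b : Fin d → Fin d → ℂ),
        (fun a b => (c • V s) a b : Fin d → Fin d → ℂ)) :=
      (measurable_pi_lambda _ fun a => measurable_pi_lambda _ fun b =>
        measurable_smul_entry hXm c a b).prodMk (measurable_pi_lambda _ fun a =>
          measurable_pi_lambda _ fun b => measurable_smul_entry hVm c a b)
    exact (iIndepFun_iidCopies P hf).precomp Fin.val_injective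
  · exact fun j a b => hone X hXm hX0 j a b
  · exact fun j a b => hone V hVm hV0 j a b
  · intro j a b e f
    rw [hprod X X hXm hXm, hprod V V hVm hVm, hXV]
  · intro j a b e f
    rw [hprod X V hXm hVm, hcr, smul_zero]

end Blocks

/-! ### Repeated doubling and passage to the stable law. -/

section Chain

variable {d : ℕ} {κ S : Type*} [MeasurableSpace S] {P : Measure S} [IsProbabilityMeasure P]
  {Z : κ → S → Matrix (Fin d) (Fin d) ℂ}

lemma retr_smul_pow (c : ℝ) (M : Matrix (Fin d) (Fin d) ℂ) (m : ℕ) :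
    retr ((c • M) ^ m) = c ^ m * retr (M ^ m) := by
  rw [smul_pow, retr_smul]

lemma measurable_retr_pow {T : Type*} [MeasurableSpace T] {M : T → Matrix (Fin d) (Fin d) ℂ}
    (hM : ∀ a b, Measurable fun s => M s a b) (m : ℕ) : Measurable fun s => retr (M s ^ m) := by
  simp only [retr_eq]
  exact (Finset.measurable_sum _ fun i _ =>
    Complex.measurable_re.comp (measurable_pow_entry hM m i i)).const_mul _

lemma integral_retr_smul_pow_eval {X : S → Matrix (Fin d) (Fin d) ℂ}
    (hX : ∀ a b, Measurable fun s => X s a b) (c : ℝ) (j m : ℕ) :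
    ∫ ω, retr ((c • X (ω j)) ^ m) ∂(iidCopies P) = c ^ m * ∫ s, retr (X s ^ m) ∂P := by
  simp only [retr_smul_pow]
  rw [integral_const_mul, integral_iidCopies_eval P (f := fun s => retr (X s ^ m))
    (measurable_retr_pow hX m).aestronglyMeasurable]

/-- The normalized moment of a normalized sum of independent copies. -/
noncomputable def iidMoment (P : Measure S) [IsProbabilityMeasure P]
    (Z₀ : Matrix (Fin d) (Fin d) ℂ) (p : ℕ) (c : ℝ) (N : ℕ)
    (X : S → Matrix (Fin d) (Fin d) ℂ) : ℝ :=
  (∫ ω, retr (iidSum Z₀ c N X ω ^ (2 * p)) ∂(iidCopies P)) ^ (1 / (2 * (p : ℝ)))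

/-- With `N = r^(-4)` copies scaled by `r ^ 2`, the total variance is unchanged while the parameter
`R` shrinks to `R r`; this decay is what makes the doubling errors summable. -/
lemma abs_iidMoment_double_sub_le [Fintype κ] {p : ℕ} (hp : 2 ≤ p) (hd : d ≠ 0)
    {Z₀ : Matrix (Fin d) (Fin d) ℂ} (hZ : Z₀.IsHermitian)
    (hherm : ∀ i s, (Z i s).IsHermitian)
    (hmeas : ∀ i a b, Measurable fun s => Z i s a b)
    (hmem : ∀ i a b, MemLp (fun s => Z i s a b) (2 * p : ℕ) P)
    (hind : iIndepFun (fun i s => (fun a b => Z i s a b : Fin d → Fin d → ℂ)) P)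
    (hmean : ∀ i a b, ∫ s, Z i s a b ∂P = 0) {R : ℝ} (hR : 0 < R)
    (hτ : ∑ i, ∫ s, retr (Z i s ^ (2 * p)) ∂P ≤
      R ^ (2 * p - 2) * (R ^ 2 + ∑ i, ∫ s, retr (Z i s ^ 2) ∂P))
    {r : ℝ} (hr : 0 < r) (hr1 : r ≤ 1) {N : ℕ} (hN : r ^ 4 * N = 1) :
    |iidMoment P Z₀ p (Real.sqrt 2 / 2 * r ^ 2) (2 * N) (fun s => ∑ i, Z i s) -
      iidMoment P Z₀ p (r ^ 2) N (fun s => ∑ i, Z i s)| ≤ 1168 * p ^ 2 * (R * r) := by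
  have h := rotationPair_blocks hherm hmeas hmem hind hmean (r ^ 2) N
  have hsum : ∀ m : ℕ, ∑ x : κ × Fin N, (r ^ 2) ^ m * ∫ s, retr (Z x.1 s ^ m) ∂P =
      N * (r ^ 2) ^ m * ∑ i, ∫ s, retr (Z i s ^ m) ∂P := fun m => by
    rw [Fintype.sum_prod_type, Finset.mul_sum]
    simp [mul_assoc]
  have hσ0 : 0 ≤ ∑ i, ∫ s, retr (Z i s ^ 2) ∂P := Finset.sum_nonneg fun i _ =>
    integral_nonneg fun s => by simpa using retr_pow_two_mul_nonneg (hherm i s) 1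
  set σ := ∑ i, ∫ s, retr (Z i s ^ 2) ∂P with hσ
  have hbound : ∑ x : κ × Fin N, (r ^ 2) ^ (2 * p) * ∫ s, retr (Z x.1 s ^ (2 * p)) ∂P ≤
      (R * r) ^ (2 * p - 2) * ((R * r) ^ 2 +
        ∑ x : κ × Fin N, (r ^ 2) ^ 2 * ∫ s, retr (Z x.1 s ^ 2) ∂P) := by
    rw [hsum, hsum, ← hσ]
    obtain ⟨q, rfl⟩ : ∃ q, p = q + 2 := ⟨p - 2, by omega⟩
    rw [show 2 * (q + 2) - 2 = 2 * q + 2 by omega] at hτ ⊢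
    have e1 : (N : ℝ) * (r ^ 2) ^ (2 * (q + 2)) = r ^ (4 * q + 4) := by
      calc (N : ℝ) * (r ^ 2) ^ (2 * (q + 2)) = r ^ (4 * q + 4) * (r ^ 4 * N) := by ring
        _ = _ := by rw [hN, mul_one]
    have e2 : (N : ℝ) * (r ^ 2) ^ 2 = 1 := by rw [← hN]; ring
    rw [e1, e2, one_mul]
    calc r ^ (4 * q + 4) * ∑ i, ∫ s, retr (Z i s ^ (2 * (q + 2))) ∂P
        ≤ r ^ (2 * q + 4) * (R ^ (2 * q + 2) * (R ^ 2 + σ)) := by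
          -- Summed over the copies, the pure powers scale like `r^(4p-4)`; this is at most the
          -- required `r^(2p)` exactly because `p ≥ 2`.
          have : r ^ (4 * q + 4) ≤ r ^ (2 * q + 4) := pow_le_pow_of_le_one hr.le hr1 (by omega)
          exact mul_le_mul this hτ (Finset.sum_nonneg fun i _ => integral_nonneg fun s =>
            retr_pow_two_mul_nonneg (hherm i s) _) (by positivity)
      _ = (R * r) ^ (2 * q + 2) * ((R * r) ^ 2 + r ^ 2 * σ) := by ring
      _ ≤ (R * r) ^ (2 * q + 2) * ((R * r) ^ 2 + σ) := by
          have : r ^ 2 * σ ≤ σ := mul_le_of_le_one_left hσ0 (pow_le_one₀ hr.le hr1)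
          gcongr
  have hτ1 : ∑ x : κ × Fin N, ∫ ω, retr ((r ^ 2 • Z x.1 (ω x.2)) ^ (2 * p)) ∂(iidCopies P) ≤
      (R * r) ^ (2 * p - 2) * ((R * r) ^ 2 +
        ∑ x : κ × Fin N, ∫ ω, retr ((r ^ 2 • Z x.1 (ω x.2)) ^ 2) ∂(iidCopies P)) := by
    simp only [integral_retr_smul_pow_eval (P := P) (hmeas _)]
    exact hbound
  have hτ2 : ∑ x : κ × Fin N, ∫ ω, retr ((r ^ 2 • Z x.1 (ω (N + x.2))) ^ (2 * p)) ∂(iidCopies P) ≤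
      (R * r) ^ (2 * p - 2) * ((R * r) ^ 2 +
        ∑ x : κ × Fin N, ∫ ω, retr ((r ^ 2 • Z x.1 (ω x.2)) ^ 2) ∂(iidCopies P)) := by
    simp only [integral_retr_smul_pow_eval (P := P) (hmeas _)]
    exact hbound
  have key := h.abs_moment_sub_le hp hd hZ (by positivity : 0 < R * r) hτ1 hτ2
    (θ := Real.pi / 4) (by positivity) (by linarith [Real.pi_le_four])
  have hlow : ∀ ω : ℕ → S, ∑ x : κ × Fin N, Z x.1 (ω x.2) =
      ∑ j ∈ Finset.range N, ∑ i, Z i (ω j) := fun ω => by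
    rw [Fintype.sum_prod_type_right, Fin.sum_univ_eq_sum_range (fun j => ∑ i, Z i (ω j))]
  have hhigh : ∀ ω : ℕ → S, ∑ x : κ × Fin N, Z x.1 (ω (N + x.2)) =
      ∑ j ∈ Finset.range N, ∑ i, Z i (ω (N + j)) := fun ω => by
    rw [Fintype.sum_prod_type_right, Fin.sum_univ_eq_sum_range (fun j => ∑ i, Z i (ω (N + j)))]
  convert key using 3
  · rw [iidMoment]
    congr 2 with ω
    congr 2
    simp only [iidSum, rotX, rotW, Real.cos_pi_div_four, Real.sin_pi_div_four]
    rw [two_mul, Finset.sum_range_add, Finset.sum_add_distrib, ← Finset.smul_sum,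
      ← Finset.smul_sum, ← Finset.smul_sum, ← Finset.smul_sum, hlow, hhigh, smul_smul, smul_smul,
      smul_add]
  · rw [iidMoment]
    congr 2 with ω
    congr 2
    simp only [iidSum, rotX, rotW, one_smul, zero_smul, add_zero]
    rw [← Finset.smul_sum, hlow]

/-- A rotation by `π/2` exchanges the two laws copy by copy. Here `R` merely bounds the moments of
the whole sum and of its replacement; it may be large, since the factor `r` sends the cost to zero.
-/
lemma abs_iidMoment_replace_sub_le {p : ℕ} (hp : 2 ≤ p) (hd : d ≠ 0)
    {Z₀ : Matrix (Fin d) (Fin d) ℂ} (hZ : Z₀.IsHermitian) {X V : S → Matrix (Fin d) (Fin d) ℂ}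
    (hX : ∀ s, (X s).IsHermitian) (hV : ∀ s, (V s).IsHermitian)
    (hXm : ∀ a b, Measurable fun s => X s a b) (hVm : ∀ a b, Measurable fun s => V s a b)
    (hXp : ∀ a b, MemLp (fun s => X s a b) (2 * p : ℕ) P)
    (hVp : ∀ a b, MemLp (fun s => V s a b) (2 * p : ℕ) P)
    (hX0 : ∀ a b, ∫ s, X s a b ∂P = 0) (hV0 : ∀ a b, ∫ s, V s a b ∂P = 0)
    (hXV : ∀ a b e f, ∫ s, X s a b * X s e f ∂P = ∫ s, V s a b * V s e f ∂P)
    (hcr : ∀ a b e f, ∫ s, X s a b * V s e f ∂P = 0) {R : ℝ} (hR : 0 < R)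
    (hτ : ∫ s, retr (X s ^ (2 * p)) ∂P ≤ R ^ (2 * p))
    (hτ' : ∫ s, retr (V s ^ (2 * p)) ∂P ≤ R ^ (2 * p))
    {r : ℝ} (hr : 0 < r) (hr1 : r ≤ 1) {N : ℕ} (hN : r ^ 4 * N = 1) :
    |iidMoment P Z₀ p (r ^ 2) N V - iidMoment P Z₀ p (r ^ 2) N X| ≤ 1168 * p ^ 2 * (R * r) := by
  have h := rotationPair_replace (P := P) hX hV hXm hVm hXp hVp hX0 hV0 hXV hcr (r ^ 2) N
  have hσ0 : 0 ≤ ∫ s, retr (X s ^ 2) ∂P :=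
    integral_nonneg fun s => by simpa using retr_pow_two_mul_nonneg (hX s) 1
  have hbound : ∀ Y : S → Matrix (Fin d) (Fin d) ℂ, (∀ a b, Measurable fun s => Y s a b) →
      ∫ s, retr (Y s ^ (2 * p)) ∂P ≤ R ^ (2 * p) →
      ∑ j : Fin N, ∫ ω, retr ((r ^ 2 • Y (ω j)) ^ (2 * p)) ∂(iidCopies P) ≤
      (R * r) ^ (2 * p - 2) * ((R * r) ^ 2 +
        ∑ j : Fin N, ∫ ω, retr ((r ^ 2 • X (ω j)) ^ 2) ∂(iidCopies P)) := by
    intro Y hY hYR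
    simp only [integral_retr_smul_pow_eval (P := P) hY, integral_retr_smul_pow_eval (P := P) hXm]
    rw [Finset.sum_const, Finset.sum_const, Finset.card_univ, Fintype.card_fin, nsmul_eq_mul,
      nsmul_eq_mul]
    obtain ⟨q, rfl⟩ : ∃ q, p = q + 2 := ⟨p - 2, by omega⟩
    rw [show 2 * (q + 2) - 2 = 2 * q + 2 by omega]
    calc (N : ℝ) * ((r ^ 2) ^ (2 * (q + 2)) * ∫ s, retr (Y s ^ (2 * (q + 2))) ∂P)
        ≤ N * ((r ^ 2) ^ (2 * (q + 2)) * R ^ (2 * (q + 2))) := by gcongr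
      _ = r ^ (4 * q + 4) * (r ^ 4 * N) * R ^ (2 * q + 4) := by ring
      _ = r ^ (4 * q + 4) * R ^ (2 * q + 4) := by rw [hN, mul_one]
      _ ≤ r ^ (2 * q + 4) * R ^ (2 * q + 4) := by
          have : r ^ (4 * q + 4) ≤ r ^ (2 * q + 4) := pow_le_pow_of_le_one hr.le hr1 (by omega)
          gcongr
      _ = (R * r) ^ (2 * q + 2) * ((R * r) ^ 2 + 0) := by ring
      _ ≤ _ := by gcongr; positivity
  have key := h.abs_moment_sub_le hp hd hZ (by positivity : 0 < R * r) (hbound X hXm hτ)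
    (hbound V hVm hτ') (θ := Real.pi / 2) (by positivity) (by linarith [Real.pi_le_four])
  convert key using 3
  · rw [iidMoment]
    congr 2 with ω
    congr 2
    simp only [iidSum, rotX, rotW, Real.cos_pi_div_two, Real.sin_pi_div_two, one_smul, zero_smul,
      zero_add]
    rw [← Finset.smul_sum, Fin.sum_univ_eq_sum_range (fun j => V (ω j))]
  · rw [iidMoment]
    congr 2 with ω
    congr 2
    simp only [iidSum, rotX, rotW, one_smul, zero_smul, add_zero]
    rw [← Finset.smul_sum, Fin.sum_univ_eq_sum_range (fun j => X (ω j))]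

/-- Universality for a sum of independent matrices against a stable random matrix with the same
second moments. -/
theorem abs_moment_sub_stable_le [Fintype κ] {p : ℕ} (hp : 2 ≤ p) (hd : d ≠ 0)
    {Z₀ : Matrix (Fin d) (Fin d) ℂ} (hZ : Z₀.IsHermitian)
    (hherm : ∀ i s, (Z i s).IsHermitian)
    (hmeas : ∀ i a b, Measurable fun s => Z i s a b)
    (hmem : ∀ i a b, MemLp (fun s => Z i s a b) (2 * p : ℕ) P)
    (hind : iIndepFun (fun i s => (fun a b => Z i s a b : Fin d → Fin d → ℂ)) P)
    (hmean : ∀ i a b, ∫ s, Z i s a b ∂P = 0) {R : ℝ} (hR : 0 < R)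
    (hτ : ∑ i, ∫ s, retr (Z i s ^ (2 * p)) ∂P ≤
      R ^ (2 * p - 2) * (R ^ 2 + ∑ i, ∫ s, retr (Z i s ^ 2) ∂P))
    {V : S → Matrix (Fin d) (Fin d) ℂ} (hV : ∀ s, (V s).IsHermitian)
    (hVm : ∀ a b, Measurable fun s => V s a b)
    (hVp : ∀ a b, MemLp (fun s => V s a b) (2 * p : ℕ) P)
    (hV0 : ∀ a b, ∫ s, V s a b ∂P = 0)
    (hXV : ∀ a b e f, ∫ s, (∑ i, Z i s) a b * (∑ i, Z i s) e f ∂P = ∫ s, V s a b * V s e f ∂P)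
    (hcr : ∀ a b e f, ∫ s, (∑ i, Z i s) a b * V s e f ∂P = 0)
    (hstable : ∀ (c : ℝ) (N : ℕ), c ^ 2 * N = 1 →
      ∫ ω, retr (iidSum Z₀ c N V ω ^ (2 * p)) ∂(iidCopies P) =
        ∫ s, retr ((Z₀ + V s) ^ (2 * p)) ∂P) :
    |(∫ s, retr ((Z₀ + ∑ i, Z i s) ^ (2 * p)) ∂P) ^ (1 / (2 * (p : ℝ))) -
      (∫ s, retr ((Z₀ + V s) ^ (2 * p)) ∂P) ^ (1 / (2 * (p : ℝ)))| ≤ 8176 * p ^ 2 * R := by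
  set X : S → Matrix (Fin d) (Fin d) ℂ := fun s => ∑ i, Z i s with hXdef
  have hXh : ∀ s, (X s).IsHermitian := fun s => by
    simp only [hXdef, Matrix.IsHermitian, Matrix.conjTranspose_sum]
    exact Finset.sum_congr rfl fun i _ => hherm i s
  have hXm : ∀ a b, Measurable fun s => X s a b := fun a b => by
    simp only [hXdef, Matrix.sum_apply]
    exact Finset.measurable_sum _ fun i _ => hmeas i a b
  have hXp : ∀ a b, MemLp (fun s => X s a b) (2 * p : ℕ) P := fun a b => by
    simp only [hXdef, Matrix.sum_apply]
    exact memLp_finsetSum _ fun i _ => hmem i a b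
  have hX0 : ∀ a b, ∫ s, X s a b ∂P = 0 := fun a b => by
    simp only [hXdef, Matrix.sum_apply]
    rw [integral_finsetSum _ fun i _ => (hmem i a b).integrable (by exact_mod_cast (by omega))]
    exact Finset.sum_eq_zero fun i _ => hmean i a b
  -- `ρ = 2^(-1/4)`, so `r = ρ ^ m` corresponds to `N = 2 ^ m` copies.
  set ρ : ℝ := Real.sqrt (Real.sqrt 2 / 2) with hρ
  have hρ2 : ρ ^ 2 = Real.sqrt 2 / 2 := Real.sq_sqrt (by positivity)
  have hρ4 : ρ ^ 4 = 1 / 2 := by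
    rw [show ρ ^ 4 = (ρ ^ 2) ^ 2 by ring, hρ2, div_pow, Real.sq_sqrt (by norm_num)]; norm_num
  have hρ0 : 0 < ρ := Real.sqrt_pos.2 (by positivity)
  have hρ1 : ρ ≤ 17 / 20 := by
    by_contra hlt
    have : (17 / 20 : ℝ) ^ 4 ≤ ρ ^ 4 := by gcongr; exact (not_le.1 hlt).le
    rw [hρ4] at this
    norm_num at this
  have hpow : ∀ m : ℕ, (ρ ^ m) ^ 4 * ((2 ^ m : ℕ) : ℝ) = 1 := fun m => by
    rw [← pow_mul, mul_comm m 4, pow_mul, hρ4, Nat.cast_pow, ← mul_pow]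
    norm_num
  have hρm1 : ∀ m : ℕ, ρ ^ m ≤ 1 := fun m => pow_le_one₀ hρ0.le (by linarith)
  set K : ℝ := 1168 * p ^ 2 * R with hK
  have hK0 : 0 ≤ K := by positivity
  set M : ℕ → ℝ := fun m => iidMoment P Z₀ p ((ρ ^ m) ^ 2) (2 ^ m) X with hM
  have hstep : ∀ m, |M (m + 1) - M m| ≤ K * ρ ^ m := fun m => by
    have h := abs_iidMoment_double_sub_le hp hd hZ hherm hmeas hmem hind hmean hR hτ
      (pow_pos hρ0 m) (hρm1 m) (hpow m)
    have e : Real.sqrt 2 / 2 * (ρ ^ m) ^ 2 = (ρ ^ (m + 1)) ^ 2 := by rw [← hρ2]; ring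
    rw [e, ← pow_succ'] at h
    exact h.trans (le_of_eq (by rw [hK]; ring))
  have htel : ∀ m, |M m - M 0| ≤ K * ∑ k ∈ Finset.range m, ρ ^ k := fun m => by
    induction m with
    | zero => simp
    | succ m ih =>
      rw [Finset.sum_range_succ, mul_add]
      calc |M (m + 1) - M 0| = |(M m - M 0) + (M (m + 1) - M m)| := by congr 1; ring
        _ ≤ _ := (abs_add_le _ _).trans (add_le_add ih (hstep m))
  -- From `ρ ≤ 17/20` the series is at most `20/3`.
  have hgeom : ∀ m, ∑ k ∈ Finset.range m, ρ ^ k ≤ 7 := fun m => by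
    have h := mul_neg_geom_sum ρ m
    have h1 : 0 ≤ ρ ^ m := by positivity
    have h2 : 0 ≤ ∑ k ∈ Finset.range m, ρ ^ k := Finset.sum_nonneg fun k _ => by positivity
    nlinarith
  have hM0 : M 0 = (∫ s, retr ((Z₀ + ∑ i, Z i s) ^ (2 * p)) ∂P) ^ (1 / (2 * (p : ℝ))) := by
    have hm : ∀ a b, Measurable fun s => (Z₀ + X s) a b := fun a b =>
      (hXm a b).const_add _
    have h := integral_iidCopies_eval P (f := fun s => retr ((Z₀ + X s) ^ (2 * p)))
      (measurable_retr_pow hm _).aestronglyMeasurable 0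
    simp only [hM, iidMoment, iidSum, pow_zero, one_pow, one_smul, Finset.sum_range_one]
    rw [h]
  set L := (∫ s, retr ((Z₀ + V s) ^ (2 * p)) ∂P) ^ (1 / (2 * (p : ℝ))) with hL
  -- Only finiteness of `R'` matters; the `1` makes `R'` at most its own power `2p`.
  set R' : ℝ := 1 + max (∫ s, retr (X s ^ (2 * p)) ∂P) (∫ s, retr (V s ^ (2 * p)) ∂P) with hR'
  have hmax : 0 ≤ max (∫ s, retr (X s ^ (2 * p)) ∂P) (∫ s, retr (V s ^ (2 * p)) ∂P) :=
    le_max_of_le_left (integral_nonneg fun s => retr_pow_two_mul_nonneg (hXh s) p)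
  have hR'1 : 1 ≤ R' := by linarith
  have hR'p : R' ≤ R' ^ (2 * p) := le_self_pow₀ hR'1 (by omega)
  have hlast : ∀ m, |L - M m| ≤ 1168 * p ^ 2 * R' * ρ ^ m := fun m => by
    have h := abs_iidMoment_replace_sub_le hp hd hZ hXh hV hXm hVm hXp hVp hX0 hV0 hXV hcr
      (zero_lt_one.trans_le hR'1)
      (((le_max_left _ _).trans (by linarith)).trans hR'p)
      (((le_max_right _ _).trans (by linarith)).trans hR'p) (pow_pos hρ0 m) (hρm1 m) (hpow m)
    have e : iidMoment P Z₀ p ((ρ ^ m) ^ 2) (2 ^ m) V = L := by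
      rw [iidMoment, hstable _ _ (by rw [← hpow m]; ring)]
    rw [e] at h
    exact h.trans (le_of_eq (by ring))
  rw [← hM0]
  have hall : ∀ m, |M 0 - L| ≤ 7 * K + 1168 * p ^ 2 * R' * ρ ^ m := fun m => by
    have h1 := htel m
    have h2 : K * ∑ k ∈ Finset.range m, ρ ^ k ≤ K * 7 :=
      mul_le_mul_of_nonneg_left (hgeom m) hK0
    have h3 := hlast m
    calc |M 0 - L| = |(M m - M 0) + (L - M m)| := by
          rw [← abs_neg]; congr 1; ring
      _ ≤ _ := (abs_add_le _ _).trans (by linarith)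
  have hlim : Filter.Tendsto (fun m : ℕ => 7 * K + 1168 * p ^ 2 * R' * ρ ^ m) Filter.atTop
      (nhds (7 * K + 1168 * p ^ 2 * R' * 0)) :=
    ((tendsto_pow_atTop_nhds_zero_of_lt_one hρ0.le (by linarith)).const_mul _).const_add _
  refine (ge_of_tendsto' hlim hall).trans (le_of_eq ?_)
  rw [hK]
  ring

end Chain

/-! ### Entrywise integrability from trace moments. -/

section Integrability

variable {d : ℕ} {Ω : Type*} [MeasurableSpace Ω] {μ : Measure Ω}

open scoped Matrix.Norms.Frobenius in
lemma integrable_retr_pow_of_memLp [IsProbabilityMeasure μ]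
    {M : Ω → Matrix (Fin d) (Fin d) ℂ} {r : ℕ}
    (hm : ∀ a b, Measurable fun ω => M ω a b) (hp : ∀ a b, MemLp (fun ω => M ω a b) r μ) :
    Integrable (fun ω => retr (M ω ^ r)) μ := by
  set g : Ω → ℝ := fun ω => 1 + ∑ a, ∑ b, ‖M ω a b‖ with hg
  have hg1 : ∀ ω, 1 ≤ g ω := fun ω => le_add_of_nonneg_right (by positivity)
  have hgL : MemLp g r μ := (memLp_const (1 : ℝ)).add (memLp_finsetSum _ fun a _ =>
    memLp_finsetSum _ fun b _ => (hp a b).norm)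
  have hgi : Integrable (fun ω => g ω ^ r) μ :=
    hgL.integrable_norm_pow'.congr (Filter.Eventually.of_forall fun ω => by
      simp only
      rw [Real.norm_of_nonneg (zero_le_one.trans (hg1 ω))])
  have hM : Dominated g 1 M := ⟨hm, 1, fun ω => (norm_le_sum_entries _).trans (by
    rw [one_mul, pow_one, hg]; simp)⟩
  exact (hM.pow hg1 r).integrable_retr hg1 le_rfl hgi

/-- A squared entry is at most `Tr A^2 = d tr A^2`; the power-mean inequality over eigenvalues then
passes to `tr A^(2p)`. -/
lemma norm_entry_pow_le {A : Matrix (Fin d) (Fin d) ℂ} (hA : A.IsHermitian) (p : ℕ)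
    (a b : Fin d) : ‖A a b‖ ^ (2 * p) ≤ (d : ℝ) ^ p * retr (A ^ (2 * p)) := by
  have hd : (0 : ℝ) < d := by exact_mod_cast a.pos
  obtain ⟨l, -, h2, -⟩ := exists_eigenvalues_retr hA
  have h3 : ‖A a b‖ ^ 2 ≤ d * retr (A ^ 2) := by
    have := retr_conjTranspose_mul_self A
    rw [hA.eq, ← pow_two] at this
    rw [this, mul_inv_cancel_left₀ hd.ne']
    exact (Finset.single_le_sum (f := fun i => ‖A i b‖ ^ 2) (fun i _ => by positivity)
      (Finset.mem_univ a)).trans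
      (Finset.single_le_sum (f := fun j => ∑ i, ‖A i j‖ ^ 2) (fun i _ => by positivity)
        (Finset.mem_univ b))
  have h4 : retr (A ^ 2) ^ p ≤ retr (A ^ (2 * p)) := by
    have := Real.pow_arith_mean_le_arith_mean_pow Finset.univ (fun _ : Fin d => (d : ℝ)⁻¹)
      (fun i => l i ^ 2) (fun _ _ => by positivity) (by simp [hd.ne']) (fun _ _ => by positivity) p
    rw [h2, h2, Finset.mul_sum, Finset.mul_sum]
    simpa only [pow_mul] using this
  calc ‖A a b‖ ^ (2 * p) = (‖A a b‖ ^ 2) ^ p := pow_mul _ _ _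
    _ ≤ (d * retr (A ^ 2)) ^ p := by gcongr
    _ = (d : ℝ) ^ p * retr (A ^ 2) ^ p := mul_pow _ _ _
    _ ≤ _ := by gcongr

lemma memLp_entry_of_lintegral_lt_top {A : Ω → Matrix (Fin d) (Fin d) ℂ}
    (hA : ∀ ω, (A ω).IsHermitian) (hm : ∀ a b, Measurable fun ω => A ω a b) {p : ℕ} (hp : 1 ≤ p)
    (h : ∫⁻ ω, ENNReal.ofReal (retr (A ω ^ (2 * p))) ∂μ < ∞) (a b : Fin d) :
    MemLp (fun ω => A ω a b) (2 * p : ℕ) μ := by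
  have h0 : ((2 * p : ℕ) : ℝ≥0∞) ≠ 0 := by exact_mod_cast (by omega : 2 * p ≠ 0)
  refine ⟨(hm a b).aestronglyMeasurable, ?_⟩
  rw [eLpNorm_lt_top_iff_lintegral_rpow_enorm_lt_top h0 (ENNReal.natCast_ne_top _)]
  have hle : ∀ ω, ‖A ω a b‖ₑ ^ ((2 * p : ℕ) : ℝ≥0∞).toReal ≤
      ENNReal.ofReal ((d : ℝ) ^ p) * ENNReal.ofReal (retr (A ω ^ (2 * p))) := fun ω => by
    rw [ENNReal.toReal_natCast, ENNReal.rpow_natCast, ← ENNReal.ofReal_mul (by positivity),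
      ← ofReal_norm, ← ENNReal.ofReal_pow (norm_nonneg _)]
    exact ENNReal.ofReal_le_ofReal (norm_entry_pow_le (hA ω) p a b)
  refine (lintegral_mono hle).trans_lt ?_
  rw [lintegral_const_mul' _ _ ENNReal.ofReal_ne_top]
  exact ENNReal.mul_lt_top ENNReal.ofReal_lt_top h

end Integrability

/-! ### From the parameter `R_q` to the bound on pure powers. -/

section SchattenBound

variable {d : ℕ}

lemma retr_matAbsPow_nonneg {A : Matrix (Fin d) (Fin d) ℂ} (hA : A.IsHermitian) (q : ℝ) :
    0 ≤ retr (matAbsPow A q) := by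
  obtain ⟨l, h1, -⟩ := exists_eigenvalues_retr hA
  rw [h1]
  exact mul_nonneg (by positivity) (Finset.sum_nonneg fun i _ => Real.rpow_nonneg (abs_nonneg _) _)

/-- Eigenvalues below `R` are compared with the square and those above with the power `q`. This
truncation treats all `q ≥ 2p` uniformly and needs only `R_q`. -/
lemma retr_pow_le_matAbsPow {A : Matrix (Fin d) (Fin d) ℂ} (hA : A.IsHermitian) {p : ℕ}
    (hp : 1 ≤ p) {q : ℝ} (hq : 2 * (p : ℝ) ≤ q) {R : ℝ} (hR : 0 < R) :
    retr (A ^ (2 * p)) ≤ R ^ (2 * (p : ℝ) - q) * retr (matAbsPow A q) +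
      R ^ (2 * p - 2) * retr (A ^ 2) := by
  obtain ⟨l, h1, h2, -⟩ := exists_eigenvalues_retr hA
  rw [h1, h2, h2, mul_left_comm, mul_left_comm _ (d : ℝ)⁻¹, ← mul_add, Finset.mul_sum _ _ (_ ^ _),
    Finset.mul_sum _ _ (_ ^ _), ← Finset.sum_add_distrib]
  refine mul_le_mul_of_nonneg_left (Finset.sum_le_sum fun i _ => ?_) (by positivity)
  rw [pow_mul, ← sq_abs (l i), ← pow_mul]
  set t := |l i| with ht
  have ht0 : 0 ≤ t := abs_nonneg _
  rcases le_total t R with htR | htR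
  · have e : t ^ (2 * p) = t ^ (2 * p - 2) * t ^ 2 := by rw [← pow_add]; congr 1; omega
    have : t ^ (2 * p) ≤ R ^ (2 * p - 2) * t ^ 2 := by rw [e]; gcongr
    have h0 : 0 ≤ R ^ (2 * (p : ℝ) - q) * t ^ q :=
      mul_nonneg (Real.rpow_nonneg hR.le _) (Real.rpow_nonneg ht0 _)
    linarith
  · have ht1 : 0 < t := hR.trans_le htR
    have e : t ^ (2 * p) = t ^ (2 * (p : ℝ) - q) * t ^ q := by
      rw [← Real.rpow_add ht1, sub_add_cancel, ← Real.rpow_natCast]; push_cast; rfl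
    have : t ^ (2 * (p : ℝ) - q) ≤ R ^ (2 * (p : ℝ) - q) :=
      Real.rpow_le_rpow_of_nonpos hR htR (by linarith)
    have h3 : t ^ (2 * p) ≤ R ^ (2 * (p : ℝ) - q) * t ^ q := by
      rw [e]; exact mul_le_mul_of_nonneg_right this (Real.rpow_nonneg ht0 _)
    have h0 : 0 ≤ R ^ (2 * p - 2) * t ^ 2 := by positivity
    linarith

lemma retr_pow_le_of_specNorm_le {A : Matrix (Fin d) (Fin d) ℂ} (hA : A.IsHermitian) {p : ℕ}
    (hp : 1 ≤ p) {R : ℝ} (hR : specNorm A ≤ R) :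
    retr (A ^ (2 * p)) ≤ R ^ (2 * p - 2) * retr (A ^ 2) := by
  obtain ⟨l, -, h2, h3⟩ := exists_eigenvalues_retr hA
  rw [h2, h2, mul_left_comm, Finset.mul_sum _ _ (_ ^ _)]
  refine mul_le_mul_of_nonneg_left (Finset.sum_le_sum fun i _ => ?_) (by positivity)
  rw [pow_mul, ← sq_abs (l i), ← pow_mul]
  have e : |l i| ^ (2 * p) = |l i| ^ (2 * p - 2) * |l i| ^ 2 := by
    rw [← pow_add]; congr 1; omega
  rw [e]
  gcongr
  exact (h3 i).trans hR

variable {n : ℕ} {Ω : Type*} [MeasurableSpace Ω] {μ : Measure Ω}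
  {Z : Fin n → Ω → Matrix (Fin d) (Fin d) ℂ}

/-- The inequality is kept in extended reals because finiteness of the `2p`-th moments is not
assumed: it is deduced from this bound and the finite second moments. -/
lemma sum_lintegral_pow_le_of_matR_le (hherm : ∀ i ω, (Z i ω).IsHermitian)
    (hmeas : ∀ i a b, Measurable fun ω => Z i ω a b) {p : ℕ} (hp : 1 ≤ p) {q : ℝ≥0∞}
    (hq : 2 * (p : ℝ≥0∞) ≤ q) {R : ℝ} (hR : 0 < R) (h : matR μ Z q ≤ ENNReal.ofReal R) :
    ∑ i, ∫⁻ ω, ENNReal.ofReal (retr (Z i ω ^ (2 * p))) ∂μ ≤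
      ENNReal.ofReal (R ^ (2 * p - 2)) * (ENNReal.ofReal (R ^ 2) +
        ∑ i, ∫⁻ ω, ENNReal.ofReal (retr (Z i ω ^ 2)) ∂μ) := by
  have hRp : 0 ≤ R ^ (2 * p - 2) := by positivity
  have hm2 : ∀ i, Measurable fun ω => ENNReal.ofReal (R ^ (2 * p - 2) * retr (Z i ω ^ 2)) :=
    fun i => ((measurable_retr_pow (hmeas i) 2).const_mul _).ennreal_ofReal
  have hpull : ∀ i, ∫⁻ ω, ENNReal.ofReal (R ^ (2 * p - 2) * retr (Z i ω ^ 2)) ∂μ =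
      ENNReal.ofReal (R ^ (2 * p - 2)) * ∫⁻ ω, ENNReal.ofReal (retr (Z i ω ^ 2)) ∂μ := fun i => by
    simp only [ENNReal.ofReal_mul hRp]
    exact lintegral_const_mul' _ _ ENNReal.ofReal_ne_top
  by_cases hqt : q = ∞
  · rw [matR, if_pos hqt] at h
    have hae : ∀ᵐ ω ∂μ, ∀ i, specNorm (Z i ω) ≤ R := by
      filter_upwards [ENNReal.ae_le_essSup
        (fun ω => ⨆ i, ENNReal.ofReal (specNorm (Z i ω)))] with ω hω i
      have := ((le_iSup (fun i => ENNReal.ofReal (specNorm (Z i ω))) i).trans hω).trans h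
      exact (ENNReal.ofReal_le_ofReal_iff hR.le).1 this
    rw [mul_add, Finset.mul_sum]
    refine le_trans ?_ le_add_self
    refine Finset.sum_le_sum fun i _ => ?_
    rw [← hpull]
    refine lintegral_mono_ae ?_
    filter_upwards [hae] with ω hω
    exact ENNReal.ofReal_le_ofReal (retr_pow_le_of_specNorm_le (hherm i ω) hp (hω i))
  · rw [matR, if_neg hqt] at h
    have hq' : 2 * (p : ℝ) ≤ q.toReal := by
      have := (ENNReal.toReal_le_toReal (by simp [ENNReal.mul_eq_top]) hqt).2 hq
      simpa using this
    have hp' : (1 : ℝ) ≤ p := by exact_mod_cast hp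
    have hq0 : 0 < q.toReal := by linarith
    have hsum : ∑ i, ∫⁻ ω, ENNReal.ofReal (retr (matAbsPow (Z i ω) q.toReal)) ∂μ ≤
        ENNReal.ofReal (R ^ q.toReal) := by
      have := ENNReal.rpow_le_rpow h hq0.le
      rwa [← ENNReal.rpow_mul, one_div, inv_mul_cancel₀ hq0.ne', ENNReal.rpow_one,
        ENNReal.ofReal_rpow_of_nonneg hR.le hq0.le] at this
    have hone : ∀ i, ∫⁻ ω, ENNReal.ofReal (retr (Z i ω ^ (2 * p))) ∂μ ≤
        ENNReal.ofReal (R ^ (2 * (p : ℝ) - q.toReal)) *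
          (∫⁻ ω, ENNReal.ofReal (retr (matAbsPow (Z i ω) q.toReal)) ∂μ) +
        ENNReal.ofReal (R ^ (2 * p - 2)) * ∫⁻ ω, ENNReal.ofReal (retr (Z i ω ^ 2)) ∂μ := by
      intro i
      rw [← hpull, ← lintegral_const_mul' _ _ ENNReal.ofReal_ne_top,
        ← lintegral_add_right _ (hm2 i)]
      refine lintegral_mono fun ω => ?_
      rw [← ENNReal.ofReal_mul (Real.rpow_nonneg hR.le _), ← ENNReal.ofReal_add
        (mul_nonneg (Real.rpow_nonneg hR.le _) (retr_matAbsPow_nonneg (hherm i ω) _))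
        (mul_nonneg hRp (by simpa using retr_pow_two_mul_nonneg (hherm i ω) 1))]
      exact ENNReal.ofReal_le_ofReal (retr_pow_le_matAbsPow (hherm i ω) hp hq' hR)
    refine (Finset.sum_le_sum fun i _ => hone i).trans ?_
    rw [Finset.sum_add_distrib, ← Finset.mul_sum, ← Finset.mul_sum, mul_add]
    refine add_le_add_left ?_ _
    calc _ ≤ ENNReal.ofReal (R ^ (2 * (p : ℝ) - q.toReal)) * ENNReal.ofReal (R ^ q.toReal) := by
          gcongr
      _ = ENNReal.ofReal (R ^ (2 * p - 2)) * ENNReal.ofReal (R ^ 2) := by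
          rw [← ENNReal.ofReal_mul (Real.rpow_nonneg hR.le _), ← Real.rpow_add hR, sub_add_cancel,
            ← ENNReal.ofReal_mul hRp, ← pow_add, ← Real.rpow_natCast]
          congr 2
          rw [show 2 * p - 2 + 2 = 2 * p by omega]
          push_cast
          rfl

variable [IsProbabilityMeasure μ]

lemma memLp_entry_of_matR_le (hherm : ∀ i ω, (Z i ω).IsHermitian)
    (hmeas : ∀ i a b, Measurable fun ω => Z i ω a b)
    (hmem : ∀ i a b, MemLp (fun ω => Z i ω a b) 2 μ) {p : ℕ} (hp : 1 ≤ p) {q : ℝ≥0∞}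
    (hq : 2 * (p : ℝ≥0∞) ≤ q) {R : ℝ} (hR : 0 < R) (h : matR μ Z q ≤ ENNReal.ofReal R)
    (i : Fin n) (a b : Fin d) : MemLp (fun ω => Z i ω a b) (2 * p : ℕ) μ := by
  have hb := sum_lintegral_pow_le_of_matR_le hherm hmeas hp hq hR h
  have h2 : ∀ i, ∫⁻ ω, ENNReal.ofReal (retr (Z i ω ^ 2)) ∂μ < ∞ := fun i =>
    (integrable_retr_pow_of_memLp (r := 2) (hmeas i)
      (by exact_mod_cast hmem i)).lintegral_lt_top
  refine memLp_entry_of_lintegral_lt_top (hherm i) (hmeas i) hp ?_ a b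
  refine (Finset.single_le_sum (f := fun i => ∫⁻ ω, ENNReal.ofReal (retr (Z i ω ^ (2 * p))) ∂μ)
    (fun _ _ => zero_le) (Finset.mem_univ i)).trans_lt (hb.trans_lt ?_)
  exact ENNReal.mul_lt_top ENNReal.ofReal_lt_top
    (ENNReal.add_lt_top.2 ⟨ENNReal.ofReal_lt_top, ENNReal.sum_lt_top.2 fun i _ => h2 i⟩)

lemma sum_integral_pow_le_of_matR_le (hherm : ∀ i ω, (Z i ω).IsHermitian)
    (hmeas : ∀ i a b, Measurable fun ω => Z i ω a b)
    (hmem : ∀ i a b, MemLp (fun ω => Z i ω a b) 2 μ) {p : ℕ} (hp : 1 ≤ p) {q : ℝ≥0∞}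
    (hq : 2 * (p : ℝ≥0∞) ≤ q) {R : ℝ} (hR : 0 < R) (h : matR μ Z q ≤ ENNReal.ofReal R) :
    ∑ i, ∫ ω, retr (Z i ω ^ (2 * p)) ∂μ ≤
      R ^ (2 * p - 2) * (R ^ 2 + ∑ i, ∫ ω, retr (Z i ω ^ 2) ∂μ) := by
  have hb := sum_lintegral_pow_le_of_matR_le hherm hmeas hp hq hR h
  have hnn : ∀ (k : ℕ) i ω, 0 ≤ retr (Z i ω ^ (2 * k)) :=
    fun k i ω => retr_pow_two_mul_nonneg (hherm i ω) k
  have hconv : ∀ k : ℕ, (∀ i a b, MemLp (fun ω => Z i ω a b) (2 * k : ℕ) μ) →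
      ∑ i, ∫⁻ ω, ENNReal.ofReal (retr (Z i ω ^ (2 * k))) ∂μ =
        ENNReal.ofReal (∑ i, ∫ ω, retr (Z i ω ^ (2 * k)) ∂μ) := fun k hk => by
    rw [ENNReal.ofReal_sum_of_nonneg fun i _ => integral_nonneg (hnn k i)]
    exact Finset.sum_congr rfl fun i _ => (ofReal_integral_eq_lintegral_ofReal
      (integrable_retr_pow_of_memLp (hmeas i) (hk i))
      (Filter.Eventually.of_forall (hnn k i))).symm
  have h1 := hconv 1 (by exact_mod_cast hmem)
  rw [mul_one] at h1
  have hs0 : 0 ≤ ∑ i, ∫ ω, retr (Z i ω ^ 2) ∂μ :=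
    Finset.sum_nonneg fun i _ => integral_nonneg fun ω => by simpa using hnn 1 i ω
  rw [h1, hconv p (memLp_entry_of_matR_le hherm hmeas hmem hp hq hR h),
    ← ENNReal.ofReal_add (by positivity) hs0, ← ENNReal.ofReal_mul (by positivity)] at hb
  exact (ENNReal.ofReal_le_ofReal_iff (by positivity)).1 hb

end SchattenBound

/-! ### Stability of Gaussian laws. -/

section Stability

variable {E : Type*} [NormedAddCommGroup E] [NormedSpace ℝ E] [MeasurableSpace E] [BorelSpace E]
  [SecondCountableTopology E] [CompleteSpace E] {S : Type*} [MeasurableSpace S] {P : Measure S}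
  [IsProbabilityMeasure P]

/-- Gaussian laws are stable under normalized centered sums of independent copies. -/
lemma map_iidCopies_gaussian_sum {Y : S → E} (hYm : Measurable Y) (hY : HasGaussianLaw Y P)
    {m : E} (hm : ∫ s, Y s ∂P = m) {c : ℝ} {N : ℕ} (hc : c ^ 2 * N = 1) :
    (iidCopies P).map (fun ω => m + c • ∑ j ∈ Finset.range N, (Y (ω j) - m)) = P.map Y := by
  have hev : ∀ j, MeasurePreserving (Function.eval j) (iidCopies P) P :=
    fun j => measurePreserving_eval_infinitePi (fun _ : ℕ => P) j
  have hind := iIndepFun_iidCopies P hYm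
  have hG : ∀ j : ℕ, HasGaussianLaw (fun ω : ℕ → S => Y (ω j)) (iidCopies P) := fun j => by
    refine ⟨?_⟩
    have : (iidCopies P).map (fun ω : ℕ → S => Y (ω j)) = P.map Y := by
      conv_rhs => rw [← (hev j).map_eq, Measure.map_map hYm (hev j).measurable]
      rfl
    rw [this]
    exact hY.isGaussian_map
  have hS : HasGaussianLaw (fun ω : ℕ → S => ∑ j : Fin N, Y (ω j)) (iidCopies P) :=
    iIndepFun.hasGaussianLaw_fun_sum (fun j : Fin N => hG j)
      (hind.precomp (Fin.val_injective (n := N)))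
  have hform : (fun ω : ℕ → S => m + c • ∑ j ∈ Finset.range N, (Y (ω j) - m)) =
      fun ω => c • ∑ j : Fin N, Y (ω j) + (m - (c * N) • m) := by
    funext ω
    rw [Fin.sum_univ_eq_sum_range (fun j => Y (ω j)), Finset.sum_sub_distrib, Finset.sum_const,
      Finset.card_range, smul_sub, mul_smul, Nat.cast_smul_eq_nsmul]
    abel
  have hW : HasGaussianLaw (fun ω : ℕ → S => m + c • ∑ j ∈ Finset.range N, (Y (ω j) - m))
      (iidCopies P) := by
    rw [hform]
    refine ⟨?_⟩
    have h1 := (hS.fun_smul c).isGaussian_map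
    have hms : Measurable fun ω : ℕ → S => c • ∑ j : Fin N, Y (ω j) :=
      (Finset.measurable_sum _ fun j _ => hYm.comp (measurable_pi_apply _)).const_smul c
    have h2 : (iidCopies P).map (fun ω : ℕ → S => c • ∑ j : Fin N, Y (ω j) + (m - (c * N) • m)) =
        ((iidCopies P).map fun ω : ℕ → S => c • ∑ j : Fin N, Y (ω j)).map
          (· + (m - (c * N) • m)) := by
      rw [Measure.map_map (measurable_add_const _) hms]
      rfl
    rw [h2]
    infer_instance
  have := hW.isGaussian_map
  have := hY.isGaussian_map
  -- Both laws are Gaussian, so it suffices to match mean and variance of each continuous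
  -- functional; `c ^ 2 * N = 1` gives the variance.
  refine Measure.ext_of_charFunDual ?_
  funext L
  have hLint : ∀ j, Integrable (fun ω : ℕ → S => L (Y (ω j))) (iidCopies P) := fun j =>
    L.integrable_comp (hG j).integrable
  have hLY : ∫ s, L (Y s) ∂P = L m := by rw [L.integral_comp_comm hY.integrable, hm]
  have hLj : ∀ j, ∫ ω, L (Y (ω j)) ∂(iidCopies P) = L m := fun j => by
    rw [integral_iidCopies_eval P (f := fun s => L (Y s))
      (L.continuous.measurable.comp hYm).aestronglyMeasurable, hLY]
  have hLW : ∀ ω : ℕ → S, L (m + c • ∑ j ∈ Finset.range N, (Y (ω j) - m)) =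
      c * ∑ j ∈ Finset.range N, L (Y (ω j)) + (L m - c * N * L m) := fun ω => by
    simp only [map_add, map_smul, map_sum, map_sub, Finset.sum_sub_distrib, smul_eq_mul,
      Finset.sum_const, Finset.card_range, map_nsmul, nsmul_eq_mul]
    ring
  have hmean : ∫ ω, L (m + c • ∑ j ∈ Finset.range N, (Y (ω j) - m)) ∂(iidCopies P) =
      ∫ s, L (Y s) ∂P := by
    simp only [hLW]
    rw [integral_add ((integrable_finsetSum _ fun j _ => hLint j).const_mul c)
      (integrable_const _), integral_const_mul, integral_finsetSum _ fun j _ => hLint j, hLY]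
    simp only [hLj, Finset.sum_const, Finset.card_range, nsmul_eq_mul, integral_const,
      probReal_univ, one_smul]
    ring
  have hmemLp : ∀ j, MemLp (fun ω : ℕ → S => L (Y (ω j))) 2 (iidCopies P) := fun j =>
    ((hG j).map_fun L).memLp_two
  have hvar : Var[fun ω => L (m + c • ∑ j ∈ Finset.range N, (Y (ω j) - m)); iidCopies P] =
      Var[fun s => L (Y s); P] := by
    simp only [hLW]
    have hvj : ∀ j, Var[fun ω : ℕ → S => L (Y (ω j)); iidCopies P] = Var[fun s => L (Y s); P] :=
      fun j => (hev j).variance_fun_comp (f := fun s => L (Y s))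
        (L.continuous.measurable.comp hYm).aemeasurable
    have hsum : Var[∑ j ∈ Finset.range N, fun ω : ℕ → S => L (Y (ω j)); iidCopies P] =
        N * Var[fun s => L (Y s); P] := by
      rw [IndepFun.variance_sum (fun j _ => hmemLp j)]
      · simp [hvj]
      · exact fun i _ j _ hij => (hind.indepFun hij).comp L.continuous.measurable
          L.continuous.measurable
    have hfun : (fun ω : ℕ → S => ∑ j ∈ Finset.range N, L (Y (ω j))) =
        ∑ j ∈ Finset.range N, fun ω : ℕ → S => L (Y (ω j)) := by
      funext ω; simp
    rw [variance_add_const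
      ((integrable_finsetSum _ fun j _ => hLint j).const_mul c).aestronglyMeasurable,
      variance_const_mul, hfun, hsum, ← mul_assoc, hc, one_mul]
  rw [hW.charFunDual_map_eq_fun, hY.charFunDual_map_eq_fun, hmean, hvar]

end Stability

/-! ### Transfer of the Gaussian model to its law on real coordinates. -/

section GaussianModel

variable {d : ℕ}

/-- The self-adjoint part of the matrix with the given real and imaginary parts. -/
noncomputable def ofReIm (v : (Fin d × Fin d) ⊕ (Fin d × Fin d) → ℝ) :
    Matrix (Fin d) (Fin d) ℂ :=
  Matrix.of fun a b => ((2⁻¹ * (v (.inl (a, b)) + v (.inl (b, a))) : ℝ) : ℂ) +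
    Complex.I * ((2⁻¹ * (v (.inr (a, b)) - v (.inr (b, a))) : ℝ) : ℂ)

lemma isHermitian_ofReIm (v : (Fin d × Fin d) ⊕ (Fin d × Fin d) → ℝ) :
    (ofReIm v).IsHermitian := by
  ext a b
  simp only [ofReIm, Matrix.conjTranspose_apply, Matrix.of_apply, Complex.star_def, map_add,
    map_mul, Complex.conj_I, Complex.conj_ofReal]
  push_cast
  ring

lemma ofReIm_reImEntries {M : Matrix (Fin d) (Fin d) ℂ} (hM : M.IsHermitian) :
    ofReIm (reImEntries M) = M := by
  ext a b
  have h : M b a = star (M a b) := (hM.apply b a).symm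
  simp only [ofReIm, reImEntries, Matrix.of_apply, Sum.elim_inl, Sum.elim_inr, h]
  apply Complex.ext <;> simp <;> ring

lemma ofReIm_add (v w : (Fin d × Fin d) ⊕ (Fin d × Fin d) → ℝ) :
    ofReIm (v + w) = ofReIm v + ofReIm w := by
  ext a b
  simp only [ofReIm, Matrix.add_apply, Matrix.of_apply, Pi.add_apply]
  push_cast
  ring

lemma ofReIm_smul (c : ℝ) (v : (Fin d × Fin d) ⊕ (Fin d × Fin d) → ℝ) :
    ofReIm (c • v) = c • ofReIm v := by
  ext a b
  simp only [ofReIm, Matrix.smul_apply, Matrix.of_apply, Pi.smul_apply, smul_eq_mul,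
    Complex.real_smul]
  push_cast
  ring

lemma ofReIm_sub (v w : (Fin d × Fin d) ⊕ (Fin d × Fin d) → ℝ) :
    ofReIm (v - w) = ofReIm v - ofReIm w := by
  rw [sub_eq_add_neg, ofReIm_add, ← neg_one_smul ℝ w, ofReIm_smul, neg_one_smul, sub_eq_add_neg]

lemma ofReIm_sum {ι : Type*} (s : Finset ι)
    (v : ι → (Fin d × Fin d) ⊕ (Fin d × Fin d) → ℝ) :
    ofReIm (∑ i ∈ s, v i) = ∑ i ∈ s, ofReIm (v i) := by
  classical
  induction s using Finset.induction_on with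
  | empty => simpa using ofReIm_smul 0 (0 : (Fin d × Fin d) ⊕ (Fin d × Fin d) → ℝ)
  | insert i s hi ih => rw [Finset.sum_insert hi, Finset.sum_insert hi, ofReIm_add, ih]

lemma measurable_ofReIm (a b : Fin d) :
    Measurable fun v : (Fin d × Fin d) ⊕ (Fin d × Fin d) → ℝ => ofReIm v a b := by
  simp only [ofReIm, Matrix.of_apply]
  fun_prop

lemma memLp_ofReIm {S : Type*} [MeasurableSpace S] {P : Measure S}
    {Y : S → (Fin d × Fin d) ⊕ (Fin d × Fin d) → ℝ} (hY : HasGaussianLaw Y P) (r : ℕ)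
    (a b : Fin d) : MemLp (fun s => ofReIm (Y s) a b) r P := by
  have h : ∀ x, MemLp (fun s => Y s x) r P := fun x =>
    (HasGaussianLaw.eval (X := fun x s => Y s x) hY x).memLp (ENNReal.natCast_ne_top r)
  have h1 : MemLp (fun s => 2⁻¹ * (Y s (.inl (a, b)) + Y s (.inl (b, a)))) r P :=
    ((h _).add (h _)).const_mul _
  have h2 : MemLp (fun s => 2⁻¹ * (Y s (.inr (a, b)) - Y s (.inr (b, a)))) r P :=
    ((h _).sub (h _)).const_mul _
  have h3 : MemLp (fun s => Complex.I *
      ((2⁻¹ * (Y s (.inr (a, b)) - Y s (.inr (b, a))) : ℝ) : ℂ)) r P :=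
    (h2.ofReal (K := ℂ)).const_mul Complex.I
  exact (h1.ofReal (K := ℂ)).add h3

variable {Ω' : Type*} [MeasurableSpace Ω'] {ν : Measure Ω'} {G : Ω' → Matrix (Fin d) (Fin d) ℂ}

/-- The Gaussian law provides `G` with only almost everywhere measurable coordinates; working with
their law gives a measurable, everywhere Hermitian representative. -/
lemma integral_comp_ofReIm {E : Type*} [NormedAddCommGroup E] [NormedSpace ℝ E]
    (hG : ∀ ω, (G ω).IsHermitian) (hg : AEMeasurable (fun ω => reImEntries (G ω)) ν)
    {F : Matrix (Fin d) (Fin d) ℂ → E}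
    (hF : AEStronglyMeasurable (fun v => F (ofReIm v)) (ν.map fun ω => reImEntries (G ω))) :
    ∫ v, F (ofReIm v) ∂(ν.map fun ω => reImEntries (G ω)) = ∫ ω, F (G ω) ∂ν := by
  rw [integral_map hg hF]
  simp only [ofReIm_reImEntries (hG _)]

lemma integrable_retr_gaussian (hG : ∀ ω, (G ω).IsHermitian)
    (hg : HasGaussianLaw (fun ω => reImEntries (G ω)) ν) (r : ℕ) :
    Integrable (fun ω => retr (G ω ^ r)) ν := by
  have := hg.isGaussian_map
  have h := integrable_retr_pow_of_memLp (r := r) measurable_ofReIm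
    (memLp_ofReIm (IsGaussian.hasGaussianLaw_id (μ := ν.map fun ω => reImEntries (G ω))) r)
  have h2 := h.comp_aemeasurable hg.aemeasurable
  simpa only [Function.comp_def, id, ofReIm_reImEntries (hG _)] using h2

/-- The second moment of the trace depends only on the mean and the covariance. -/
lemma integral_retr_add_sq_eq {S : Type*} [MeasurableSpace S] {P : Measure S}
    [IsProbabilityMeasure P] {Z₀ : Matrix (Fin d) (Fin d) ℂ} {X : S → Matrix (Fin d) (Fin d) ℂ}
    (hXp : ∀ a b, MemLp (fun s => X s a b) 2 P) (hX0 : ∀ a b, ∫ s, X s a b ∂P = 0) :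
    ∫ s, retr ((Z₀ + X s) ^ 2) ∂P =
      (d : ℝ)⁻¹ * ∑ a, ∑ b, (Z₀ a b * Z₀ b a + ∫ s, X s a b * X s b a ∂P).re := by
  have hi : ∀ a b, Integrable (fun s => X s a b) P := fun a b =>
    (hXp a b).integrable one_le_two
  have hii : ∀ a b, Integrable (fun s => X s a b * X s b a) P := fun a b =>
    (hXp a b).integrable_mul (hXp b a)
  have e : ∀ a b s, (Z₀ + X s) a b * (Z₀ + X s) b a =
      Z₀ a b * Z₀ b a + (Z₀ a b * X s b a + Z₀ b a * X s a b) + X s a b * X s b a := by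
    intro a b s
    simp only [Matrix.add_apply]
    ring
  have hI1 : ∀ a b, Integrable (fun s => Z₀ a b * Z₀ b a +
      (Z₀ a b * X s b a + Z₀ b a * X s a b)) P := fun a b =>
    (integrable_const _).add (((hi b a).const_mul _).add ((hi a b).const_mul _))
  have hI : ∀ a b, Integrable (fun s => (Z₀ + X s) a b * (Z₀ + X s) b a) P := fun a b => by
    simp only [e]
    exact (hI1 a b).add (hii a b)
  have hre : ∀ a b, ∫ s, ((Z₀ + X s) a b * (Z₀ + X s) b a).re ∂P =
      (Z₀ a b * Z₀ b a + ∫ s, X s a b * X s b a ∂P).re := fun a b => by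
    have h1 : ∫ s, ((Z₀ + X s) a b * (Z₀ + X s) b a).re ∂P =
      (∫ s, (Z₀ + X s) a b * (Z₀ + X s) b a ∂P).re := integral_re (hI a b)
    rw [h1]
    simp only [e]
    have hA : Integrable (fun s => Z₀ a b * X s b a) P := (hi b a).const_mul _
    have hB : Integrable (fun s => Z₀ b a * X s a b) P := (hi a b).const_mul _
    have hAB : Integrable (fun s => Z₀ a b * X s b a + Z₀ b a * X s a b) P := hA.add hB
    have hA0 : ∫ s, Z₀ a b * X s b a ∂P = 0 := by
      rw [integral_const_mul (Z₀ a b) fun s => X s b a, hX0, mul_zero]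
    have hB0 : ∫ s, Z₀ b a * X s a b ∂P = 0 := by
      rw [integral_const_mul (Z₀ b a) fun s => X s a b, hX0, mul_zero]
    rw [integral_add (hI1 a b) (hii a b), integral_add (integrable_const _) hAB,
      integral_add hA hB, hA0, hB0]
    simp
  have hr : ∀ s, retr ((Z₀ + X s) ^ 2) =
      (d : ℝ)⁻¹ * ∑ a, ∑ b, ((Z₀ + X s) a b * (Z₀ + X s) b a).re := fun s => by
    rw [retr_eq, pow_two]
    simp only [Matrix.mul_apply, Complex.re_sum]
  have hIre : ∀ a b, Integrable (fun s => ((Z₀ + X s) a b * (Z₀ + X s) b a).re) P :=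
    fun a b => (hI a b).re
  simp only [hr]
  rw [integral_const_mul, integral_finsetSum _ fun a _ => integrable_finsetSum _ fun b _ =>
    hIre a b]
  congr 1
  refine Finset.sum_congr rfl fun a _ => ?_
  rw [integral_finsetSum _ fun b _ => hIre a b]
  exact Finset.sum_congr rfl fun b _ => hre a b

end GaussianModel

/-! ### Comparison with the Gaussian model and conclusion. -/

section Main

variable {d n : ℕ} {Ω Ω' : Type*} [MeasurableSpace Ω] [MeasurableSpace Ω'] {μ : Measure Ω}
  [IsProbabilityMeasure μ] {ν : Measure Ω'} [IsProbabilityMeasure ν]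
  {Z₀ : Matrix (Fin d) (Fin d) ℂ} {Z : Fin n → Ω → Matrix (Fin d) (Fin d) ℂ}
  {X : Ω → Matrix (Fin d) (Fin d) ℂ} {G : Ω' → Matrix (Fin d) (Fin d) ℂ}

/-- For a Hermitian matrix conjugating an entry transposes it, so the covariance determines the
unconjugated second moments that a rotation pair must match. -/
lemma integral_mul_eq_matCov {T : Type*} [MeasurableSpace T] {m : Measure T}
    {M : T → Matrix (Fin d) (Fin d) ℂ} (hM : ∀ t, (M t).IsHermitian)
    (hZ : Z₀.IsHermitian) (hmean : matMean m M = Z₀) (a b e f : Fin d) :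
    ∫ t, (M t - Z₀) a b * (M t - Z₀) e f ∂m = matCov m M (a, b) (f, e) := by
  simp only [matCov, Matrix.of_apply, hmean]
  congr 1 with t
  congr 1
  exact (((hM t).sub hZ).apply e f).symm

/-- Moments of a sum of independent matrices are close to those of its Gaussian model. -/
theorem abs_moment_sub_gaussian_le (hd : d ≠ 0) (hZ : Z₀.IsHermitian)
    (hherm : ∀ i ω, (Z i ω).IsHermitian) (hmeas : ∀ i a b, Measurable fun ω => Z i ω a b)
    {p : ℕ} (hp : 1 ≤ p) (hmem : ∀ i a b, MemLp (fun ω => Z i ω a b) (2 * p : ℕ) μ)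
    (hind : iIndepFun (fun i ω (a b : Fin d) => Z i ω a b) μ)
    (hmean : ∀ i, matMean μ (Z i) = 0) (hX : ∀ ω, X ω = Z₀ + ∑ i, Z i ω)
    (hG : IsGaussianModel μ X ν G) {R : ℝ} (hR : 0 < R)
    (hτ : ∑ i, ∫ ω, retr (Z i ω ^ (2 * p)) ∂μ ≤
      R ^ (2 * p - 2) * (R ^ 2 + ∑ i, ∫ ω, retr (Z i ω ^ 2) ∂μ)) :
    |(∫ ω, retr (X ω ^ (2 * p)) ∂μ) ^ (1 / (2 * (p : ℝ))) -
      (∫ ω, retr (G ω ^ (2 * p)) ∂ν) ^ (1 / (2 * (p : ℝ)))| ≤ 8176 * p ^ 2 * R := by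
  set γ : Measure ((Fin d × Fin d) ⊕ (Fin d × Fin d) → ℝ) :=
    ν.map fun ω => reImEntries (G ω) with hγ
  have hγG : IsGaussian γ := hG.gaussian.isGaussian_map
  -- `X` and its Gaussian model are put on one space independently, which makes them uncorrelated.
  set P : Measure (Ω × ((Fin d × Fin d) ⊕ (Fin d × Fin d) → ℝ)) := μ.prod γ with hP
  have hfst : MeasurePreserving Prod.fst P μ := measurePreserving_fst
  have hsnd : MeasurePreserving Prod.snd P γ := measurePreserving_snd
  have hle2 : (1 : ℝ≥0∞) ≤ (2 * p : ℕ) := by exact_mod_cast (by omega : 1 ≤ 2 * p)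
  have hle22 : (2 : ℝ≥0∞) ≤ (2 * p : ℕ) := by exact_mod_cast (by omega : 2 ≤ 2 * p)
  have hmean' : ∀ i a b, ∫ ω, Z i ω a b ∂μ = 0 := fun i a b => congrFun (congrFun (hmean i) a) b
  -- transfer to the product space
  have tr1 : ∀ {E : Type} [NormedAddCommGroup E] [NormedSpace ℝ E] {f : Ω → E},
      AEStronglyMeasurable f μ → ∫ s, f s.1 ∂P = ∫ ω, f ω ∂μ := by
    intro E _ _ f hf
    rw [← hfst.map_eq] at hf
    conv_rhs => rw [← hfst.map_eq, integral_map hfst.measurable.aemeasurable hf]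
  have tr2 : ∀ {E : Type} [NormedAddCommGroup E] [NormedSpace ℝ E]
      {F : Matrix (Fin d) (Fin d) ℂ → E}, StronglyMeasurable (fun v => F (ofReIm v)) →
      ∫ s, F (ofReIm s.2) ∂P = ∫ ω, F (G ω) ∂ν := by
    intro E _ _ F hF
    rw [← integral_comp_ofReIm hG.isHermitian hG.gaussian.aemeasurable hF.aestronglyMeasurable,
      ← hγ]
    conv_rhs => rw [← hsnd.map_eq, integral_map hsnd.measurable.aemeasurable
      hF.aestronglyMeasurable]
  -- centered sums
  have hSm : ∀ a b, Measurable fun ω => (∑ i, Z i ω) a b := fun a b => by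
    simp only [Matrix.sum_apply]
    exact Finset.measurable_sum _ fun i _ => hmeas i a b
  have hSp : ∀ a b, MemLp (fun ω => (∑ i, Z i ω) a b) (2 * p : ℕ) μ := fun a b => by
    simp only [Matrix.sum_apply]
    exact memLp_finsetSum _ fun i _ => hmem i a b
  have hS0 : ∀ a b, ∫ ω, (∑ i, Z i ω) a b ∂μ = 0 := fun a b => by
    simp only [Matrix.sum_apply]
    rw [integral_finsetSum _ fun i _ => (hmem i a b).integrable hle2]
    exact Finset.sum_eq_zero fun i _ => hmean' i a b
  have hXherm : ∀ ω, (X ω).IsHermitian := fun ω => by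
    rw [hX, Matrix.IsHermitian, Matrix.conjTranspose_add, Matrix.conjTranspose_sum, hZ.eq]
    congr 1
    exact Finset.sum_congr rfl fun i _ => hherm i ω
  have hXmean : matMean μ X = Z₀ := by
    ext a b
    simp only [matMean, Matrix.of_apply, hX, Matrix.add_apply]
    rw [integral_add (integrable_const _) ((hSp a b).integrable hle2), hS0]
    simp
  have hGmean : matMean ν G = Z₀ := hG.mean_eq.trans hXmean
  have hYG : HasGaussianLaw (fun s : Ω × ((Fin d × Fin d) ⊕ (Fin d × Fin d) → ℝ) => s.2) P :=
    ⟨by have : P.map Prod.snd = γ := hsnd.map_eq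
        rw [this]; exact hγG⟩
  set V : Ω × ((Fin d × Fin d) ⊕ (Fin d × Fin d) → ℝ) → Matrix (Fin d) (Fin d) ℂ :=
    fun s => ofReIm s.2 - Z₀ with hV
  have hVh : ∀ s, (V s).IsHermitian := fun s => (isHermitian_ofReIm _).sub hZ
  have hTm : ∀ a b, Measurable fun s : Ω × ((Fin d × Fin d) ⊕ (Fin d × Fin d) → ℝ) =>
      ofReIm s.2 a b := fun a b => (measurable_ofReIm a b).comp measurable_snd
  have hVm : ∀ a b, Measurable fun s => V s a b := fun a b => (hTm a b).sub_const _
  have hVp : ∀ a b, MemLp (fun s => V s a b) (2 * p : ℕ) P := fun a b =>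
    (memLp_ofReIm hYG _ a b).sub (memLp_const _)
  have hV0 : ∀ a b, ∫ s, V s a b ∂P = 0 := fun a b => by
    have h1 := tr2 (F := fun M => M a b) (measurable_ofReIm a b).stronglyMeasurable
    have h2 : ∫ ω, G ω a b ∂ν = Z₀ a b := congrFun (congrFun hGmean a) b
    simp only [hV, Matrix.sub_apply]
    rw [integral_sub ((memLp_ofReIm hYG _ a b).integrable hle2) (integrable_const _), h1, h2]
    simp
  have hXV : ∀ a b e f, ∫ s : Ω × ((Fin d × Fin d) ⊕ (Fin d × Fin d) → ℝ),
      (∑ i, Z i s.1) a b * (∑ i, Z i s.1) e f ∂P = ∫ s, V s a b * V s e f ∂P := by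
    intro a b e f
    have h1 := tr1 (f := fun ω => (∑ i, Z i ω) a b * (∑ i, Z i ω) e f)
      ((hSm a b).mul (hSm e f)).aestronglyMeasurable
    have h2 := tr2 (F := fun M => (M - Z₀) a b * (M - Z₀) e f)
      (((measurable_ofReIm a b).sub_const _).mul
        ((measurable_ofReIm e f).sub_const _)).stronglyMeasurable
    have h3 := integral_mul_eq_matCov (m := μ) hXherm hZ hXmean a b e f
    have h4 := integral_mul_eq_matCov (m := ν) hG.isHermitian hZ hGmean a b e f
    rw [h1, h2, h4, hG.cov_eq, ← h3]
    simp only [hX, add_sub_cancel_left]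
  have hXend : ∫ s : Ω × ((Fin d × Fin d) ⊕ (Fin d × Fin d) → ℝ),
      retr ((Z₀ + ∑ i, Z i s.1) ^ (2 * p)) ∂P = ∫ ω, retr (X ω ^ (2 * p)) ∂μ := by
    have := tr1 (f := fun ω => retr ((Z₀ + ∑ i, Z i ω) ^ (2 * p)))
      (measurable_retr_pow (fun a b => (hSm a b).const_add _) _).aestronglyMeasurable
    rw [this]
    simp only [hX]
  have hVend : ∫ s, retr ((Z₀ + V s) ^ (2 * p)) ∂P = ∫ ω, retr (G ω ^ (2 * p)) ∂ν := by
    rw [← tr2 (F := fun M => retr (M ^ (2 * p)))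
      (measurable_retr_pow measurable_ofReIm _).stronglyMeasurable]
    simp only [hV, add_sub_cancel]
  rw [← hXend, ← hVend]
  -- The doubling argument needs `p ≥ 2`; for `p = 1` mean and covariance determine the moment and
  -- the difference is zero.
  obtain rfl | hp2 := hp.eq_or_lt
  · have e1 := integral_retr_add_sq_eq (P := P) (Z₀ := Z₀) (X := fun s => ∑ i, Z i s.1)
      (fun a b => ((hSp a b).comp_measurePreserving hfst).mono_exponent hle22)
      (fun a b => (tr1 (hSm a b).aestronglyMeasurable).trans (hS0 a b))
    have e2 := integral_retr_add_sq_eq (P := P) (Z₀ := Z₀) (X := V)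
      (fun a b => (hVp a b).mono_exponent hle22) hV0
    simp only [hXV] at e1
    rw [mul_one, e1, e2, sub_self, abs_zero]
    positivity
  · refine abs_moment_sub_stable_le (P := P) (Z := fun i s => Z i s.1) hp2 hd hZ
      (fun i s => hherm i _) (fun i a b => (hmeas i a b).comp measurable_fst)
      (fun i a b => (hmem i a b).comp_measurePreserving hfst)
      (iIndepFun_comp_measurePreserving hfst
        (f := fun i ω => (fun a b => Z i ω a b : Fin d → Fin d → ℂ))
        (fun i => measurable_pi_lambda _ fun a =>
          measurable_pi_lambda _ fun b => hmeas i a b) hind)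
      (fun i a b => (tr1 (hmeas i a b).aestronglyMeasurable).trans (hmean' i a b)) hR ?_ hVh hVm
      hVp hV0 hXV ?_ ?_
    · have h1 : ∀ (k : ℕ) i, ∫ s : Ω × ((Fin d × Fin d) ⊕ (Fin d × Fin d) → ℝ),
          retr (Z i s.1 ^ k) ∂P = ∫ ω, retr (Z i ω ^ k) ∂μ := fun k i =>
        tr1 (f := fun ω => retr (Z i ω ^ k)) (measurable_retr_pow (hmeas i) k).aestronglyMeasurable
      simp only [h1]
      exact hτ
    · intro a b e f
      have h1 := integral_prod_mul (μ := μ) (ν := γ) (fun ω => (∑ i, Z i ω) a b)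
        (fun v => (ofReIm v - Z₀) e f)
      rw [hS0, zero_mul] at h1
      exact h1
    · intro c N hc
      have hm : ∫ s : Ω × ((Fin d × Fin d) ⊕ (Fin d × Fin d) → ℝ), s.2 ∂P = reImEntries Z₀ := by
        funext x
        have hi : ∀ y, Integrable
            (fun s : Ω × ((Fin d × Fin d) ⊕ (Fin d × Fin d) → ℝ) => s.2 y) P := fun y =>
          Integrable.eval hYG.integrable y
        have hGi : ∀ a b, Integrable (fun ω => G ω a b) ν := fun a b => by
          have := (memLp_ofReIm hG.gaussian (2 * p) a b).integrable hle2
          simpa only [ofReIm_reImEntries (hG.isHermitian _)] using this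
        have h1 : ∫ s, s.2 x ∂P = ∫ v, v x ∂γ := by
          conv_rhs => rw [← hsnd.map_eq, integral_map hsnd.measurable.aemeasurable
            (measurable_pi_apply x).aestronglyMeasurable]
        rw [eval_integral hi, h1, hγ, integral_map hG.gaussian.aemeasurable
          (measurable_pi_apply x).aestronglyMeasurable]
        rcases x with ⟨a, b⟩ | ⟨a, b⟩
        · have h2 : ∫ ω, (G ω a b).re ∂ν = (∫ ω, G ω a b ∂ν).re := integral_re (hGi a b)
          have h3 : ∫ ω, G ω a b ∂ν = Z₀ a b := congrFun (congrFun hGmean a) b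
          simp only [reImEntries, Sum.elim_inl]
          rw [h2, h3]
        · have h2 : ∫ ω, (G ω a b).im ∂ν = (∫ ω, G ω a b ∂ν).im := integral_im (hGi a b)
          have h3 : ∫ ω, G ω a b ∂ν = Z₀ a b := congrFun (congrFun hGmean a) b
          simp only [reImEntries, Sum.elim_inr]
          rw [h2, h3]
      have hlaw := map_iidCopies_gaussian_sum (P := P) measurable_snd hYG hm hc
      have hTZ := ofReIm_reImEntries hZ
      have h1 : ∀ ω : ℕ → Ω × ((Fin d × Fin d) ⊕ (Fin d × Fin d) → ℝ), iidSum Z₀ c N V ω =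
          ofReIm (reImEntries Z₀ + c • ∑ j ∈ Finset.range N, ((ω j).2 - reImEntries Z₀)) := by
        intro ω
        simp only [iidSum, hV, ofReIm_add, ofReIm_smul, ofReIm_sum, ofReIm_sub, hTZ]
      have hmr : Measurable fun v : (Fin d × Fin d) ⊕ (Fin d × Fin d) → ℝ =>
          retr (ofReIm v ^ (2 * p)) := measurable_retr_pow measurable_ofReIm _
      simp only [h1]
      have hWm : Measurable fun ω : ℕ → Ω × ((Fin d × Fin d) ⊕ (Fin d × Fin d) → ℝ) =>
          reImEntries Z₀ + c • ∑ j ∈ Finset.range N, ((ω j).2 - reImEntries Z₀) := by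
        fun_prop
      have h2 := integral_map (μ := iidCopies P) hWm.aemeasurable
        (f := fun v => retr (ofReIm v ^ (2 * p))) hmr.aestronglyMeasurable
      rw [← h2, hlaw, integral_map measurable_snd.aemeasurable hmr.aestronglyMeasurable]
      simp only [hV, add_sub_cancel]

end Main

theorem mainTheorem12 :
    ∃ C : ℝ, 0 < C ∧
      ∀ (d n : ℕ), 2 ≤ d →
      ∀ (Ω : Type*) [MeasurableSpace Ω] (μ : Measure Ω) [IsProbabilityMeasure μ]
        (Ω' : Type*) [MeasurableSpace Ω'] (ν : Measure Ω') [IsProbabilityMeasure ν]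
        (Z₀ : Matrix (Fin d) (Fin d) ℂ) (Z : Fin n → Ω → Matrix (Fin d) (Fin d) ℂ)
        (X : Ω → Matrix (Fin d) (Fin d) ℂ) (G : Ω' → Matrix (Fin d) (Fin d) ℂ),
      Z₀.IsHermitian →
      (∀ i ω, (Z i ω).IsHermitian) →
      (∀ i a b, Measurable fun ω => Z i ω a b) →
      (∀ i a b, MemLp (fun ω => Z i ω a b) 2 μ) →
      iIndepFun (fun i ω (a b : Fin d) => Z i ω a b) μ →
      (∀ i, matMean μ (Z i) = 0) →
      (∀ ω, X ω = Z₀ + ∑ i, Z i ω) →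
      IsGaussianModel μ X ν G →
      ∀ (p : ℕ), 1 ≤ p → ∀ (q : ℝ≥0∞), 2 * (p : ℝ≥0∞) ≤ q →
        Integrable (fun ω => (ntr (G ω ^ (2 * p))).re) ν ∧
        (matR μ Z q ≠ ∞ → Integrable (fun ω => (ntr (X ω ^ (2 * p))).re) μ) ∧
        ENNReal.ofReal
            |(∫ ω, (ntr (X ω ^ (2 * p))).re ∂μ) ^ (1 / (2 * (p : ℝ))) -
              (∫ ω, (ntr (G ω ^ (2 * p))).re ∂ν) ^ (1 / (2 * (p : ℝ)))|
          ≤ ENNReal.ofReal C * matR μ Z q * (p : ℝ≥0∞) ^ 2 := by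
  -- `8176 = 7 * 1168`: the bound on the geometric series times the cost of one rotation.
  refine ⟨8176, by norm_num, ?_⟩
  intro d n hd Ω _ μ _ Ω' _ ν _ Z₀ Z X G hZ hherm hmeas hmem hind hmean hX hG p hp q hq
  have hXm : ∀ a b, Measurable fun ω => X ω a b := fun a b => by
    simp only [hX, Matrix.add_apply, Matrix.sum_apply]
    exact (Finset.measurable_sum _ fun i _ => hmeas i a b).const_add _
  have hbound : matR μ Z q ≠ ∞ → ∀ ε : ℝ, 0 < ε →
      matR μ Z q ≤ ENNReal.ofReal ((matR μ Z q).toReal + ε) := fun hR ε hε => by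
    conv_lhs => rw [← ENNReal.ofReal_toReal hR]
    exact ENNReal.ofReal_le_ofReal (by linarith)
  have hpos : ∀ ε : ℝ, 0 < ε → 0 < (matR μ Z q).toReal + ε := fun ε hε =>
    add_pos_of_nonneg_of_pos ENNReal.toReal_nonneg hε
  refine ⟨integrable_retr_gaussian hG.isHermitian hG.gaussian (2 * p), fun hR => ?_, ?_⟩
  · refine integrable_retr_pow_of_memLp (r := 2 * p) hXm fun a b => ?_
    simp only [hX, Matrix.add_apply, Matrix.sum_apply]
    have h1 : ∀ i, MemLp (fun ω => Z i ω a b) (2 * p : ℕ) μ := fun i =>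
      memLp_entry_of_matR_le hherm hmeas hmem hp hq (hpos 1 one_pos) (hbound hR 1 one_pos) i a b
    have h2 : MemLp (fun ω => ∑ i, Z i ω a b) (2 * p : ℕ) μ := memLp_finsetSum _ fun i _ => h1 i
    exact (memLp_const (Z₀ a b)).add h2
  · by_cases hR : matR μ Z q = ∞
    · have hp0 : (p : ℝ≥0∞) ^ 2 ≠ 0 := pow_ne_zero _ (by exact_mod_cast (by omega : p ≠ 0))
      rw [hR, ENNReal.mul_top (by norm_num), ENNReal.top_mul hp0]
      exact le_top
    -- The comparison requires `R > 0`, whereas `R_q` may vanish; hence `R_q + ε`, followed by `ε →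
    -- 0`.
    · have key : ∀ ε : ℝ, 0 < ε →
          |(∫ ω, retr (X ω ^ (2 * p)) ∂μ) ^ (1 / (2 * (p : ℝ))) -
            (∫ ω, retr (G ω ^ (2 * p)) ∂ν) ^ (1 / (2 * (p : ℝ)))| ≤
            8176 * p ^ 2 * ((matR μ Z q).toReal + ε) := fun ε hε => by
        have h1 := memLp_entry_of_matR_le hherm hmeas hmem hp hq (hpos ε hε) (hbound hR ε hε)
        have h2 := sum_integral_pow_le_of_matR_le hherm hmeas hmem hp hq (hpos ε hε)
          (hbound hR ε hε)
        have hd0 : d ≠ 0 := by omega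
        exact abs_moment_sub_gaussian_le (μ := μ) (ν := ν) (Z := Z) (X := X) (G := G) hd0 hZ hherm
          hmeas hp h1 hind hmean hX hG (hpos ε hε) h2
      have hlim : Filter.Tendsto
          (fun ε : ℝ => 8176 * (p : ℝ) ^ 2 * ((matR μ Z q).toReal + ε))
          (nhdsWithin 0 (Set.Ioi 0)) (nhds (8176 * (p : ℝ) ^ 2 * ((matR μ Z q).toReal + 0))) :=
        (Continuous.tendsto (by fun_prop) 0).mono_left nhdsWithin_le_nhds
      have hfin := ge_of_tendsto hlim (by
        filter_upwards [self_mem_nhdsWithin] with ε hε using key ε hε)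
      rw [add_zero] at hfin
      refine (ENNReal.ofReal_le_ofReal hfin).trans (le_of_eq ?_)
      rw [ENNReal.ofReal_mul (by positivity), ENNReal.ofReal_mul (by norm_num),
        ENNReal.ofReal_toReal hR, ENNReal.ofReal_pow (by positivity), ENNReal.ofReal_natCast]
      ring
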